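/- All languages are over $\{0,1\}$. A set $S$ is sparse if for some polynomial $q$ it has at most $q(m)$ strings of length at most $m$, for every $m\ge 0$; it is Turing-hard for a class $\mathcal C$ if $\mathcal C\subseteq \mathrm{P}^S$. A DPOM (NPOM) is a deterministic (nondeterministic) oracle Turing machine all of whose computation paths halt within a number of steps that is polynomial in the input length, whatever the oracle is. $\mathrm{UP}^A$ is the class of languages $L(N^A)$ of NPOMs $N$ such that $N^A$ has at most one accepting path on every input, and $\mathrm{UP}=\mathrm{UP}^\emptyset$. For a class $\mathcal C$, a superscript $\mathcal C$ denotes the union over all oracles in $\mathcal C$. Put $\Sigma_0^{p}=\mathrm P$, $\Sigma_{k+1}^{p}=\mathrm{NP}^{\Sigma_k^{p}}$, $\mathrm U\Sigma_0^{p,A}=\mathrm P^A$, $\mathrm U\Sigma_{k+1}^{p,A}=\mathrm{UP}^{\mathrm U\Sigma_k^{p,A}}$, $\mathrm U\Sigma_k^p=\mathrm U\Sigma_k^{p,\emptyset}$, and $\mathrm{Low}_2=\{A\in\mathrm{NP} : \mathrm{NP}^{\mathrm{NP}^A}\subseteq\mathrm{NP}^{\mathrm{NP}}\}$. Oracle access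 to $\mathcal U\Sigma_i^p$ (the $i$-th level of the promise unambiguous polynomial hierarchy) is guardedly unambiguous: only computations that are actually executed have to be unambiguous. Precisely, a tower of height $i$ consists of NPOMs $N_1,\dots,N_i$ and a bottom set $E\in\mathrm P$; the oracle of $N_l$ is $L_{l+1}$, where $L_{i+1}=E$ and $L_l=L(N_l^{L_{l+1}})$, and the language of the tower is $L_1$. The tower is guarded at a string $z$ if $i=0$, or if $N_1(z)$ has at most one accepting path and the tower $N_2,\dots,N_i,E$ is guarded at every string that $N_1(z)$ queries on some path. - $\Sigma_2^{p,\,\mathcal U\Sigma_i^p}$ is the class of languages $L\bigl(M_1^{L(M_2^{L_1})}\bigr)$, where $M_1,M_2$ are NPOMs and $L_1$ is the language of a tower of height $i$ such that, for every input $x$, every string $q$ queried by $M_1(x)$ and every string $q'$ queried by $M_2(q)$, the tower is guarded at $q'$. - $\mathrm P^{\,\mathcal U\Sigma_i^p\oplus\Sigma_2^p}$ is the class of languages $L(M^{L_1\oplus D})$, where $M$ is a DPOM, $D\in\Sigma_2^p$, $L_1\oplus D=\{0y : y\in L_1\}\cup\{1y : y\in D\}$, and $L_1$ is the language of a tower of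 height $i$ such that, whenever $M$ queries $0q$ on some input, the tower is guarded at $q$. **Theorem.** If there exists a sparse Turing-hard set for $\mathrm{UP}$, then 1. $\mathrm{UP}\subseteq\mathrm{Low}_2$, and 2. for every $k\ge 3$ and every $j$ with $0\le j\le k-3$, $$\mathrm U\Sigma_k^p\ \subseteq\ \mathrm U\Sigma_j^{p,\ \Sigma_2^{p,\,\mathcal U\Sigma_{k-j-3}^p}}\ \cap\ \mathrm P^{\,\mathcal U\Sigma_{k-1}^p\oplus\Sigma_2^p}.$$ -/

import Mathlib

namespace SparseUP

/-! ### Strings, languages, classes -/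

/-- Strings over the alphabet `{0,1}`. -/
abbrev Str := List Bool

/-- Languages over the alphabet `{0,1}`. -/
abbrev Lang := Set Str

/-- `S` is sparse: the number of strings of length at most `m` in `S` is polynomially bounded. -/
def Sparse (S : Lang) : Prop :=
  ∃ q : Polynomial ℕ, ∀ m : ℕ, {x | x ∈ S ∧ x.length ≤ m}.ncard ≤ q.eval m

/-- The join `{0x | x ∈ A} ∪ {1x | x ∈ B}`. -/
def join (A B : Lang) : Lang :=
  {y | (∃ x ∈ A, y = false :: x) ∨ (∃ x ∈ B, y = true :: x)}

/-- `𝓡^𝓒`, the union of the classes `𝓡^A` over the oracles `A ∈ 𝓒`. -/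
def relTo (R : Lang → Set Lang) (C : Set Lang) : Set Lang :=
  {L | ∃ A ∈ C, L ∈ R A}

/-! ### The machine model: nondeterministic oracle machines

A machine has finitely many one-way infinite work tapes, each used as a stack of bits (two stacks
are a Turing tape, so this is the multitape Turing machine up to a constant factor in time). Its
finite control is presented as a structured program. In one step a machine changes or inspects the
top cell of one stack, or makes a binary nondeterministic choice, or asks its oracle about the
string that is written on one of its stacks. -/

/-- Programs of nondeterministic oracle machines; tapes are numbered by natural numbers. -/
inductive Prog : Type
  /-- do nothing -/
  | skip : Prog
  /-- write the bit `b` on top of tape `r` -/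
  | push (r : ℕ) (b : Bool) : Prog
  /-- erase the top bit of tape `r` (if there is one) -/
  | pop (r : ℕ) : Prog
  /-- first `c₁`, then `c₂` -/
  | seq (c₁ c₂ : Prog) : Prog
  /-- branch on the top of tape `r`: `c₁` if it is `1`, `c₀` if it is `0`, `cₑ` if `r` is empty -/
  | test (r : ℕ) (c₁ c₀ cₑ : Prog) : Prog
  /-- as long as tape `r` is not empty, execute `c` -/
  | loop (r : ℕ) (c : Prog) : Prog
  /-- ask the oracle about the string on tape `r`: go on with `c₁` if the answer is yes,
  with `c₀` if it is no -/
  | ask (r : ℕ) (c₁ c₀ : Prog) : Prog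
  /-- nondeterministically go on with `c₁` (choice `1`) or with `c₀` (choice `0`) -/
  | guess (c₁ c₀ : Prog) : Prog

/-- The contents of the tapes. The first element of a list is the top of the stack. -/
abbrev Store := ℕ → Str

/-- `Run A c s g Q t s'`: with oracle `A` and started with tape contents `s`, the program `c` has a
halting computation path, along which the nondeterministic choices are, in this order, the bits of
`g`, the oracle is asked about the strings in the list `Q`, exactly `t` steps are made, and the
tape contents at the end are `s'`. A path is determined by its sequence `g` of choices. -/
inductive Run (A : Lang) : Prog → Store → List Bool → List Str → ℕ → Store → Prop
  | skip (s : Store) : Run A .skip s [] [] 1 s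
  | push (r : ℕ) (b : Bool) (s : Store) :
      Run A (.push r b) s [] [] 1 (Function.update s r (b :: s r))
  | pop (r : ℕ) (s : Store) : Run A (.pop r) s [] [] 1 (Function.update s r (s r).tail)
  | seq {c₁ c₂ : Prog} {s s' s'' : Store} {g g' : List Bool} {Q Q' : List Str} {t t' : ℕ} :
      Run A c₁ s g Q t s' → Run A c₂ s' g' Q' t' s'' →
      Run A (.seq c₁ c₂) s (g ++ g') (Q ++ Q') (t + t') s''
  | test_one {r : ℕ} {c₁ c₀ cₑ : Prog} {s s' : Store} {g : List Bool} {Q : List Str} {t : ℕ} :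
      (s r).head? = some true → Run A c₁ s g Q t s' → Run A (.test r c₁ c₀ cₑ) s g Q (t + 1) s'
  | test_zero {r : ℕ} {c₁ c₀ cₑ : Prog} {s s' : Store} {g : List Bool} {Q : List Str} {t : ℕ} :
      (s r).head? = some false → Run A c₀ s g Q t s' → Run A (.test r c₁ c₀ cₑ) s g Q (t + 1) s'
  | test_empty {r : ℕ} {c₁ c₀ cₑ : Prog} {s s' : Store} {g : List Bool} {Q : List Str} {t : ℕ} :
      s r = [] → Run A cₑ s g Q t s' → Run A (.test r c₁ c₀ cₑ) s g Q (t + 1) s'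
  | loop_stop {r : ℕ} {c : Prog} {s : Store} : s r = [] → Run A (.loop r c) s [] [] 1 s
  | loop_step {r : ℕ} {c : Prog} {s s' s'' : Store} {g g' : List Bool} {Q Q' : List Str}
      {t t' : ℕ} :
      s r ≠ [] → Run A c s g Q t s' → Run A (.loop r c) s' g' Q' t' s'' →
      Run A (.loop r c) s (g ++ g') (Q ++ Q') (t + t' + 1) s''
  | ask_yes {r : ℕ} {c₁ c₀ : Prog} {s s' : Store} {g : List Bool} {Q : List Str} {t : ℕ} :
      s r ∈ A → Run A c₁ s g Q t s' → Run A (.ask r c₁ c₀) s g (s r :: Q) (t + 1) s'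
  | ask_no {r : ℕ} {c₁ c₀ : Prog} {s s' : Store} {g : List Bool} {Q : List Str} {t : ℕ} :
      s r ∉ A → Run A c₀ s g Q t s' → Run A (.ask r c₁ c₀) s g (s r :: Q) (t + 1) s'
  | guess_one {c₁ c₀ : Prog} {s s' : Store} {g : List Bool} {Q : List Str} {t : ℕ} :
      Run A c₁ s g Q t s' → Run A (.guess c₁ c₀) s (true :: g) Q (t + 1) s'
  | guess_zero {c₁ c₀ : Prog} {s s' : Store} {g : List Bool} {Q : List Str} {t : ℕ} :
      Run A c₀ s g Q t s' → Run A (.guess c₁ c₀) s (false :: g) Q (t + 1) s'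

/-- Initially the input is on tape `0`, and all other tapes are empty. -/
def init (x : Str) : Store := fun r => if r = 0 then x else []

/-- `g` is (the sequence of choices of) an accepting path of `M^A(x)`: a halting path at whose end
tape `1` is not empty. -/
def AcceptingPath (A : Lang) (M : Prog) (x : Str) (g : List Bool) : Prop :=
  ∃ Q t s', Run A M (init x) g Q t s' ∧ s' 1 ≠ []

/-- The language `L(M^A)`. -/
def langOf (A : Lang) (M : Prog) : Lang := {x | ∃ g, AcceptingPath A M x g}

/-- `M^A(x)` has at most one accepting path. -/
def UnambiguousAt (A : Lang) (M : Prog) (x : Str) : Prop :=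
  ∀ g g', AcceptingPath A M x g → AcceptingPath A M x g' → g = g'

/-- On some computation path, `M^A(x)` asks the oracle about `q`. -/
def Asks (A : Lang) (M : Prog) (x q : Str) : Prop :=
  ∃ g Q t s', Run A M (init x) g Q t s' ∧ q ∈ Q

/-- `M` is an NPOM: there is a polynomial `p` such that, whatever the oracle is, every computation
path on an input of length `n` halts within `p(n)` steps. (Every infinite sequence `ω` of choices
starts with the choices `g` of a path that halts in time.) -/
def IsNPOM (M : Prog) : Prop :=
  ∃ p : Polynomial ℕ, ∀ (A : Lang) (x : Str) (ω : Stream' Bool),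
    ∃ g ω' Q t s', ω = g ++ₛ ω' ∧ Run A M (init x) g Q t s' ∧ t ≤ p.eval x.length

/-- The program makes no nondeterministic choices. -/
def Prog.Deterministic : Prog → Prop
  | .skip => True
  | .push _ _ => True
  | .pop _ => True
  | .seq c₁ c₂ => c₁.Deterministic ∧ c₂.Deterministic
  | .test _ c₁ c₀ cₑ => c₁.Deterministic ∧ c₀.Deterministic ∧ cₑ.Deterministic
  | .loop _ c => c.Deterministic
  | .ask _ c₁ c₀ => c₁.Deterministic ∧ c₀.Deterministic
  | .guess _ _ => False

/-- `M` is a DPOM, a deterministic polynomial-time oracle machine. -/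
def IsDPOM (M : Prog) : Prop := M.Deterministic ∧ IsNPOM M

/-! ### Complexity classes and hierarchies -/

/-- `P^A`. -/
def PRel (A : Lang) : Set Lang := {L | ∃ M, IsDPOM M ∧ L = langOf A M}

/-- `NP^A`. -/
def NPRel (A : Lang) : Set Lang := {L | ∃ M, IsNPOM M ∧ L = langOf A M}

/-- `UP^A`: the machine has at most one accepting path on every input with this oracle `A`. -/
def UPRel (A : Lang) : Set Lang :=
  {L | ∃ M, IsNPOM M ∧ (∀ x, UnambiguousAt A M x) ∧ L = langOf A M}

/-- The class P. -/
def P : Set Lang := PRel ∅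

/-- The class NP. -/
def NP : Set Lang := NPRel ∅

/-- The class UP. -/
def UP : Set Lang := UPRel ∅

/-- `S` is Turing-hard for the class `C` (under polynomial-time Turing reductions). -/
def TuringHard (S : Lang) (C : Set Lang) : Prop := ∀ A ∈ C, A ∈ PRel S

/-- `Low₂`, the second level of the low hierarchy. -/
def Low2 : Set Lang := {A | A ∈ NP ∧ relTo NPRel (NPRel A) ⊆ relTo NPRel NP}

/-- The levels `Σ_k^{p,A}` of the polynomial hierarchy relative to `A`. -/
def SigmaRel : ℕ → Lang → Set Lang
  | 0, A => PRel A
  | k + 1, A => relTo NPRel (SigmaRel k A)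

/-- The levels `UΣ_k^{p,A}` of the unambiguous polynomial hierarchy relative to `A`. -/
def USigmaRel : ℕ → Lang → Set Lang
  | 0, A => PRel A
  | k + 1, A => relTo UPRel (USigmaRel k A)

/-- `UΣ_k^p`. -/
def USigma (k : ℕ) : Set Lang := USigmaRel k ∅

/-! ### Guardedly unambiguous access -/

/-- A tower `N₁, …, N_i` of NPOMs over a bottom oracle in P: each machine of the list has the
language of the rest of the tower as its oracle. -/
structure IsTower (i : ℕ) (Ns : List Prog) (A : Lang) : Prop where
  length_eq : Ns.length = i
  npom : ∀ N ∈ Ns, IsNPOM N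
  bottom : A ∈ P

/-- The language `L(N₁^{L(N₂^{⋯})})` of a tower. -/
def towerLang (A : Lang) : List Prog → Lang
  | [] => A
  | N :: Ns => langOf (towerLang A Ns) N

/-- All computations that are executed when the tower is run on `x` are unambiguous: `N₁(x)` has at
most one accepting path; whenever `N₁(x)` asks some `q`, then `N₂(q)` has at most one accepting
path; and so on up the tower. -/
def Guarded (A : Lang) : List Prog → Str → Prop
  | [], _ => True
  | N :: Ns, x => UnambiguousAt (towerLang A Ns) N x ∧
      ∀ q, Asks (towerLang A Ns) N x q → Guarded A Ns q

/-- `Σ_2^{p,𝒰Σ_i^p}`: languages of `Σ_2` machines `M₁, M₂` over a tower of `i` NPOMs that is accessed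
in a guardedly unambiguous manner: whatever the input `x` is, the tower is run only on strings on
which all executed computations of the tower are unambiguous. -/
def Sigma2PromiseUSigma (i : ℕ) : Set Lang :=
  {L | ∃ M₁ M₂ Ns A, IsNPOM M₁ ∧ IsNPOM M₂ ∧ IsTower i Ns A ∧
    L = langOf (langOf (towerLang A Ns) M₂) M₁ ∧
    ∀ x q q', Asks (langOf (towerLang A Ns) M₂) M₁ x q → Asks (towerLang A Ns) M₂ q q' →
      Guarded A Ns q'}

/-- `P^{𝒰Σ_i^p ⊕ Σ_2^p}`: languages of DPOMs that have as oracle the join of a tower of `i` NPOMs and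
of a `Σ_2^p` set, and access the tower in a guardedly unambiguous manner. -/
def PPromiseUSigmaJoinSigma2 (i : ℕ) : Set Lang :=
  {L | ∃ M Ns A D, IsDPOM M ∧ IsTower i Ns A ∧ D ∈ SigmaRel 2 ∅ ∧
    L = langOf (join (towerLang A Ns) D) M ∧
    ∀ x q, Asks (join (towerLang A Ns) D) M x (false :: q) → Guarded A Ns q}

end SparseUP

open SparseUP

namespace SparseUP

/-! ### Basic facts about computation paths -/

/-! Let `U` be in UP, accepted by the unambiguous machine `N`. The set of prefixes of accepting
paths of `N` is again in UP, because fixing the first choices leaves at most one accepting path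
(`unambiguousAt_preM`); so it is decidable in polynomial time with the sparse set as oracle. Prefix
search turns this into a deterministic machine that decides `U` by constructing the accepting path.
On inputs of length at most m it asks only about strings of polynomial length, of which the sparse
set contains polynomially many. The list of these strings is an advice F, and a set `E` in P decides
`U` from pairs (F, u). The search accepts only when the path it has followed is accepting, so with
wrong advice it still never accepts a string outside `U` (`langOf_searchM_subset`). Errors are
one-sided, and therefore "F errs on some string of length at most m" is an NP property: guess u with
an accepting path of `N`, and see that (F, u) is rejected. This is `exists_advice`.

Now take machines N₁, N₂, … stacked over `U`. An NP machine guesses F, asks whether F is bad, and if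
not runs N₁ with each question u replaced by (F, u). The lower machines hand F down, and at the
bottom `E` replaces `U` (`tower_advice`). The guess of F merges with N₁, the NP test merges with N₂,
and so the UP level at the bottom disappears at no cost (`collapse`). With two machines over `U`
this is lowness. With more, the machines below N₂ survive as a tower. Nothing is known about their
unambiguity when F is bad, but they are run only with an F that has passed the test: this is guarded
access. The top j levels of the hierarchy are split off beforehand (`USigma_add`).

For the inclusion in a relativized P, the prefixes of the paths that guess a good F form a set in
Σ₂. A deterministic machine finds such an F by prefix search and asks the whole tower one question
(F, x) (`findM_spec`).

Most of the file programs these machines and bounds their time. The machines put into towers make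
the same choices as the machines they simulate, so accepting paths correspond one to one and
unambiguity carries over. -/

/-- Comparing the two choice lists after padding them to a common stream is what lets the induction
pass through concatenations: the first halves agree, are cancelled, and the remaining streams agree
again. -/
theorem Run.det {A : Lang} {c : Prog} {s : Store} {g : List Bool} {Q : List Str} {t : ℕ}
    {s' : Store} (h : Run A c s g Q t s') :
    ∀ {g₂ Q₂ t₂ s₂ ω ω₂}, Run A c s g₂ Q₂ t₂ s₂ → g ++ₛ ω = g₂ ++ₛ ω₂ →
      g = g₂ ∧ Q = Q₂ ∧ t = t₂ ∧ s' = s₂ := by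
  induction h with
  | skip s => intro _ _ _ _ _ _ h _; cases h; simp
  | push r b s => intro _ _ _ _ _ _ h _; cases h; simp
  | pop r s => intro _ _ _ _ _ _ h _; cases h; simp
  | seq _ _ ih₁ ih₂ =>
    intro _ _ _ _ _ _ h hω
    cases h with
    | seq k₁ k₂ =>
      rw [Stream'.append_append_stream, Stream'.append_append_stream] at hω
      obtain ⟨rfl, rfl, rfl, rfl⟩ := ih₁ k₁ hω
      obtain ⟨rfl, rfl, rfl, rfl⟩ := ih₂ k₂ (Stream'.append_right_injective _ _ _ hω)
      simp
  | test_one hr _ ih =>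
    intro _ _ _ _ _ _ h hω
    cases h with
    | test_one _ k => obtain ⟨rfl, rfl, rfl, rfl⟩ := ih k hω; simp
    | test_zero hr' => simp [hr] at hr'
    | test_empty hr' => simp [hr'] at hr
  | test_zero hr _ ih =>
    intro _ _ _ _ _ _ h hω
    cases h with
    | test_zero _ k => obtain ⟨rfl, rfl, rfl, rfl⟩ := ih k hω; simp
    | test_one hr' => simp [hr] at hr'
    | test_empty hr' => simp [hr'] at hr
  | test_empty hr _ ih =>
    intro _ _ _ _ _ _ h hω
    cases h with
    | test_empty _ k => obtain ⟨rfl, rfl, rfl, rfl⟩ := ih k hω; simp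
    | test_one hr' => simp [hr] at hr'
    | test_zero hr' => simp [hr] at hr'
  | loop_stop hr =>
    intro _ _ _ _ _ _ h _
    cases h with
    | loop_stop _ => simp
    | loop_step hr' => exact absurd hr hr'
  | loop_step hr _ _ ih₁ ih₂ =>
    intro _ _ _ _ _ _ h hω
    cases h with
    | loop_stop hr' => exact absurd hr' hr
    | loop_step _ k₁ k₂ =>
      rw [Stream'.append_append_stream, Stream'.append_append_stream] at hω
      obtain ⟨rfl, rfl, rfl, rfl⟩ := ih₁ k₁ hω
      obtain ⟨rfl, rfl, rfl, rfl⟩ := ih₂ k₂ (Stream'.append_right_injective _ _ _ hω)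
      simp
  | ask_yes hr _ ih =>
    intro _ _ _ _ _ _ h hω
    cases h with
    | ask_yes _ k => obtain ⟨rfl, rfl, rfl, rfl⟩ := ih k hω; simp
    | ask_no hr' => exact absurd hr hr'
  | ask_no hr _ ih =>
    intro _ _ _ _ _ _ h hω
    cases h with
    | ask_no _ k => obtain ⟨rfl, rfl, rfl, rfl⟩ := ih k hω; simp
    | ask_yes hr' => exact absurd hr' hr
  | guess_one _ ih =>
    intro _ _ _ _ _ _ h hω
    cases h with
    | guess_one k =>
      rw [Stream'.cons_append_stream, Stream'.cons_append_stream] at hω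
      obtain ⟨rfl, rfl, rfl, rfl⟩ := ih k (Stream'.cons_injective_right _ hω); simp
    | guess_zero k =>
      rw [Stream'.cons_append_stream, Stream'.cons_append_stream] at hω
      exact absurd (congrArg Stream'.head hω) (by simp)
  | guess_zero _ ih =>
    intro _ _ _ _ _ _ h hω
    cases h with
    | guess_zero k =>
      rw [Stream'.cons_append_stream, Stream'.cons_append_stream] at hω
      obtain ⟨rfl, rfl, rfl, rfl⟩ := ih k (Stream'.cons_injective_right _ hω); simp
    | guess_one k =>
      rw [Stream'.cons_append_stream, Stream'.cons_append_stream] at hω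
      exact absurd (congrArg Stream'.head hω) (by simp)

/-- The all-zero sequence of choices. -/
def zeros : Stream' Bool := Stream'.const false

theorem Run.det_self {A : Lang} {c : Prog} {s : Store} {g : List Bool} {Q Q₂ : List Str} {t t₂ : ℕ}
    {s' s₂ : Store} (h : Run A c s g Q t s') (h₂ : Run A c s g Q₂ t₂ s₂) :
    Q = Q₂ ∧ t = t₂ ∧ s' = s₂ :=
  (h.det h₂ (ω := zeros) (ω₂ := zeros) rfl).2

/-- Halting choice sequences are prefix-free. Prefix search relies on this to know when a path is
complete. -/
theorem Run.eq_of_prefix {A : Lang} {c : Prog} {s : Store} {g g₂ : List Bool} {Q Q₂ : List Str}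
    {t t₂ : ℕ} {s' s₂ : Store} (h : Run A c s g Q t s') (h₂ : Run A c s g₂ Q₂ t₂ s₂)
    (hp : g <+: g₂) : g = g₂ := by
  obtain ⟨k, rfl⟩ := hp
  exact (h.det h₂ (ω := k ++ₛ zeros) (ω₂ := zeros)
    (by rw [Stream'.append_append_stream])).1

/-! ### Paths along arbitrary choice sequences -/

/-- Whatever the choices are, `c` halts on a path that satisfies `Φ`. -/
def Total (A : Lang) (c : Prog) (s : Store) (Φ : List Bool → List Str → ℕ → Store → Prop) : Prop :=
  ∀ ω : Stream' Bool, ∃ g ω' Q t s', ω = g ++ₛ ω' ∧ Run A c s g Q t s' ∧ Φ g Q t s'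

/-- By `Run.det`, the path that totality supplies for a stream beginning with `g` can only be the
given one. An existence statement about streams thus becomes a statement about all paths. -/
theorem Total.of_run {A : Lang} {c : Prog} {s : Store} {Φ : List Bool → List Str → ℕ → Store → Prop}
    (h : Total A c s Φ) {g Q t s'} (hr : Run A c s g Q t s') : Φ g Q t s' := by
  obtain ⟨g₂, ω', Q₂, t₂, s₂, hω, hr₂, hΦ⟩ := h (g ++ₛ zeros)
  obtain ⟨rfl, rfl, rfl, rfl⟩ := hr.det hr₂ hω
  exact hΦ

theorem Total.mono {A : Lang} {c : Prog} {s : Store} {Φ Ψ : List Bool → List Str → ℕ → Store → Prop}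
    (h : Total A c s Φ) (hΨ : ∀ g Q t s', Run A c s g Q t s' → Φ g Q t s' → Ψ g Q t s') :
    Total A c s Ψ := by
  intro ω
  obtain ⟨g, ω', Q, t, s', hω, hr, hΦ⟩ := h ω
  exact ⟨g, ω', Q, t, s', hω, hr, hΨ _ _ _ _ hr hΦ⟩

theorem Total.seq {A : Lang} {c d : Prog} {s : Store} {Φ Ψ : List Bool → List Str → ℕ → Store → Prop}
    (h : Total A c s Φ)
    (h' : ∀ g Q t s', Run A c s g Q t s' → Φ g Q t s' →
      Total A d s' (fun g' Q' t' s'' => Ψ (g ++ g') (Q ++ Q') (t + t') s'')) :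
    Total A (.seq c d) s Ψ := by
  intro ω
  obtain ⟨g, ω', Q, t, s', rfl, hr, hΦ⟩ := h ω
  obtain ⟨g₂, ω₂, Q₂, t₂, s₂, rfl, hr₂, hΨ⟩ := h' g Q t s' hr hΦ ω'
  exact ⟨g ++ g₂, ω₂, Q ++ Q₂, t + t₂, s₂, by rw [Stream'.append_append_stream], hr.seq hr₂, hΨ⟩

theorem Total.of_det {A : Lang} {c : Prog} {s : Store}
    {Φ : List Bool → List Str → ℕ → Store → Prop} {Q t s'} (h : Run A c s [] Q t s')
    (hΦ : Φ [] Q t s') : Total A c s Φ :=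
  fun ω => ⟨[], ω, Q, t, s', rfl, h, hΦ⟩

theorem isNPOM_iff {M : Prog} : IsNPOM M ↔
    ∃ p : Polynomial ℕ, ∀ A x, Total A M (init x) (fun _ _ t _ => t ≤ p.eval x.length) := Iff.rfl

/-- A deterministic program makes no choices. -/
theorem Run.no_guess {A : Lang} {c : Prog} {s : Store} {g Q t s'} (h : Run A c s g Q t s')
    (hd : c.Deterministic) : g = [] := by
  induction h with
  | skip | push | pop | loop_stop => rfl
  | seq _ _ ih₁ ih₂ => simp [ih₁ hd.1, ih₂ hd.2]
  | test_one _ _ ih => exact ih hd.1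
  | test_zero _ _ ih => exact ih hd.2.1
  | test_empty _ _ ih => exact ih hd.2.2
  | loop_step _ _ _ ih₁ ih₂ => simp [ih₁ hd, ih₂ hd]
  | ask_yes _ _ ih => exact ih hd.1
  | ask_no _ _ ih => exact ih hd.2
  | guess_one | guess_zero => exact hd.elim

/-- One step adds at most one bit to one tape. Through this, time bounds become bounds on the
lengths of outputs and questions. -/
theorem Run.length_le {A : Lang} {c : Prog} {s : Store} {g Q t s'} (h : Run A c s g Q t s') :
    ∀ {m : ℕ}, (∀ r, (s r).length ≤ m) →
      (∀ r, (s' r).length ≤ m + t) ∧ ∀ q ∈ Q, q.length ≤ m + t := by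
  induction h with
  | skip s => intro m hm; exact ⟨fun r => (hm r).trans (by omega), by simp⟩
  | push r b s =>
    intro m hm
    refine ⟨fun r' => ?_, by simp⟩
    by_cases hr : r' = r
    · subst hr; simpa using hm r'
    · simpa [Function.update_of_ne hr] using (hm r').trans (by omega)
  | pop r s =>
    intro m hm
    refine ⟨fun r' => ?_, by simp⟩
    by_cases hr : r' = r
    · subst hr; simpa using (hm r').trans (by omega)
    · simpa [Function.update_of_ne hr] using (hm r').trans (by omega)
  | seq _ _ ih₁ ih₂ =>
    intro m hm
    obtain ⟨h₁, h₁'⟩ := ih₁ hm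
    obtain ⟨h₂, h₂'⟩ := ih₂ h₁
    refine ⟨fun r => (h₂ r).trans (by omega), fun q hq => ?_⟩
    rcases List.mem_append.1 hq with hq | hq
    · exact (h₁' q hq).trans (by omega)
    · exact (h₂' q hq).trans (by omega)
  | test_one _ _ ih | test_zero _ _ ih | test_empty _ _ ih | guess_one _ ih | guess_zero _ ih =>
    intro m hm
    exact ⟨fun r => ((ih hm).1 r).trans (by omega), fun q hq => ((ih hm).2 q hq).trans (by omega)⟩
  | loop_stop => intro m hm; exact ⟨fun r => (hm r).trans (by omega), by simp⟩
  | loop_step _ _ _ ih₁ ih₂ =>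
    intro m hm
    obtain ⟨h₁, h₁'⟩ := ih₁ hm
    obtain ⟨h₂, h₂'⟩ := ih₂ h₁
    refine ⟨fun r => (h₂ r).trans (by omega), fun q hq => ?_⟩
    rcases List.mem_append.1 hq with hq | hq
    · exact (h₁' q hq).trans (by omega)
    · exact (h₂' q hq).trans (by omega)
  | ask_yes _ _ ih | ask_no _ _ ih =>
    intro m hm
    refine ⟨fun r => ((ih hm).1 r).trans (by omega), fun q hq => ?_⟩
    rcases List.mem_cons.1 hq with rfl | hq
    · exact (hm _).trans (by omega)
    · exact ((ih hm).2 q hq).trans (by omega)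

theorem init_length_le (x : Str) (r : ℕ) : (init x r).length ≤ x.length := by
  unfold init; split <;> simp

/-- A path depends only on the answers to the questions that are asked on it. -/
theorem Run.congr_oracle {A A' : Lang} {c : Prog} {s : Store} {g Q t s'} (h : Run A c s g Q t s')
    (hQ : ∀ q ∈ Q, q ∈ A ↔ q ∈ A') : Run A' c s g Q t s' := by
  induction h with
  | skip s => exact .skip s
  | push r b s => exact .push r b s
  | pop r s => exact .pop r s
  | seq _ _ ih₁ ih₂ =>
    exact .seq (ih₁ fun q hq => hQ q (by simp [hq])) (ih₂ fun q hq => hQ q (by simp [hq]))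
  | test_one hr _ ih => exact .test_one hr (ih hQ)
  | test_zero hr _ ih => exact .test_zero hr (ih hQ)
  | test_empty hr _ ih => exact .test_empty hr (ih hQ)
  | loop_stop hr => exact Run.loop_stop hr
  | loop_step hr _ _ ih₁ ih₂ =>
    exact .loop_step hr (ih₁ fun q hq => hQ q (by simp [hq])) (ih₂ fun q hq => hQ q (by simp [hq]))
  | ask_yes hr _ ih =>
    exact .ask_yes ((hQ _ (by simp)).1 hr) (ih fun q hq => hQ q (by simp [hq]))
  | ask_no hr _ ih =>
    exact .ask_no (fun h => hr ((hQ _ (by simp)).2 h)) (ih fun q hq => hQ q (by simp [hq]))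
  | guess_one _ ih => exact .guess_one (ih hQ)
  | guess_zero _ ih => exact .guess_zero (ih hQ)

/-! ### Tapes in use, and removal of questions -/

/-- All tapes that occur in the program have numbers below `c.width`. -/
def Prog.width : Prog → ℕ
  | .skip => 0
  | .push r _ => r + 1
  | .pop r => r + 1
  | .seq c₁ c₂ => max c₁.width c₂.width
  | .test r c₁ c₀ cₑ => max (r + 1) (max c₁.width (max c₀.width cₑ.width))
  | .loop r c => max (r + 1) c.width
  | .ask r c₁ c₀ => max (r + 1) (max c₁.width c₀.width)
  | .guess c₁ c₀ => max c₁.width c₀.width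

/-- Needed to clean up after a subroutine: only finitely many tapes, known in advance, can have been
changed. -/
theorem Run.eq_of_width_le {A : Lang} {c : Prog} {s : Store} {g Q t s'} (h : Run A c s g Q t s')
    {r : ℕ} (hr : c.width ≤ r) : s' r = s r := by
  induction h with
  | skip | loop_stop => rfl
  | push r' b s | pop r' s =>
    exact Function.update_of_ne (by rintro rfl; simp [Prog.width] at hr) _ _
  | seq _ _ ih₁ ih₂ =>
    simp only [Prog.width, max_le_iff] at hr
    rw [ih₂ hr.2, ih₁ hr.1]
  | test_one _ _ ih => simp only [Prog.width, max_le_iff] at hr; exact ih hr.2.1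
  | test_zero _ _ ih => simp only [Prog.width, max_le_iff] at hr; exact ih hr.2.2.1
  | test_empty _ _ ih => simp only [Prog.width, max_le_iff] at hr; exact ih hr.2.2.2
  | loop_step _ _ _ ih₁ ih₂ =>
    rw [ih₂ hr]
    simp only [Prog.width, max_le_iff] at hr
    exact ih₁ hr.2
  | ask_yes _ _ ih => simp only [Prog.width, max_le_iff] at hr; exact ih hr.2.1
  | ask_no _ _ ih => simp only [Prog.width, max_le_iff] at hr; exact ih hr.2.2
  | guess_one _ ih => simp only [Prog.width, max_le_iff] at hr; exact ih hr.1
  | guess_zero _ ih => simp only [Prog.width, max_le_iff] at hr; exact ih hr.2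

/-- The program that assumes the answer no instead of asking the oracle. -/
def Prog.noAsk : Prog → Prog
  | .skip => .skip
  | .push r b => .push r b
  | .pop r => .pop r
  | .seq c₁ c₂ => .seq c₁.noAsk c₂.noAsk
  | .test r c₁ c₀ cₑ => .test r c₁.noAsk c₀.noAsk cₑ.noAsk
  | .loop r c => .loop r c.noAsk
  | .ask _ _ c₀ => c₀.noAsk
  | .guess c₁ c₀ => .guess c₁.noAsk c₀.noAsk

/-- With the empty oracle each answer is no, so the question can be left out, and time can only
drop. This places an NP machine beside a machine that has a tower as oracle without sending the
tower any question. -/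
theorem Run.noAsk {c : Prog} {s : Store} {g Q t s'} (h : Run ∅ c s g Q t s') (A : Lang) :
    ∃ t' ≤ t, Run A c.noAsk s g [] t' s' := by
  induction h with
  | skip s => exact ⟨1, le_rfl, .skip s⟩
  | push r b s => exact ⟨1, le_rfl, .push r b s⟩
  | pop r s => exact ⟨1, le_rfl, .pop r s⟩
  | seq _ _ ih₁ ih₂ =>
    obtain ⟨t₁, h₁, k₁⟩ := ih₁
    obtain ⟨t₂, h₂, k₂⟩ := ih₂
    exact ⟨t₁ + t₂, by omega, k₁.seq k₂⟩
  | test_one hr _ ih => obtain ⟨t, h, k⟩ := ih; exact ⟨t + 1, by omega, .test_one hr k⟩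
  | test_zero hr _ ih => obtain ⟨t, h, k⟩ := ih; exact ⟨t + 1, by omega, .test_zero hr k⟩
  | test_empty hr _ ih => obtain ⟨t, h, k⟩ := ih; exact ⟨t + 1, by omega, .test_empty hr k⟩
  | loop_stop hr => exact ⟨1, le_rfl, Run.loop_stop hr⟩
  | loop_step hr _ _ ih₁ ih₂ =>
    obtain ⟨t₁, h₁, k₁⟩ := ih₁
    obtain ⟨t₂, h₂, k₂⟩ := ih₂
    exact ⟨t₁ + t₂ + 1, by omega, .loop_step hr k₁ k₂⟩
  | ask_yes hr => exact hr.elim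
  | ask_no hr _ ih => obtain ⟨t, h, k⟩ := ih; exact ⟨t, by omega, k⟩
  | guess_one _ ih => obtain ⟨t, h, k⟩ := ih; exact ⟨t + 1, by omega, .guess_one k⟩
  | guess_zero _ ih => obtain ⟨t, h, k⟩ := ih; exact ⟨t + 1, by omega, .guess_zero k⟩

/-! ### Paths with a time bound -/

/-- `c` has a path with choices `g` and questions `Q` that makes at most `T` steps. -/
def RunLE (A : Lang) (c : Prog) (s : Store) (g : List Bool) (Q : List Str) (T : ℕ) (s' : Store) :
    Prop := ∃ t ≤ T, Run A c s g Q t s'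

section RunLE
variable {A : Lang} {c d e : Prog} {s s' s'' : Store} {g g' : List Bool} {Q Q' : List Str}
  {T T' : ℕ} {r : ℕ} {b : Bool}

theorem Run.runLE {t : ℕ} (h : Run A c s g Q t s') : RunLE A c s g Q t s' := ⟨t, le_rfl, h⟩

theorem RunLE.mono (h : RunLE A c s g Q T s') (hT : T ≤ T') : RunLE A c s g Q T' s' := by
  obtain ⟨t, ht, k⟩ := h; exact ⟨t, ht.trans hT, k⟩

theorem RunLE.to (h : RunLE A c s g Q T s') (hs : s' = s'') (hT : T ≤ T') :
    RunLE A c s g Q T' s'' := hs ▸ h.mono hT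

theorem RunLE.seq (h : RunLE A c s g Q T s') (h' : RunLE A d s' g' Q' T' s'') :
    RunLE A (.seq c d) s (g ++ g') (Q ++ Q') (T + T') s'' := by
  obtain ⟨t, ht, k⟩ := h
  obtain ⟨t', ht', k'⟩ := h'
  exact ⟨t + t', by omega, k.seq k'⟩

/-- Prefix a path by a path without choices and questions. -/
theorem RunLE.pre (h : RunLE A c s [] [] T s') (h' : RunLE A d s' g' Q' T' s'') :
    RunLE A (.seq c d) s g' Q' (T + T') s'' := h.seq h'

/-- Extend a path by a path without choices and questions. -/
theorem RunLE.post (h : RunLE A c s g Q T s') (h' : RunLE A d s' [] [] T' s'') :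
    RunLE A (.seq c d) s g Q (T + T') s'' := by
  simpa using h.seq h'

theorem runLE_skip : RunLE A .skip s [] [] 1 s := ⟨1, le_rfl, .skip s⟩

theorem runLE_push : RunLE A (.push r b) s [] [] 1 (Function.update s r (b :: s r)) :=
  ⟨1, le_rfl, .push r b s⟩

theorem runLE_pop : RunLE A (.pop r) s [] [] 1 (Function.update s r (s r).tail) :=
  ⟨1, le_rfl, .pop r s⟩

theorem RunLE.test_one (hr : (s r).head? = some true) (h : RunLE A c s g Q T s') :
    RunLE A (.test r c d e) s g Q (T + 1) s' := by
  obtain ⟨t, ht, k⟩ := h; exact ⟨t + 1, by omega, .test_one hr k⟩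

theorem RunLE.test_zero (hr : (s r).head? = some false) (h : RunLE A d s g Q T s') :
    RunLE A (.test r c d e) s g Q (T + 1) s' := by
  obtain ⟨t, ht, k⟩ := h; exact ⟨t + 1, by omega, .test_zero hr k⟩

theorem RunLE.test_empty (hr : s r = []) (h : RunLE A e s g Q T s') :
    RunLE A (.test r c d e) s g Q (T + 1) s' := by
  obtain ⟨t, ht, k⟩ := h; exact ⟨t + 1, by omega, .test_empty hr k⟩

theorem RunLE.test_bit {bs : Str} (hr : s r = b :: bs)
    (h : RunLE A (if b then c else d) s g Q T s') :
    RunLE A (.test r c d e) s g Q (T + 1) s' := by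
  cases b
  · exact RunLE.test_zero (by simp [hr]) h
  · exact RunLE.test_one (by simp [hr]) h

theorem runLE_loop_stop (hr : s r = []) : RunLE A (.loop r c) s [] [] 1 s :=
  ⟨1, le_rfl, Run.loop_stop hr⟩

theorem RunLE.loop_step (hr : s r ≠ []) (h : RunLE A c s g Q T s')
    (h' : RunLE A (.loop r c) s' g' Q' T' s'') :
    RunLE A (.loop r c) s (g ++ g') (Q ++ Q') (T + T' + 1) s'' := by
  obtain ⟨t, ht, k⟩ := h
  obtain ⟨t', ht', k'⟩ := h'
  exact ⟨t + t' + 1, by omega, .loop_step hr k k'⟩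

theorem RunLE.ask_yes (hr : s r ∈ A) (h : RunLE A c s g Q T s') :
    RunLE A (.ask r c d) s g (s r :: Q) (T + 1) s' := by
  obtain ⟨t, ht, k⟩ := h; exact ⟨t + 1, by omega, .ask_yes hr k⟩

theorem RunLE.ask_no (hr : s r ∉ A) (h : RunLE A d s g Q T s') :
    RunLE A (.ask r c d) s g (s r :: Q) (T + 1) s' := by
  obtain ⟨t, ht, k⟩ := h; exact ⟨t + 1, by omega, .ask_no hr k⟩

theorem RunLE.guess_bit (h : RunLE A (if b then c else d) s g Q T s') :
    RunLE A (.guess c d) s (b :: g) Q (T + 1) s' := by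
  obtain ⟨t, ht, k⟩ := h
  cases b
  · exact ⟨t + 1, by omega, .guess_zero k⟩
  · exact ⟨t + 1, by omega, .guess_one k⟩

/-- Asking the oracle and pushing its answer on tape `x`. -/
theorem runLE_ask_push {x : ℕ} (hb : b = true ↔ s r ∈ A) :
    RunLE A (.ask r (.push x true) (.push x false)) s [] [s r] 2
      (Function.update s x (b :: s x)) := by
  cases b
  · exact RunLE.ask_no (by simpa using hb) runLE_push
  · exact RunLE.ask_yes (by simpa using hb) runLE_push

theorem runLE_guess_push {x : ℕ} :
    RunLE A (.guess (.push x true) (.push x false)) s [b] [] 2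
      (Function.update s x (b :: s x)) := by
  refine RunLE.guess_bit ?_
  cases b <;> exact runLE_push

end RunLE

/-! ### Three banks of tapes -/

/-- Helper tapes. -/
def hT (i : ℕ) : ℕ := 4 * (i / 2) + i % 2
/-- Tapes of a simulated machine. -/
def sT (i : ℕ) : ℕ := 4 * i + 2
/-- Tapes of a subroutine. -/
def tT (i : ℕ) : ℕ := 4 * i + 3

/-- A store that is made of three banks of tapes. -/
def mix (a s b : Store) : Store := fun n =>
  if n % 4 < 2 then a (2 * (n / 4) + n % 4) else if n % 4 = 2 then s (n / 4) else b (n / 4)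

section mix
variable (a s b : Store) (i : ℕ) (v : Str)

-- Numbers congruent to 0 and 1 modulo 4 are helper tapes, 2 is the simulated machine and 3 the
-- subroutine. In particular `hT 0 = 0` and `hT 1 = 1`, so the input and output tapes of a program
-- are helper tapes.
@[simp] theorem mix_hT : mix a s b (hT i) = a i := by
  have h₁ : hT i % 4 < 2 := by unfold hT; omega
  have h₂ : 2 * (hT i / 4) + hT i % 4 = i := by unfold hT; omega
  simp [mix, h₁, h₂]

@[simp] theorem mix_sT : mix a s b (sT i) = s i := by
  have h₁ : sT i % 4 = 2 := by unfold sT; omega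
  have h₂ : sT i / 4 = i := by unfold sT; omega
  simp [mix, h₁, h₂]

@[simp] theorem mix_tT : mix a s b (tT i) = b i := by
  have h₁ : tT i % 4 = 3 := by unfold tT; omega
  have h₂ : tT i / 4 = i := by unfold tT; omega
  simp [mix, h₁, h₂]

@[simp] theorem update_mix_hT :
    Function.update (mix a s b) (hT i) v = mix (Function.update a i v) s b := by
  ext1 n
  by_cases hn : n = hT i
  · subst hn; simp
  · rw [Function.update_of_ne hn]
    unfold mix
    split_ifs with h
    · rw [Function.update_of_ne]; unfold hT at hn; omega
    · rfl
    · rfl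

@[simp] theorem update_mix_sT :
    Function.update (mix a s b) (sT i) v = mix a (Function.update s i v) b := by
  ext1 n
  by_cases hn : n = sT i
  · subst hn; simp
  · rw [Function.update_of_ne hn]
    unfold mix
    split_ifs with h
    · rfl
    · rw [Function.update_of_ne]; unfold sT at hn; omega
    · rfl

@[simp] theorem update_mix_tT :
    Function.update (mix a s b) (tT i) v = mix a s (Function.update b i v) := by
  ext1 n
  by_cases hn : n = tT i
  · subst hn; simp
  · rw [Function.update_of_ne hn]
    unfold mix
    split_ifs with h
    · rfl
    · rfl
    · rw [Function.update_of_ne]; unfold tT at hn; omega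

end mix

@[simp] theorem hT_inj {i j : ℕ} : hT i = hT j ↔ i = j := by unfold hT; omega
@[simp] theorem sT_inj {i j : ℕ} : sT i = sT j ↔ i = j := by unfold sT; omega
@[simp] theorem tT_inj {i j : ℕ} : tT i = tT j ↔ i = j := by unfold tT; omega
@[simp] theorem hT_ne_sT {i j : ℕ} : hT i ≠ sT j := by unfold hT sT; omega
@[simp] theorem sT_ne_hT {i j : ℕ} : sT i ≠ hT j := by unfold hT sT; omega
@[simp] theorem hT_ne_tT {i j : ℕ} : hT i ≠ tT j := by unfold hT tT; omega
@[simp] theorem tT_ne_hT {i j : ℕ} : tT i ≠ hT j := by unfold hT tT; omega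

/-- The store with empty tapes. -/
def nil : Store := fun _ => []

@[simp] theorem nil_apply (i : ℕ) : nil i = [] := rfl

/-- The store with the given contents of the first tapes. -/
def bank (l : List Str) : Store := fun i => l.getD i []

@[simp] theorem bank_apply (l : List Str) (i : ℕ) : bank l i = l.getD i [] := rfl

theorem update_bank {l : List Str} {i : ℕ} {v : Str} (h : i < l.length) :
    Function.update (bank l) i v = bank (l.set i v) := by
  ext1 n
  by_cases hn : n = i
  · subst hn; simp [h]
  · rw [Function.update_of_ne hn]
    simp [List.getD_eq_getElem?_getD, List.getElem?_set_ne (Ne.symm hn)]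

theorem init_eq_update (x : Str) : init x = Function.update nil 0 x := by
  ext1 n; by_cases h : n = 0 <;> simp [init, h]

/-- All programs below use helper tapes with index below ten. With the bank written as an explicit
list, `update_bank` lets `simp` compute each intermediate store. -/
theorem init_eq_mix (x : Str) :
    init x = mix (bank [x, [], [], [], [], [], [], [], [], []]) nil nil := by
  have h : mix nil nil nil = nil := by ext1 n; simp [mix]
  have h' : bank [x, [], [], [], [], [], [], [], [], []] = Function.update nil 0 x := by
    have : nil = bank [[], [], [], [], [], [], [], [], [], []] := by
      ext1 n
      rcases n with _|_|_|_|_|_|_|_|_|_|n <;> simp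
    rw [this, update_bank (by simp)]; rfl
  rw [init_eq_update, h', ← update_mix_hT, h]; rfl

theorem mix_one (a s b : Store) : mix a s b 1 = a 1 := mix_hT a s b 1

/-! ### Subroutines that move strings between tapes -/

/-- Empty tape `i`. -/
def clear (i : ℕ) : Prog := .loop i (.pop i)

/-- Move the contents of tape `i` onto tape `j`, in reverse order. -/
def move (i j : ℕ) : Prog :=
  .loop i (.test i (.seq (.pop i) (.push j true)) (.seq (.pop i) (.push j false)) .skip)

/-- Move the contents of tape `i` onto tape `j`, via the empty tape `k`. -/
def move₂ (i j k : ℕ) : Prog := .seq (move i k) (move k j)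

/-- Move the contents of `k` in reverse order onto both `i` and `j`. -/
def split (k i j : ℕ) : Prog :=
  .loop k (.test k (.seq (.pop k) (.seq (.push i true) (.push j true)))
    (.seq (.pop k) (.seq (.push i false) (.push j false))) .skip)

/-- Copy the contents of tape `i` onto tape `j`, using the empty tape `k`. -/
def copy (i j k : ℕ) : Prog := .seq (move i k) (split k i j)

/-- Write the bits of `l` on tape `i`. -/
def pushes (i : ℕ) : Str → Prog
  | [] => .skip
  | b :: l => .seq (pushes i l) (.push i b)

section
variable {A : Lang} {i j k : ℕ}

theorem run_clear (σ : Store) :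
    RunLE A (clear i) σ [] [] (2 * (σ i).length + 1) (Function.update σ i []) := by
  generalize hw : σ i = w
  induction w generalizing σ with
  | nil => exact (runLE_loop_stop hw).to (by rw [← hw]; simp) (by simp)
  | cons b w ih =>
    refine ((RunLE.loop_step (by simp [hw]) runLE_pop (ih _ (by simp [hw]))).to ?_ ?_)
    · simp
    · simp; omega

theorem run_move (hij : i ≠ j) (σ : Store) :
    RunLE A (move i j) σ [] [] (4 * (σ i).length + 1)
      (Function.update (Function.update σ j ((σ i).reverse ++ σ j)) i []) := by
  generalize hw : σ i = w
  induction w generalizing σ with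
  | nil =>
    refine (runLE_loop_stop hw).to ?_ (by simp)
    ext1 n; by_cases h : n = i <;> simp [h, hw, Function.update_apply]
  | cons b w ih =>
    have h₁ : RunLE A (.test i (.seq (.pop i) (.push j true)) (.seq (.pop i) (.push j false)) .skip)
        σ [] [] 3 (Function.update (Function.update σ i w) j (b :: σ j)) := by
      refine RunLE.test_bit hw ?_
      cases b <;> exact (runLE_pop.pre runLE_push).to (by simp [hw, hij.symm]) le_rfl
    refine ((RunLE.loop_step (by simp [hw]) h₁ (ih _ (by simp [hij]))).to ?_ ?_)
    · ext1 n; by_cases h : n = i <;> by_cases h' : n = j <;> simp [h, h', Function.update_apply]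
    · simp; omega

theorem run_move₂ (hij : i ≠ j) (hik : i ≠ k) (hjk : j ≠ k) (σ : Store) (hk : σ k = []) :
    RunLE A (move₂ i j k) σ [] [] (8 * (σ i).length + 2)
      (Function.update (Function.update σ j (σ i ++ σ j)) i []) := by
  refine ((run_move hik σ).pre (run_move hjk.symm _)).to ?_ ?_
  · ext1 n
    by_cases h : n = i <;> by_cases h' : n = j <;> by_cases h'' : n = k <;>
      simp [h, h', h'', hk, Function.update_apply] <;> grind
  · simp [hik.symm, hk]; omega

theorem run_split (hij : i ≠ j) (hik : i ≠ k) (hjk : j ≠ k) (σ : Store) :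
    RunLE A (split k i j) σ [] [] (5 * (σ k).length + 1)
      (Function.update (Function.update (Function.update σ i ((σ k).reverse ++ σ i)) j
        ((σ k).reverse ++ σ j)) k []) := by
  generalize hw : σ k = w
  induction w generalizing σ with
  | nil =>
    refine (runLE_loop_stop hw).to ?_ (by simp)
    ext1 n
    by_cases h : n = i <;> by_cases h' : n = j <;> by_cases h'' : n = k <;>
      simp [h, h', h'', hw, Function.update_apply] <;> grind
  | cons b w ih =>
    have h₁ : RunLE A (.test k (.seq (.pop k) (.seq (.push i true) (.push j true)))
        (.seq (.pop k) (.seq (.push i false) (.push j false))) .skip)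
        σ [] [] 4 (Function.update (Function.update (Function.update σ k w) i (b :: σ i)) j
          (b :: σ j)) := by
      refine RunLE.test_bit hw ?_
      cases b <;> exact (runLE_pop.pre (runLE_push.pre runLE_push)).to
        (by simp [hw, hik, hjk, hij.symm]) le_rfl
    refine ((RunLE.loop_step (by simp [hw]) h₁ (ih _ (by simp [hik.symm, hjk.symm]))).to ?_ ?_)
    · ext1 n
      by_cases h : n = i <;> by_cases h' : n = j <;> by_cases h'' : n = k <;>
        simp [h, h', h'', Function.update_apply] <;> grind
    · simp; omega

theorem run_copy (hij : i ≠ j) (hik : i ≠ k) (hjk : j ≠ k) (σ : Store) (hk : σ k = []) :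
    RunLE A (copy i j k) σ [] [] (9 * (σ i).length + 2)
      (Function.update σ j (σ i ++ σ j)) := by
  refine ((run_move hik σ).pre (run_split hij hik hjk _)).to ?_ ?_
  · ext1 n
    by_cases h : n = i <;> by_cases h' : n = j <;> by_cases h'' : n = k <;>
      simp [h, h', h'', hk, Function.update_apply] <;> grind
  · simp [hik.symm, hk]; omega

theorem run_pushes (σ : Store) (l : Str) :
    RunLE A (pushes i l) σ [] [] (l.length + 1) (Function.update σ i (l ++ σ i)) := by
  induction l with
  | nil => exact runLE_skip.to (by simp) (by simp)
  | cons b l ih => exact (ih.pre runLE_push).to (by simp) (by simp)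

end

/-! ### Pairs of strings -/

/-- The code of a pair of strings. -/
def enc (F q : Str) : Str := F.flatMap (fun b => [true, b]) ++ false :: q

/-- Decoding of pairs. Every string is read as the code of a pair. -/
def dec : Str → Str × Str
  | [] => ([], [])
  | false :: q => ([], q)
  | [true] => ([], [])
  | true :: b :: z => (b :: (dec z).1, (dec z).2)

@[simp] theorem dec_enc (F q : Str) : dec (enc F q) = (F, q) := by
  induction F with
  | nil => simp [enc, dec]
  | cons b F ih => simp only [enc, List.flatMap_cons] at ih ⊢; simp [dec, ih]

theorem enc_length (F q : Str) : (enc F q).length = 2 * F.length + q.length + 1 := by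
  induction F with
  | nil => simp [enc]
  | cons b F ih => simp only [enc, List.flatMap_cons] at ih ⊢; simp at ih ⊢; omega

theorem dec_length : ∀ z : Str, (dec z).1.length + (dec z).2.length ≤ z.length
  | [] => by simp [dec]
  | false :: q => by simp [dec]
  | [true] => by simp [dec]
  | true :: b :: z => by have := dec_length z; simp [dec]; omega

/-- Write the code of the pair of the strings on tapes `f` and `q` on tape `o`, using the
empty tape `k`. -/
def encode (f q o k : ℕ) : Prog :=
  .seq (copy q o k) (.seq (.push o false) (.seq (move f k)
    (.loop k (.test k
      (.seq (.pop k) (.seq (.push f true) (.seq (.push o true) (.push o true))))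
      (.seq (.pop k) (.seq (.push f false) (.seq (.push o false) (.push o true)))) .skip))))

/-- Decode the pair on tape `i`: its first component is written on tape `r` in reverse order, its
second component remains on tape `i`. Tape `c` is empty before and after. -/
def decode (i r c : ℕ) : Prog :=
  .seq (.push c true) (.loop c (.test i
    (.seq (.pop i) (.test i (.seq (.pop i) (.push r true)) (.seq (.pop i) (.push r false)) .skip))
    (.seq (.pop i) (.pop c)) (.pop c)))

section
variable {A : Lang}

theorem run_encode {f q o k : ℕ} (hfo : f ≠ o) (hfk : f ≠ k) (hqo : q ≠ o)
    (hqk : q ≠ k) (hok : o ≠ k) (σ : Store) (hk : σ k = []) (ho : σ o = []) :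
    RunLE A (encode f q o k) σ [] [] (12 * ((σ f).length + (σ q).length) + 10)
      (Function.update σ o (enc (σ f) (σ q))) := by
  have key : ∀ (w : Str) (τ : Store), τ k = w → RunLE A (.loop k (.test k
      (.seq (.pop k) (.seq (.push f true) (.seq (.push o true) (.push o true))))
      (.seq (.pop k) (.seq (.push f false) (.seq (.push o false) (.push o true)))) .skip)) τ [] []
      (6 * w.length + 1) (Function.update (Function.update (Function.update τ f
        (w.reverse ++ τ f)) o (w.reverse.flatMap (fun b => [true, b]) ++ τ o)) k []) := by
    intro w
    induction w with
    | nil =>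
      intro τ hw
      refine (runLE_loop_stop hw).to ?_ (by simp)
      ext1 n
      by_cases h : n = f <;> by_cases h' : n = o <;> by_cases h'' : n = k <;>
        simp [h, h', h'', hw, Function.update_apply] <;> grind
    | cons b w ih =>
      intro τ hw
      have h₁ : RunLE A (.test k
          (.seq (.pop k) (.seq (.push f true) (.seq (.push o true) (.push o true))))
          (.seq (.pop k) (.seq (.push f false) (.seq (.push o false) (.push o true)))) .skip)
          τ [] [] 5 (Function.update (Function.update (Function.update τ k w) f (b :: τ f)) o
            (true :: b :: τ o)) := by
        refine RunLE.test_bit hw ?_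
        cases b <;> exact (runLE_pop.pre (runLE_push.pre (runLE_push.pre runLE_push))).to
          (by simp [hw, hfk, hok, hfo.symm]) le_rfl
      refine ((RunLE.loop_step (by simp [hw]) h₁ (ih _ (by simp [hfk.symm, hok.symm]))).to ?_ ?_)
      · ext1 n
        by_cases h : n = f <;> by_cases h' : n = o <;> by_cases h'' : n = k <;>
          simp [h, h', h'', Function.update_apply] <;> grind
      · simp; omega
  refine ((run_copy hqo hqk hok σ hk).pre (runLE_push.pre ((run_move hfk _).pre
    (key (σ f).reverse _ ?_)))).to ?_ ?_
  · simp [hfk.symm, hok.symm, hfo, hk]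
  · ext1 n
    by_cases h : n = f <;> by_cases h' : n = o <;> by_cases h'' : n = k <;>
      simp [h, h', h'', hk, ho, enc, Function.update_apply] <;> grind
  · simp [hfo]; omega

/-- Tape `c` is the loop flag: it holds one bit until the separator, or the end of the string, is
reached. The induction follows the recursion of `dec`. -/
theorem run_decode {i r c : ℕ} (hir : i ≠ r) (hic : i ≠ c) (hrc : r ≠ c) (σ : Store)
    (hc : σ c = []) :
    RunLE A (decode i r c) σ [] [] (6 * (σ i).length + 6)
      (Function.update (Function.update σ r ((dec (σ i)).1.reverse ++ σ r)) i
        (dec (σ i)).2) := by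
  have key : ∀ (z : Str) (τ : Store), τ i = z → τ c = [true] → RunLE A (.loop c (.test i
      (.seq (.pop i) (.test i (.seq (.pop i) (.push r true)) (.seq (.pop i) (.push r false)) .skip))
      (.seq (.pop i) (.pop c)) (.pop c))) τ [] [] (6 * z.length + 5)
      (Function.update (Function.update (Function.update τ r ((dec z).1.reverse ++ τ r)) i
        (dec z).2) c []) := by
    intro z
    induction z using dec.induct with
    | case1 =>
      intro τ hz hc
      refine (RunLE.loop_step (by simp [hc]) (RunLE.test_empty hz runLE_pop)
        (runLE_loop_stop (by simp [hc]))).to ?_ (by simp)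
      ext1 n
      by_cases h : n = i <;> by_cases h' : n = r <;> by_cases h'' : n = c <;>
        simp [h, h', h'', hz, hc, dec, Function.update_apply] <;> grind
    | case2 q =>
      intro τ hz hc
      refine (RunLE.loop_step (by simp [hc]) (RunLE.test_zero (by simp [hz])
        (runLE_pop.pre runLE_pop)) (runLE_loop_stop (by simp [hc, hic.symm]))).to ?_
        (by simp)
      ext1 n
      by_cases h : n = i <;> by_cases h' : n = r <;> by_cases h'' : n = c <;>
        simp [h, h', h'', hz, hc, dec, Function.update_apply] <;> grind
    -- A string broken off inside a bit pair costs one more round, in which the empty tape `i` makes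
    -- the flag drop.
    | case3 =>
      intro τ hz hc
      refine (RunLE.loop_step (by simp [hc]) (RunLE.test_one (by simp [hz])
        (runLE_pop.pre (RunLE.test_empty (by simp [hz]) runLE_skip)))
        (RunLE.loop_step (by simp [hc, hic.symm]) (RunLE.test_empty (by simp [hz]) runLE_pop)
        (runLE_loop_stop (by simp [hc, hic.symm])))).to ?_ (by simp)
      ext1 n
      by_cases h : n = i <;> by_cases h' : n = r <;> by_cases h'' : n = c <;>
        simp [h, h', h'', hz, hc, dec, Function.update_apply] <;> grind
    | case4 b z ih =>
      intro τ hz hc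
      have h₁ : RunLE A (.test i (.seq (.pop i) (.push r true)) (.seq (.pop i) (.push r false)) .skip)
          (Function.update τ i (b :: z)) [] [] 3
          (Function.update (Function.update τ i z) r (b :: τ r)) := by
        refine RunLE.test_bit (bs := z) (b := b) (by simp) ?_
        cases b <;> exact (runLE_pop.pre runLE_push).to (by simp [hir.symm]) le_rfl
      refine (RunLE.loop_step (by simp [hc]) (RunLE.test_one (by simp [hz])
        ((runLE_pop.to (by rw [hz]; rfl) le_rfl).pre h₁))
        (ih _ (by simp [hir]) (by simp [hic.symm, hrc.symm, hc]))).to ?_ (by simp; omega)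
      ext1 n
      by_cases h : n = i <;> by_cases h' : n = r <;> by_cases h'' : n = c <;>
        simp [h, h', h'', dec, Function.update_apply]
  refine (runLE_push.pre (key (σ i) _ (by simp [hic]) (by simp [hc]))).to ?_ (by omega)
  ext1 n
  by_cases h : n = i <;> by_cases h' : n = r <;> by_cases h'' : n = c <;>
    simp [h, h', h'', hc, Function.update_apply] <;> grind

end

/-! ### Calling a machine as a subroutine -/

/-- Rename the tapes. -/
def Prog.ren (f : ℕ → ℕ) : Prog → Prog
  | .skip => .skip
  | .push r b => .push (f r) b
  | .pop r => .pop (f r)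
  | .seq c₁ c₂ => .seq (c₁.ren f) (c₂.ren f)
  | .test r c₁ c₀ cₑ => .test (f r) (c₁.ren f) (c₀.ren f) (cₑ.ren f)
  | .loop r c => .loop (f r) (c.ren f)
  | .ask r c₁ c₀ => .ask (f r) (c₁.ren f) (c₀.ren f)
  | .guess c₁ c₀ => .guess (c₁.ren f) (c₀.ren f)

theorem Prog.Deterministic.ren {c : Prog} (h : c.Deterministic) (f : ℕ → ℕ) :
    (c.ren f).Deterministic := by
  induction c with
  | skip | push | pop => trivial
  | seq _ _ ih₁ ih₂ => exact ⟨ih₁ h.1, ih₂ h.2⟩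
  | test _ _ _ _ ih₁ ih₂ ih₃ => exact ⟨ih₁ h.1, ih₂ h.2.1, ih₃ h.2.2⟩
  | loop _ _ ih => exact ih h
  | ask _ _ _ ih₁ ih₂ => exact ⟨ih₁ h.1, ih₂ h.2⟩
  | guess => exact h.elim

theorem Run.ren_tT {A : Lang} {c : Prog} {b : Store} {g Q t b'} (h : Run A c b g Q t b')
    (a s : Store) : Run A (c.ren tT) (mix a s b) g Q t (mix a s b') := by
  induction h with
  | skip => exact .skip _
  | push r x b => simpa [Prog.ren] using Run.push (A := A) (tT r) x (mix a s b)
  | pop r b => simpa [Prog.ren] using Run.pop (A := A) (tT r) (mix a s b)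
  | seq _ _ ih₁ ih₂ => exact .seq ih₁ ih₂
  | test_one hr _ ih => exact .test_one (by simpa using hr) ih
  | test_zero hr _ ih => exact .test_zero (by simpa using hr) ih
  | test_empty hr _ ih => exact .test_empty (by simpa using hr) ih
  | loop_stop hr => exact Run.loop_stop (by simpa using hr)
  | loop_step hr _ _ ih₁ ih₂ => exact .loop_step (by simpa using hr) ih₁ ih₂
  | @ask_yes r _ c₀ b _ _ _ _ hr _ ih =>
    have h := Run.ask_yes (r := tT r) (c₀ := c₀.ren tT) (by simpa using hr) ih
    rw [mix_tT] at h
    exact h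
  | @ask_no r c₁ _ b _ _ _ _ hr _ ih =>
    have h := Run.ask_no (r := tT r) (c₁ := c₁.ren tT) (by simpa using hr) ih
    rw [mix_tT] at h
    exact h
  | guess_one _ ih => exact .guess_one ih
  | guess_zero _ ih => exact .guess_zero ih

/-- Empty the first `n` tapes of the subroutine bank. -/
def clearBank : ℕ → Prog
  | 0 => .skip
  | n + 1 => .seq (clear (tT n)) (clearBank n)

theorem run_clearBank {A : Lang} {a s : Store} {m n : ℕ} {b : Store} (hb : ∀ r, (b r).length ≤ m)
    (hn : ∀ r, n ≤ r → b r = []) :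
    RunLE A (clearBank n) (mix a s b) [] [] (n * (2 * m + 1) + 1) (mix a s nil) := by
  induction n generalizing b with
  | zero =>
    obtain rfl : b = nil := by ext1 r; simp [hn r]
    exact runLE_skip.mono (by simp)
  | succ n ih =>
    have h := run_clear (A := A) (i := tT n) (mix a s b)
    rw [update_mix_tT, mix_tT] at h
    refine (h.pre (ih (b := Function.update b n []) ?_ ?_)).mono ?_
    · intro r
      by_cases hr : r = n
      · subst hr; simp
      · rw [Function.update_of_ne hr]; exact hb r
    · intro r hr
      by_cases hr' : r = n
      · subst hr'; simp
      · rw [Function.update_of_ne hr']; exact hn r (by omega)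
    · have := hb n
      rw [Nat.add_mul n 1]; omega

/-- Run `M` on the string on the helper tape `i`. What it has on tape `1` at the end is written on
the helper tape `j`. -/
def call (i j : ℕ) (M : Prog) : Prog :=
  .seq (copy (hT i) (tT 0) (hT 5)) (.seq (M.ren tT)
    (.seq (move₂ (tT 1) (hT j) (hT 5)) (clearBank (M.width + 1))))

/-- A bound for the time of a call, where `m` bounds the sum of the lengths of the input and the
time of `M`. -/
def callCost (M : Prog) (m : ℕ) : ℕ := (M.width + 20) * (2 * m + 2)

theorem callCost_mono {M : Prog} {m m' : ℕ} (h : m ≤ m') : callCost M m ≤ callCost M m' :=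
  Nat.mul_le_mul_left _ (by omega)

/-- The subroutine bank is empty before and after, so calls can be repeated. Helper tape `5` is
scratch space, which is why `i` and `j` must avoid it. -/
theorem run_call {A : Lang} {M : Prog} {a s : Store} {i j : ℕ} (hi : i ≠ 5) (hj : j ≠ 5)
    (h5 : a 5 = []) (haj : a j = []) {g Q t b'} (h : Run A M (init (a i)) g Q t b') :
    RunLE A (call i j M) (mix a s nil) g Q (callCost M ((a i).length + t))
      (mix (Function.update a j (b' 1)) s nil) := by
  have h₁ := run_copy (A := A) (i := hT i) (j := tT 0) (k := hT 5) (by simp) (by simpa) (by simp)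
    (mix a s nil) (by simpa)
  rw [mix_tT, mix_hT, update_mix_tT, nil_apply, List.append_nil, ← init_eq_update] at h₁
  have hb := h.length_le (init_length_le _)
  have h₂ := run_move₂ (A := A) (i := tT 1) (j := hT j) (k := hT 5) (by simp) (by simp) (by simpa)
    (mix a s b') (by simpa)
  rw [mix_tT, mix_hT, update_mix_hT, update_mix_tT, haj, List.append_nil] at h₂
  -- The bound is `M.width + 1` and not `M.width`: a program of width `0` never touches tape `0`,
  -- yet the input lies there and must be erased.
  have h₃ := run_clearBank (A := A) (a := Function.update a j (b' 1)) (s := s)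
    (b := Function.update b' 1 []) (m := (a i).length + t) (n := M.width + 1)
    (fun r => by
      by_cases hr : r = 1
      · subst hr; simp
      · rw [Function.update_of_ne hr]; exact hb.1 r)
    (fun r hr => by
      by_cases hr' : r = 1
      · subst hr'; simp
      · rw [Function.update_of_ne hr', h.eq_of_width_le (by omega)]
        simp [init]; omega)
  refine (h₁.pre ((h.ren_tT a s).runLE.post (h₂.pre h₃))).mono ?_
  have := hb.1 1
  unfold callCost
  nlinarith

theorem det_move (i j : ℕ) : (move i j).Deterministic := by simp [move, Prog.Deterministic]
theorem det_clear (i : ℕ) : (clear i).Deterministic := by simp [clear, Prog.Deterministic]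
theorem det_move₂ (i j k : ℕ) : (move₂ i j k).Deterministic := ⟨det_move _ _, det_move _ _⟩
theorem det_copy (i j k : ℕ) : (copy i j k).Deterministic := by
  simp [copy, move, split, Prog.Deterministic]
theorem det_encode (f q o k : ℕ) : (encode f q o k).Deterministic := by
  simp [encode, copy, move, split, Prog.Deterministic]
theorem det_decode (i r c : ℕ) : (decode i r c).Deterministic := by
  simp [decode, Prog.Deterministic]
theorem det_pushes (i : ℕ) (l : Str) : (pushes i l).Deterministic := by
  induction l with
  | nil => trivial
  | cons b l ih => exact ⟨ih, trivial⟩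
theorem det_clearBank (n : ℕ) : (clearBank n).Deterministic := by
  induction n with
  | zero => trivial
  | succ n ih => exact ⟨det_clear _, ih⟩
theorem det_call {M : Prog} (h : M.Deterministic) (i j : ℕ) : (call i j M).Deterministic :=
  ⟨det_copy _ _ _, h.ren _, det_move₂ _ _ _, det_clearBank _⟩

/-! ### Polynomial bounds -/

/-- `f` is bounded by a polynomial. -/
def PolyBd (f : ℕ → ℕ) : Prop := ∃ p : Polynomial ℕ, ∀ n, f n ≤ p.eval n

theorem eval_mono (p : Polynomial ℕ) {m n : ℕ} (h : m ≤ n) : p.eval m ≤ p.eval n := by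
  induction p using Polynomial.induction_on' with
  | add p q hp hq => simp only [Polynomial.eval_add]; omega
  | monomial k a =>
    simp only [Polynomial.eval_monomial]
    exact Nat.mul_le_mul_left _ (Nat.pow_le_pow_left h k)

namespace PolyBd
variable {f f' : ℕ → ℕ}

theorem const (c : ℕ) : PolyBd (fun _ => c) := ⟨Polynomial.C c, fun n => by simp⟩
theorem id : PolyBd (fun n => n) := ⟨Polynomial.X, fun n => by simp⟩
theorem add (h : PolyBd f) (h' : PolyBd f') : PolyBd (fun n => f n + f' n) := by
  obtain ⟨p, hp⟩ := h
  obtain ⟨q, hq⟩ := h'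
  exact ⟨p + q, fun n => by have := hp n; have := hq n; simp; omega⟩
theorem mul (h : PolyBd f) (h' : PolyBd f') : PolyBd (fun n => f n * f' n) := by
  obtain ⟨p, hp⟩ := h
  obtain ⟨q, hq⟩ := h'
  exact ⟨p * q, fun n => by simpa using Nat.mul_le_mul (hp n) (hq n)⟩
theorem eval (p : Polynomial ℕ) (h : PolyBd f) : PolyBd (fun n => p.eval (f n)) := by
  obtain ⟨q, hq⟩ := h
  exact ⟨p.comp q, fun n => by simpa using eval_mono p (hq n)⟩
theorem callCost (M : Prog) (h : PolyBd f) : PolyBd (fun n => SparseUP.callCost M (f n)) :=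
  (const _).mul (((const 2).mul h).add (const 2))
theorem mono (h : PolyBd f) (h' : ∀ n, f' n ≤ f n) : PolyBd f' := by
  obtain ⟨p, hp⟩ := h
  exact ⟨p, fun n => (h' n).trans (hp n)⟩
theorem pow (h : PolyBd f) : ∀ d : ℕ, PolyBd (fun n => f n ^ d)
  | 0 => by simpa using const 1
  | d + 1 => by simpa [pow_succ] using (pow h d).mul h

end PolyBd

theorem isNPOM_of_total {M : Prog} {f : ℕ → ℕ} (hf : PolyBd f)
    (h : ∀ A x, Total A M (init x) (fun _ _ t _ => t ≤ f x.length)) : IsNPOM M := by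
  obtain ⟨p, hp⟩ := hf
  exact isNPOM_iff.2 ⟨p, fun A x => (h A x).mono fun _ _ _ _ _ ht => ht.trans (hp _)⟩

theorem IsNPOM.time {M : Prog} (h : IsNPOM M) :
    ∃ p : Polynomial ℕ, ∀ A x, Total A M (init x) (fun _ _ t _ => t ≤ p.eval x.length) := h

theorem Run.guess_length_le {A : Lang} {c : Prog} {s : Store} {g Q t s'}
    (h : Run A c s g Q t s') : g.length ≤ t := by
  induction h <;>
    (try simp only [List.length_nil, List.length_append, List.length_cons]) <;> omega

/-! ### Simulation of a machine with other oracle calls and other choices -/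

/-- Branch on the bit on the helper tape `2`, which is erased. -/
def branch (c₁ c₀ : Prog) : Prog :=
  .test (hT 2) (.seq (.pop (hT 2)) c₁) (.seq (.pop (hT 2)) c₀) .skip

/-- The program that simulates `N` on the simulation bank. To answer a question on tape `r`, it
executes `G r`, and to make a choice, it executes `H`; these programs write the answer, resp. the
choice, on the helper tape `2`. -/
def sim (G : ℕ → Prog) (H : Prog) : Prog → Prog
  | .skip => .skip
  | .push r b => .push (sT r) b
  | .pop r => .pop (sT r)
  | .seq c₁ c₂ => .seq (sim G H c₁) (sim G H c₂)
  | .test r c₁ c₀ cₑ => .test (sT r) (sim G H c₁) (sim G H c₀) (sim G H cₑ)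
  | .loop r c => .loop (sT r) (sim G H c)
  | .ask r c₁ c₀ => .seq (G r) (branch (sim G H c₁) (sim G H c₀))
  | .guess c₁ c₀ => .seq H (branch (sim G H c₁) (sim G H c₀))

theorem det_sim {G : ℕ → Prog} {H N : Prog} (hG : ∀ r, (G r).Deterministic)
    (hH : H.Deterministic ∨ N.Deterministic) : (sim G H N).Deterministic := by
  induction N with
  | skip | push | pop => trivial
  | seq _ _ ih₁ ih₂ =>
    exact ⟨ih₁ (hH.imp_right fun h => h.1), ih₂ (hH.imp_right fun h => h.2)⟩
  | test _ _ _ _ ih₁ ih₂ ih₃ =>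
    exact ⟨ih₁ (hH.imp_right fun h => h.1), ih₂ (hH.imp_right fun h => h.2.1),
      ih₃ (hH.imp_right fun h => h.2.2)⟩
  | loop _ _ ih => exact ih (hH.imp_right id)
  | ask r _ _ ih₁ ih₂ =>
    exact ⟨hG r, ⟨trivial, ih₁ (hH.imp_right fun h => h.1)⟩,
      ⟨trivial, ih₂ (hH.imp_right fun h => h.2)⟩, trivial⟩
  | guess _ _ ih₁ ih₂ =>
    have hH : H.Deterministic := hH.resolve_right id
    exact ⟨hH, ⟨trivial, ih₁ (.inl hH)⟩, ⟨trivial, ih₂ (.inl hH)⟩, trivial⟩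

/-- The choices of the simulation of a path with choices `g` after a history `h`. -/
def simGuess (γ : List Bool → Bool → List Bool) : List Bool → List Bool → List Bool
  | _, [] => []
  | h, b :: g => γ h b ++ simGuess γ (h ++ [b]) g

theorem simGuess_append (γ : List Bool → Bool → List Bool) (h g g' : List Bool) :
    simGuess γ h (g ++ g') = simGuess γ h g ++ simGuess γ (h ++ g) g' := by
  induction g generalizing h with
  | nil => simp [simGuess]
  | cons b g ih => simp [simGuess, ih]

theorem simGuess_id (h g : List Bool) : simGuess (fun _ b => [b]) h g = g := by
  induction g generalizing h with
  | nil => rfl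
  | cons b g ih => simp [simGuess, ih]

theorem simGuess_nil (h g : List Bool) : simGuess (fun _ _ => []) h g = [] := by
  induction g generalizing h with
  | nil => rfl
  | cons b g ih => simp [simGuess, ih]

theorem run_branch {A : Lang} {c₁ c₀ : Prog} {a s s' : Store} {b : Bool} {g Q T} (ha : a 2 = [])
    (h : RunLE A (if b then c₁ else c₀) (mix a s nil) g Q T s') :
    RunLE A (branch c₁ c₀) (mix (Function.update a 2 [b]) s nil) g Q (T + 2) s' := by
  have e : Function.update (Function.update a 2 [b]) 2 [] = a := by
    rw [Function.update_idem, ← ha, Function.update_eq_self]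
  have h₁ : RunLE A (.pop (hT 2)) (mix (Function.update a 2 [b]) s nil) [] [] 1 (mix a s nil) :=
    runLE_pop.to (by simp [e]) le_rfl
  refine (RunLE.test_bit (b := b) (bs := []) (T := 1 + T) (by simp) ?_).mono (by omega)
  cases b <;> exact h₁.pre h

/-- Correctness of the simulation. The contents of the helper tapes are a function `a` of the
history of choices. -/
theorem run_sim {A A' : Lang} {G : ℕ → Prog} {H : Prog} {a : List Bool → Store}
    {ok : List Bool → Prop} {γ : List Bool → Bool → List Bool} {Al Al' : Str → Prop} {m K : ℕ}
    (ha : ∀ h, ok h → a h 2 = []) (hok : ∀ h h', ok (h ++ h') → ok h)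
    (hG : ∀ h s r b, ok h → (∀ r, (s r).length ≤ m) → Al (s r) → (b = true ↔ s r ∈ A) →
      ∃ Q, (∀ q ∈ Q, Al' q) ∧ RunLE A' (G r) (mix (a h) s nil) [] Q K
        (mix (Function.update (a h) 2 [b]) s nil))
    (hH : ∀ h s b, ok (h ++ [b]) →
      ∃ Q, (∀ q ∈ Q, Al' q) ∧ RunLE A' H (mix (a h) s nil) (γ h b) Q K
        (mix (Function.update (a (h ++ [b])) 2 [b]) s nil))
    {N : Prog} {s : Store} {g Q t s'} (h : Run A N s g Q t s') :
    ∀ w, ok (w ++ g) → (∀ q ∈ Q, Al q) → (∀ r, (s r).length + t ≤ m) →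
      ∃ Q', (∀ q ∈ Q', Al' q) ∧
        RunLE A' (sim G H N) (mix (a w) s nil) (simGuess γ w g) Q' (t * (K + 3))
          (mix (a (w ++ g)) s' nil) := by
  have ask : ∀ {w : List Bool} {s s' : Store} {r : ℕ} {b : Bool} {c₁ c₀ : Prog} {g Q t},
      ok (w ++ g) → (∀ q ∈ s r :: Q, Al q) → (∀ r, (s r).length + (t + 1) ≤ m) →
      (b = true ↔ s r ∈ A) →
      (∃ Q', (∀ q ∈ Q', Al' q) ∧ RunLE A' (if b then sim G H c₁ else sim G H c₀)
        (mix (a w) s nil) (simGuess γ w g) Q' (t * (K + 3)) (mix (a (w ++ g)) s' nil)) →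
      ∃ Q', (∀ q ∈ Q', Al' q) ∧ RunLE A' (sim G H (.ask r c₁ c₀))
        (mix (a w) s nil) (simGuess γ w g) Q' ((t + 1) * (K + 3)) (mix (a (w ++ g)) s' nil) := by
    rintro w s s' r b c₁ c₀ g Q t hw hQ hm hb ⟨Q', hQ', k⟩
    obtain ⟨Q₁, hQ₁, k₁⟩ := hG w s r b (hok _ _ hw) (fun r => by have := hm r; omega)
      (hQ _ (by simp)) hb
    refine ⟨Q₁ ++ Q', fun q hq => (List.mem_append.1 hq).elim (hQ₁ q) (hQ' q),
      (k₁.seq (run_branch (ha w (hok _ _ hw)) k)).mono ?_⟩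
    rw [Nat.add_mul t 1]; omega
  have guess : ∀ {w : List Bool} {s s' : Store} {b : Bool} {c₁ c₀ : Prog} {g t},
      ok (w ++ b :: g) →
      (∃ Q', (∀ q ∈ Q', Al' q) ∧ RunLE A' (if b then sim G H c₁ else sim G H c₀)
        (mix (a (w ++ [b])) s nil) (simGuess γ (w ++ [b]) g) Q' (t * (K + 3))
        (mix (a (w ++ [b] ++ g)) s' nil)) →
      ∃ Q', (∀ q ∈ Q', Al' q) ∧ RunLE A' (sim G H (.guess c₁ c₀))
        (mix (a w) s nil) (simGuess γ w (b :: g)) Q' ((t + 1) * (K + 3))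
        (mix (a (w ++ b :: g)) s' nil) := by
    rintro w s s' b c₁ c₀ g t hw ⟨Q', hQ', k⟩
    have hw' : ok (w ++ [b]) := hok _ g (by simpa using hw)
    obtain ⟨Q₁, hQ₁, k₁⟩ := hH w s b hw'
    refine ⟨Q₁ ++ Q', fun q hq => (List.mem_append.1 hq).elim (hQ₁ q) (hQ' q),
      (k₁.seq (run_branch (ha _ hw') k)).to (by simp) ?_⟩
    rw [Nat.add_mul t 1]; omega
  induction h with
  | skip s =>
    intro w _ _ _
    exact ⟨[], by simp, by simpa [simGuess, sim] using runLE_skip.mono (by omega)⟩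
  | push r b s =>
    intro w _ _ _
    exact ⟨[], by simp, by simpa [simGuess, sim] using runLE_push.to (by simp) (by omega)⟩
  | pop r s =>
    intro w _ _ _
    exact ⟨[], by simp, by simpa [simGuess, sim] using runLE_pop.to (by simp) (by omega)⟩
  | @seq c₁ c₂ s s' s'' g g' Q Q' t t' hr₁ hr₂ ih₁ ih₂ =>
    intro w hw hQ hm
    -- The invariant is that tape length plus remaining time is at most `m`. Starting below `m - (t
    -- + t')`, the first part adds at most `t`, which leaves the second part its `t'`. The
    -- subtraction is not truncated, by `hm`.
    have hl := fun r => hr₁.length_le (m := m - (t + t')) (fun r => by have := hm r; omega) |>.1 r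
    obtain ⟨Q₁, hQ₁, k₁⟩ := ih₁ w (hok _ g' (by simpa using hw)) (fun q hq => hQ q (by simp [hq]))
      (fun r => by have := hm r; omega)
    obtain ⟨Q₂, hQ₂, k₂⟩ := ih₂ (w ++ g) (by simpa using hw) (fun q hq => hQ q (by simp [hq]))
      (fun r => by have := hl r; have := hm r; omega)
    refine ⟨Q₁ ++ Q₂, fun q hq => (List.mem_append.1 hq).elim (hQ₁ q) (hQ₂ q), ?_⟩
    rw [simGuess_append]
    exact (k₁.seq k₂).to (by simp) (by rw [Nat.add_mul])
  | @test_one r c₁ c₀ cₑ s s' g Q t hr _ ih =>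
    intro w hw hQ hm
    obtain ⟨Q₁, hQ₁, k₁⟩ := ih w hw hQ (fun r => by have := hm r; omega)
    exact ⟨Q₁, hQ₁, (RunLE.test_one (by simpa using hr) k₁).mono (by rw [Nat.add_mul t 1]; omega)⟩
  | @test_zero r c₁ c₀ cₑ s s' g Q t hr _ ih =>
    intro w hw hQ hm
    obtain ⟨Q₁, hQ₁, k₁⟩ := ih w hw hQ (fun r => by have := hm r; omega)
    exact ⟨Q₁, hQ₁, (RunLE.test_zero (by simpa using hr) k₁).mono (by rw [Nat.add_mul t 1]; omega)⟩
  | @test_empty r c₁ c₀ cₑ s s' g Q t hr _ ih =>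
    intro w hw hQ hm
    obtain ⟨Q₁, hQ₁, k₁⟩ := ih w hw hQ (fun r => by have := hm r; omega)
    exact ⟨Q₁, hQ₁, (RunLE.test_empty (by simpa using hr) k₁).mono (by rw [Nat.add_mul t 1]; omega)⟩
  | loop_stop hr =>
    intro w _ _ _
    exact ⟨[], by simp, by
      simpa [simGuess, sim] using (runLE_loop_stop (by simpa using hr)).mono (by omega)⟩
  | @loop_step r c s s' s'' g g' Q Q' t t' hr hr₁ hr₂ ih₁ ih₂ =>
    intro w hw hQ hm
    have hl := fun r => hr₁.length_le (m := m - (t + t')) (fun r => by have := hm r; omega) |>.1 r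
    obtain ⟨Q₁, hQ₁, k₁⟩ := ih₁ w (hok _ g' (by simpa using hw)) (fun q hq => hQ q (by simp [hq]))
      (fun r => by have := hm r; omega)
    obtain ⟨Q₂, hQ₂, k₂⟩ := ih₂ (w ++ g) (by simpa using hw) (fun q hq => hQ q (by simp [hq]))
      (fun r => by have := hl r; have := hm r; omega)
    refine ⟨Q₁ ++ Q₂, fun q hq => (List.mem_append.1 hq).elim (hQ₁ q) (hQ₂ q), ?_⟩
    rw [simGuess_append]
    exact (RunLE.loop_step (by simpa using hr) k₁ k₂).to (by simp)
      (by rw [Nat.add_mul, Nat.add_mul]; omega)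
  | @ask_yes r c₁ c₀ s s' g Q t hr _ ih =>
    intro w hw hQ hm
    exact ask (b := true) hw hQ hm (by simpa using hr)
      (by simpa using ih w hw (fun q hq => hQ q (by simp [hq])) (fun r => by have := hm r; omega))
  | @ask_no r c₁ c₀ s s' g Q t hr _ ih =>
    intro w hw hQ hm
    exact ask (b := false) hw hQ hm (by simpa using hr)
      (by simpa using ih w hw (fun q hq => hQ q (by simp [hq])) (fun r => by have := hm r; omega))
  | @guess_one c₁ c₀ s s' g Q t _ ih =>
    intro w hw hQ hm
    exact guess (b := true) hw (by
      simpa using ih (w ++ [true]) (by simpa using hw) hQ (fun r => by have := hm r; omega))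
  | @guess_zero c₁ c₀ s s' g Q t _ ih =>
    intro w hw hQ hm
    exact guess (b := false) hw (by
      simpa using ih (w ++ [false]) (by simpa using hw) hQ (fun r => by have := hm r; omega))

/-- The choice that a simulation makes itself. -/
def pass : Prog := .guess (.push (hT 2) true) (.push (hT 2) false)

/-- Write the output of the simulated machine on tape `1`. -/
def finish : Prog := move₂ (sT 1) (hT 1) (hT 5)

theorem run_finish {A : Lang} {a s : Store} (h1 : a 1 = []) (h5 : a 5 = []) :
    RunLE A finish (mix a s nil) [] [] (8 * (s 1).length + 2)
      (mix (Function.update a 1 (s 1)) (Function.update s 1 []) nil) :=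
  (run_move₂ (by simp) (by simp) (by simp) _ (by simpa)).to (by simp [h1]) (by simp)

/-- The case of a simulation where the helper tapes are constant and choices are passed on. -/
theorem run_sim_pass {A A' : Lang} {G : ℕ → Prog} {a : Store} {Al Al' : Str → Prop} {m K : ℕ}
    (ha : a 2 = [])
    (hG : ∀ s r b, (∀ r, (s r).length ≤ m) → Al (s r) → (b = true ↔ s r ∈ A) →
      ∃ Q, (∀ q ∈ Q, Al' q) ∧ RunLE A' (G r) (mix a s nil) [] Q K
        (mix (Function.update a 2 [b]) s nil))
    {N : Prog} {q : Str} {g Q t s'} (h : Run A N (init q) g Q t s') (hQ : ∀ q ∈ Q, Al q)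
    (hm : q.length + t ≤ m) :
    ∃ Q', (∀ q ∈ Q', Al' q) ∧
      RunLE A' (sim G pass N) (mix a (init q) nil) g Q' (t * (K + 5)) (mix a s' nil) := by
  obtain ⟨Q', hQ', k⟩ := run_sim (A' := A') (G := G) (H := pass) (a := fun _ => a)
    (ok := fun _ => True) (γ := fun _ b => [b]) (Al := Al) (Al' := Al') (m := m) (K := K + 2)
    (fun _ _ => ha) (fun _ _ _ => trivial)
    (fun h s r b _ hs hal hb => by
      obtain ⟨Q, hQ, k⟩ := hG s r b hs hal hb
      exact ⟨Q, hQ, k.mono (by omega)⟩)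
    (fun h s b _ => ⟨[], by simp, runLE_guess_push.to (by simp [ha]) (by omega)⟩)
    h [] trivial hQ (fun r => by have := init_length_le q r; omega)
  rw [simGuess_id] at k
  exact ⟨Q', hQ', k⟩

theorem mix_bank_init (a : Store) (q : Str) :
    mix a (Function.update nil 0 q) nil = mix a (init q) nil := by
  rw [init_eq_update]

/-- Every machine whose paths come, with the same choices, from the paths of `N`. -/
theorem Total.transfer {A A' : Lang} {N M : Prog} {s σ : Store}
    {Φ Ψ : List Bool → List Str → ℕ → Store → Prop} (hN : Total A N s Φ)
    (h : ∀ g Q t s₁, Run A N s g Q t s₁ → Φ g Q t s₁ →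
      ∃ Q' t' s', Run A' M σ g Q' t' s' ∧ Ψ g Q' t' s') : Total A' M σ Ψ := by
  intro ω
  obtain ⟨g, ω', Q, t, s₁, hω, hr, hΦ⟩ := hN ω
  obtain ⟨Q', t', s', hr', hΨ⟩ := h g Q t s₁ hr hΦ
  exact ⟨g, ω', Q', t', s', hω, hr', hΨ⟩

/-! ### Machines with advice -/

/-- On the code of a pair `(F, q)`, run `N` on `q`, where questions are answered by the programs
`G r`; they find `F` on the helper tape `3`. -/
def adviceM (G : ℕ → Prog) (N : Prog) : Prog :=
  .seq (decode (hT 0) (hT 4) (hT 5)) (.seq (move (hT 4) (hT 3))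
    (.seq (move₂ (hT 0) (sT 0) (hT 5)) (.seq (sim G pass N) finish)))

/-- The helper tapes of `adviceM`. -/
def adviceBank (F : Str) : Store := bank [[], [], [], F, [], [], [], [], [], []]

/-- `Al'` records which questions the answering programs may ask; its instances give, at one stroke,
the shape of the questions of `primeM` and their absence in `lookM`. `G` needs to be correct only on
tapes no longer than input plus time. -/
theorem run_adviceM {A A' : Lang} {G : ℕ → Prog} {Al Al' : Str → Prop} {K : ℕ} {N : Prog}
    {z F q : Str} {g Q t s₁} (hz : dec z = (F, q)) (h : Run A N (init q) g Q t s₁)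
    (hQ : ∀ q ∈ Q, Al q)
    (hG : ∀ s r b, (∀ r, (s r).length ≤ z.length + t) → Al (s r) → (b = true ↔ s r ∈ A) →
      ∃ Q, (∀ q ∈ Q, Al' q) ∧ RunLE A' (G r) (mix (adviceBank F) s nil) [] Q K
        (mix (Function.update (adviceBank F) 2 [b]) s nil)) :
    ∃ Q' t' s', Run A' (adviceM G N) (init z) g Q' t' s' ∧ (∀ q ∈ Q', Al' q) ∧ s' 1 = s₁ 1 ∧
      t' ≤ t * (K + 5) + 30 * (z.length + t) + 20 := by
  have hl := dec_length z
  rw [hz] at hl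
  dsimp only at hl
  obtain ⟨Q', hQ', k⟩ := run_sim_pass (a := adviceBank F) (m := z.length + t) (by simp [adviceBank])
    hG h hQ (by omega)
  have k₁ := run_decode (A := A') (i := hT 0) (r := hT 4) (c := hT 5) (by simp) (by simp)
    (by simp) (init z) (by simp [init_eq_mix])
  have k₂ := run_move (A := A') (i := hT 4) (j := hT 3) (by simp)
    (mix (bank [q, [], [], [], F.reverse, [], [], [], [], []]) nil nil)
  have k₃ := run_move₂ (A := A') (i := hT 0) (j := sT 0) (k := hT 5) (by simp) (by simp) (by simp)
    (mix (bank [q, [], [], F, [], [], [], [], [], []]) nil nil) (by simp)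
  have k₄ := run_finish (A := A') (a := adviceBank F) (s := s₁) (by simp [adviceBank])
    (by simp [adviceBank])
  have h₁ := (h.length_le (init_length_le _)).1 1
  simp only [init_eq_mix z, mix_hT, bank_apply, List.getD_cons_zero, hz] at k₁ k₂ k₃
  obtain ⟨t', ht', k⟩ := (k₁.to (by simp [update_bank]) le_rfl).pre ((k₂.to (by simp [update_bank]) le_rfl).pre
    ((k₃.to (by simp [update_bank, mix_bank_init, adviceBank]) le_rfl).pre (k.post k₄)))
  refine ⟨Q', t', _, by rw [init_eq_mix]; exact k, hQ', by rw [mix_one]; simp, ht'.trans ?_⟩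
  simp
  omega

/-- Ask the oracle about the pair of the advice and the string on tape `r` of the simulated
machine; the question is marked with `pre`. -/
def primeG (pre : Str) (r : ℕ) : Prog :=
  .seq (encode (hT 3) (sT r) (hT 4) (hT 5)) (.seq (pushes (hT 4) pre)
    (.seq (.ask (hT 4) (.push (hT 2) true) (.push (hT 2) false)) (clear (hT 4))))

/-- On `(F, q)`, run `N` on `q`, where each question `u` is replaced by `(F, u)`, marked with
`pre`. -/
def primeM (pre : Str) (N : Prog) : Prog := adviceM (primeG pre) N

theorem run_primeG {A : Lang} {pre F : Str} {s : Store} {r m : ℕ} {b : Bool}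
    (hs : (s r).length ≤ m) (hF : F.length ≤ m) (hb : b = true ↔ pre ++ enc F (s r) ∈ A) :
    RunLE A (primeG pre r) (mix (adviceBank F) s nil) [] [pre ++ enc F (s r)]
      (3 * pre.length + 30 * m + 20) (mix (Function.update (adviceBank F) 2 [b]) s nil) := by
  have k₁ := run_encode (A := A) (f := hT 3) (q := sT r) (o := hT 4) (k := hT 5) (by simp) (by simp)
    (by simp) (by simp) (by simp) (mix (adviceBank F) s nil) (by simp [adviceBank])
    (by simp [adviceBank])
  have k₂ := run_pushes (A := A) (i := hT 4)
    (mix (bank [[], [], [], F, enc F (s r), [], [], [], [], []]) s nil) pre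
  have k₃ := runLE_ask_push (A := A) (r := hT 4) (x := hT 2) (b := b)
    (s := mix (bank [[], [], [], F, pre ++ enc F (s r), [], [], [], [], []]) s nil) (by simpa)
  have k₄ := run_clear (A := A) (i := hT 4)
    (mix (bank [[], [], [b], F, pre ++ enc F (s r), [], [], [], [], []]) s nil)
  refine ((k₁.to (by simp [adviceBank, update_bank]) le_rfl).pre
    ((k₂.to (by simp [update_bank]) le_rfl).pre
    ((k₃.to (by simp [update_bank]) le_rfl).post k₄))).to (by simp [adviceBank, update_bank]) ?_
  simp [adviceBank, enc_length]; omega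

theorem run_primeM {A A' : Lang} {pre z F q : Str} {N : Prog} {g Q t s₁} (hz : dec z = (F, q))
    (h : Run A N (init q) g Q t s₁) (hA : ∀ u ∈ Q, u ∈ A ↔ pre ++ enc F u ∈ A') :
    ∃ Q' t' s', Run A' (primeM pre N) (init z) g Q' t' s' ∧
      (∀ q' ∈ Q', ∃ u ∈ Q, q' = pre ++ enc F u) ∧ s' 1 = s₁ 1 ∧
      t' ≤ t * (3 * pre.length + 30 * (z.length + t) + 25) + 30 * (z.length + t) + 20 := by
  have hl := dec_length z
  rw [hz] at hl
  dsimp only at hl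
  refine run_adviceM (Al := fun u => u ∈ Q) (K := 3 * pre.length + 30 * (z.length + t) + 20)
    hz h (fun _ => id) fun s r b hs hu hb => ?_
  exact ⟨_, by simpa using ⟨_, hu, rfl⟩, run_primeG (hs r) (by omega) (hb.trans (hA _ hu))⟩

theorem isNPOM_primeM {N : Prog} (hN : IsNPOM N) (pre : Str) : IsNPOM (primeM pre N) := by
  obtain ⟨p, hp⟩ := hN.time
  refine isNPOM_of_total (f := fun n => p.eval n * (3 * pre.length + 30 * (n + p.eval n) + 25) +
    30 * (n + p.eval n) + 20) ?_ fun A z => ?_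
  · have h := PolyBd.eval p .id
    exact ((h.mul (((PolyBd.const _).add ((PolyBd.const _).mul (PolyBd.id.add h))).add
      (.const _))).add ((PolyBd.const _).mul (PolyBd.id.add h))).add (.const _)
  · have hl := dec_length z
    -- With oracle `A` the machine behaves as `N` with the section of `A` at the advice. The time
    -- bound of an NPOM holds for every oracle, hence for this one, even if the advice is nonsense.
    refine (hp {u | pre ++ enc (dec z).1 u ∈ A} (dec z).2).transfer fun g Q t s₁ hr ht => ?_
    obtain ⟨Q', t', s', k, -, -, ht'⟩ := run_primeM (pre := pre) (A' := A) (z := z) rfl hr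
      (fun u _ => Iff.rfl)
    have ht : t ≤ p.eval z.length := ht.trans (eval_mono p (by omega))
    refine ⟨Q', t', s', k, ht'.trans ?_⟩
    gcongr

/-- The oracles have to agree only on questions that `N` really asks on `q`. This is why advice that
is correct up to a polynomial length suffices. -/
theorem primeM_paths {A A' : Lang} {pre F q : Str} {N : Prog} (hN : IsNPOM N)
    (hA : ∀ u, Asks A N q u → (u ∈ A ↔ pre ++ enc F u ∈ A')) :
    Total A' (primeM pre N) (init (enc F q)) (fun g Q' _ s' => ∃ Q t s₁,
      Run A N (init q) g Q t s₁ ∧ s' 1 = s₁ 1 ∧ ∀ q' ∈ Q', ∃ u ∈ Q, q' = pre ++ enc F u) := by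
  obtain ⟨p, hp⟩ := hN.time
  refine (hp A q).transfer fun g Q t s₁ hr _ => ?_
  obtain ⟨Q', t', s', k, hQ', h1, -⟩ := run_primeM (pre := pre) (A' := A') (dec_enc F q) hr
    (fun u hu => hA u ⟨g, Q, t, s₁, hr, hu⟩)
  exact ⟨Q', t', s', k, Q, t, s₁, hr, h1, hQ'⟩

/-- The choices are kept literally, so not only the language but also the number of accepting paths
is preserved. -/
theorem primeM_acceptingPath {A A' : Lang} {pre F q : Str} {N : Prog} (hN : IsNPOM N)
    (hA : ∀ u, Asks A N q u → (u ∈ A ↔ pre ++ enc F u ∈ A')) (g : List Bool) :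
    AcceptingPath A' (primeM pre N) (enc F q) g ↔ AcceptingPath A N q g := by
  constructor
  · rintro ⟨Q', t', s', k, h1⟩
    obtain ⟨Q, t, s₁, hr, e, -⟩ := (primeM_paths hN hA).of_run k
    exact ⟨Q, t, s₁, hr, e ▸ h1⟩
  · rintro ⟨Q, t, s₁, hr, h1⟩
    obtain ⟨Q', t', s', k, -, e, -⟩ := run_primeM (pre := pre) (A' := A') (dec_enc F q) hr
      (fun u hu => hA u ⟨g, Q, t, s₁, hr, hu⟩)
    exact ⟨Q', t', s', k, e ▸ h1⟩

theorem primeM_asks {A A' : Lang} {pre F q q' : Str} {N : Prog} (hN : IsNPOM N)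
    (hA : ∀ u, Asks A N q u → (u ∈ A ↔ pre ++ enc F u ∈ A'))
    (h : Asks A' (primeM pre N) (enc F q) q') : ∃ u, Asks A N q u ∧ q' = pre ++ enc F u := by
  obtain ⟨g, Q', t', s', k, hq'⟩ := h
  obtain ⟨Q, t, s₁, hr, -, hQ'⟩ := (primeM_paths hN hA).of_run k
  obtain ⟨u, hu, rfl⟩ := hQ' q' hq'
  exact ⟨u, ⟨g, Q, t, s₁, hr, hu⟩, rfl⟩

/-! ### Finite sets as advice -/

/-- Look for `q` in a coded list of strings. Here `Y` is the part of `q` that has not been compared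
yet, `bad` is nonempty if the current entry of the list is different from `q`, and `ans` tells
whether `q` has been found. -/
def look (q : Str) : Str → Str → Str → Bool → Bool
  | [], _, _, ans => ans
  | [true], _, _, ans => ans
  | false :: F, Y, bad, ans => look q F q [] (ans || (Y.isEmpty && bad.isEmpty))
  | true :: b :: F, Y, bad, ans =>
    if Y.head? = some b then look q F Y.tail bad ans else look q F Y (true :: bad) ans

/-- The finite set that is coded by `F`. -/
def memF (F : Str) : Lang := {q | look q F q [] false = true}

/-- A mismatch leaves a bit in `bad` that stays until the end of the entry; without mismatch `Y`
loses exactly the bits of `u`. So at the separator both are empty just in case `u` was the whole of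
`Y` and nothing had gone wrong before. -/
theorem look_enc (q u F : Str) : ∀ Y bad ans, look q (enc u F) Y bad ans =
    look q F q [] (ans || (decide (u = Y) && bad.isEmpty)) := by
  induction u with
  | nil => intro Y bad ans; cases Y <;> simp [enc, look]
  | cons b u ih =>
    intro Y bad ans
    have e : enc (b :: u) F = true :: b :: enc u F := by simp [enc]
    rw [e, look]
    cases Y with
    | nil => simp [ih]
    | cons c Y =>
      by_cases hb : c = b
      · subst hb; simp [ih]
      · simp [ih, hb, Ne.symm hb]

/-- The code of a list of strings. -/
def encList : List Str → Str
  | [] => []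
  | u :: l => enc u (encList l)

theorem mem_memF_encList (l : List Str) (q : Str) : q ∈ memF (encList l) ↔ q ∈ l := by
  have : ∀ ans, look q (encList l) q [] ans = true ↔ ans = true ∨ q ∈ l := by
    induction l with
    | nil => simp [encList, look]
    | cons u l ih => intro ans; simp [encList, look_enc, ih, eq_comm (a := q), or_assoc]
  simpa [memF] using this false

theorem encList_length_le {l : List Str} {m : ℕ} (h : ∀ u ∈ l, u.length ≤ m) :
    (encList l).length ≤ l.length * (2 * m + 1) := by
  induction l with
  | nil => simp [encList]
  | cons u l ih =>
    have := ih fun v hv => h v (by simp [hv])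
    have := h u (by simp)
    simp only [encList, enc_length, List.length_cons, Nat.add_mul l.length 1]
    omega

/-- Answer the question on tape `r` of the simulated machine by looking into the advice. -/
def lookG (r : ℕ) : Prog :=
  .seq (.push (hT 2) false) (.seq (copy (hT 3) (hT 6) (hT 5)) (.seq (copy (sT r) (hT 7) (hT 5))
    (.seq (.loop (hT 6) (.test (hT 6)
      (.seq (.pop (hT 6)) (.test (hT 6)
        (.seq (.pop (hT 6)) (.test (hT 7) (.pop (hT 7)) (.push (hT 8) true) (.push (hT 8) true)))
        (.seq (.pop (hT 6)) (.test (hT 7) (.push (hT 8) true) (.pop (hT 7)) (.push (hT 8) true)))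
        .skip))
      (.seq (.pop (hT 6)) (.seq
        (.test (hT 7) .skip .skip (.test (hT 8) .skip .skip
          (.seq (.pop (hT 2)) (.push (hT 2) true))))
        (.seq (clear (hT 7)) (.seq (clear (hT 8)) (copy (sT r) (hT 7) (hT 5))))))
      .skip)) (.seq (clear (hT 7)) (clear (hT 8))))))

/-- Each bit put on `bad` is paid for by bits of `F` that have been read, so their total length
never grows. The factor `13 * m` covers the end of an entry: two tapes are cleared and the question
is copied afresh. -/
theorem run_lookG_loop {A : Lang} {F₀ q : Str} {s : Store} {r m : ℕ} (hq : s r = q)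
    (hm : q.length ≤ m) (F Y bad : Str) (ans : Bool) (hY : Y.length ≤ m)
    (hbad : bad.length + F.length ≤ m) :
    ∃ Y' bad' : Str, Y'.length ≤ m ∧ bad'.length ≤ m ∧
    RunLE A (.loop (hT 6) (.test (hT 6)
      (.seq (.pop (hT 6)) (.test (hT 6)
        (.seq (.pop (hT 6)) (.test (hT 7) (.pop (hT 7)) (.push (hT 8) true) (.push (hT 8) true)))
        (.seq (.pop (hT 6)) (.test (hT 7) (.push (hT 8) true) (.pop (hT 7)) (.push (hT 8) true)))
        .skip))
      (.seq (.pop (hT 6)) (.seq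
        (.test (hT 7) .skip .skip (.test (hT 8) .skip .skip
          (.seq (.pop (hT 2)) (.push (hT 2) true))))
        (.seq (clear (hT 7)) (.seq (clear (hT 8)) (copy (sT r) (hT 7) (hT 5))))))
      .skip))
      (mix (bank [[], [], [ans], F₀, [], [], F, Y, bad, []]) s nil) [] []
      (F.length * (13 * m + 20) + 1)
      (mix (bank [[], [], [look q F Y bad ans], F₀, [], [], [], Y', bad', []]) s nil) := by
  induction F, Y, bad, ans using look.induct q with
  | case1 Y bad ans =>
    exact ⟨Y, bad, hY, by simpa using hbad, (runLE_loop_stop (by simp)).to (by simp [look]) (by simp)⟩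
  | case2 Y bad ans =>
    refine ⟨Y, bad, hY, by simp at hbad; omega, ?_⟩
    refine (RunLE.loop_step (by simp) (RunLE.test_one (by simp) (runLE_pop.pre
      (RunLE.test_empty (by simp) runLE_skip))) (runLE_loop_stop (by simp))).to
      (by simp [look, update_bank]) (by simp)
  | case3 F Y bad ans ih =>
    simp only [List.length_cons] at hbad
    obtain ⟨Y', bad', hY', hbad', k⟩ := ih hm (by simp; omega)
    refine ⟨Y', bad', hY', hbad', ?_⟩
    have k₁ : RunLE A (.test (hT 7) .skip .skip (.test (hT 8) .skip .skip
          (.seq (.pop (hT 2)) (.push (hT 2) true))))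
        (mix (bank [[], [], [ans], F₀, [], [], F, Y, bad, []]) s nil) [] [] 4
        (mix (bank [[], [], [ans || (Y.isEmpty && bad.isEmpty)], F₀, [], [], F, Y, bad, []])
          s nil) := by
      cases Y with
      | cons b Y =>
        refine RunLE.mono (RunLE.test_bit (T := 1) (b := b) (bs := Y) (by simp) ?_) (by omega)
        cases b <;> exact runLE_skip.to (by simp) le_rfl
      | nil =>
        cases bad with
        | cons b bad =>
          refine RunLE.mono (RunLE.test_empty (by simp) (RunLE.test_bit (T := 1) (b := b)
            (bs := bad) (by simp) ?_)) (by omega)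
          cases b <;> exact runLE_skip.to (by simp) le_rfl
        | nil =>
          exact RunLE.test_empty (by simp) (RunLE.test_empty (by simp)
            ((runLE_pop.pre runLE_push).to (by simp [update_bank]) le_rfl))
    have k₂ := run_clear (A := A) (i := hT 7)
      (mix (bank [[], [], [ans || (Y.isEmpty && bad.isEmpty)], F₀, [], [], F, Y, bad, []]) s nil)
    have k₃ := run_clear (A := A) (i := hT 8)
      (mix (bank [[], [], [ans || (Y.isEmpty && bad.isEmpty)], F₀, [], [], F, [], bad, []]) s nil)
    have k₄ := run_copy (A := A) (i := sT r) (j := hT 7) (k := hT 5) (by simp) (by simp) (by simp)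
      (mix (bank [[], [], [ans || (Y.isEmpty && bad.isEmpty)], F₀, [], [], F, [], [], []]) s nil)
      (by simp)
    refine (RunLE.loop_step (by simp) (RunLE.test_zero (by simp)
      ((runLE_pop.to (by simp [update_bank]) le_rfl).pre (k₁.pre
      ((k₂.to (by simp [update_bank]) le_rfl).pre ((k₃.to (by simp [update_bank]) le_rfl).pre
      (k₄.to (by simp [update_bank, hq]) le_rfl)))))) k).to (by simp [look]) ?_
    simp [Nat.add_mul, hq]
    omega
  | case4 b F Y bad ans hb ih =>
    simp only [List.length_cons] at hbad
    obtain ⟨Y', bad', hY', hbad', k⟩ := ih (by simp; omega) (by omega)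
    refine ⟨Y', bad', hY', hbad', ?_⟩
    obtain ⟨Y, rfl⟩ : ∃ Y₁, Y = b :: Y₁ := by
      cases Y with
      | nil => simp at hb
      | cons c Y => simp at hb; exact ⟨Y, by rw [hb]⟩
    have k₁ : RunLE A (.test (hT 6)
        (.seq (.pop (hT 6)) (.test (hT 7) (.pop (hT 7)) (.push (hT 8) true) (.push (hT 8) true)))
        (.seq (.pop (hT 6)) (.test (hT 7) (.push (hT 8) true) (.pop (hT 7)) (.push (hT 8) true)))
        .skip) (mix (bank [[], [], [ans], F₀, [], [], b :: F, b :: Y, bad, []]) s nil) [] [] 4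
        (mix (bank [[], [], [ans], F₀, [], [], F, Y, bad, []]) s nil) := by
      refine RunLE.test_bit (b := b) (bs := F) (by simp) ?_
      cases b
      · exact runLE_pop.pre (RunLE.test_zero (by simp) (runLE_pop.to (by simp [update_bank]) le_rfl))
      · exact runLE_pop.pre (RunLE.test_one (by simp) (runLE_pop.to (by simp [update_bank]) le_rfl))
    refine (RunLE.loop_step (by simp) (RunLE.test_one (by simp)
      ((runLE_pop.to (by simp [update_bank]) le_rfl).pre k₁)) k).to (by simp [look]) ?_
    simp [Nat.add_mul]
    omega
  | case5 b F Y bad ans hb ih =>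
    simp only [List.length_cons] at hbad
    obtain ⟨Y', bad', hY', hbad', k⟩ := ih hY (by simp; omega)
    refine ⟨Y', bad', hY', hbad', ?_⟩
    have k₁ : RunLE A (.test (hT 6)
        (.seq (.pop (hT 6)) (.test (hT 7) (.pop (hT 7)) (.push (hT 8) true) (.push (hT 8) true)))
        (.seq (.pop (hT 6)) (.test (hT 7) (.push (hT 8) true) (.pop (hT 7)) (.push (hT 8) true)))
        .skip) (mix (bank [[], [], [ans], F₀, [], [], b :: F, Y, bad, []]) s nil) [] [] 4
        (mix (bank [[], [], [ans], F₀, [], [], F, Y, true :: bad, []]) s nil) := by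
      refine RunLE.test_bit (b := b) (bs := F) (by simp) ?_
      cases b
      · refine runLE_pop.pre (T' := 2) ?_
        rcases Y with _ | ⟨_ | _, Y⟩
        · exact (RunLE.test_empty (by simp) runLE_push).to (by simp [update_bank]) le_rfl
        · simp at hb
        · exact (RunLE.test_one (by simp) runLE_push).to (by simp [update_bank]) le_rfl
      · refine runLE_pop.pre (T' := 2) ?_
        rcases Y with _ | ⟨_ | _, Y⟩
        · exact (RunLE.test_empty (by simp) runLE_push).to (by simp [update_bank]) le_rfl
        · exact (RunLE.test_zero (by simp) runLE_push).to (by simp [update_bank]) le_rfl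
        · simp at hb
    refine (RunLE.loop_step (by simp) (RunLE.test_one (by simp)
      ((runLE_pop.to (by simp [update_bank]) le_rfl).pre k₁)) k).to (by simp [look, hb]) ?_
    simp [Nat.add_mul]
    omega

theorem run_lookG {A : Lang} {F : Str} {s : Store} {r m : ℕ} {b : Bool}
    (hs : (s r).length ≤ m) (hF : F.length ≤ m) (hb : b = true ↔ s r ∈ memF F) :
    RunLE A (lookG r) (mix (adviceBank F) s nil) [] [] (m * (13 * m + 20) + 30 * m + 20)
      (mix (Function.update (adviceBank F) 2 [b]) s nil) := by
  obtain rfl : b = look (s r) F (s r) [] false := by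
    rw [Bool.eq_iff_iff]; exact hb
  obtain ⟨Y, bad, hY, hbad, k⟩ := run_lookG_loop (A := A) (F₀ := F) (q := s r) (m := m) rfl hs F
    (s r) [] false hs (by simpa)
  have k₁ := run_copy (A := A) (i := hT 3) (j := hT 6) (k := hT 5) (by simp) (by simp) (by simp)
    (mix (bank [[], [], [false], F, [], [], [], [], [], []]) s nil) (by simp)
  have k₂ := run_copy (A := A) (i := sT r) (j := hT 7) (k := hT 5) (by simp) (by simp) (by simp)
    (mix (bank [[], [], [false], F, [], [], F, [], [], []]) s nil) (by simp)
  have k₃ := run_clear (A := A) (i := hT 7) (mix (bank [[], [], [look (s r) F (s r) [] false], F,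
    [], [], [], Y, bad, []]) s nil)
  have k₄ := run_clear (A := A) (i := hT 8) (mix (bank [[], [], [look (s r) F (s r) [] false], F,
    [], [], [], [], bad, []]) s nil)
  refine ((runLE_push.to (by simp [adviceBank, update_bank]) le_rfl).pre
    ((k₁.to (by simp [update_bank]) le_rfl).pre ((k₂.to (by simp [update_bank]) le_rfl).pre
    (k.pre ((k₃.to (by simp [update_bank]) le_rfl).pre k₄))))).to
    (by simp [adviceBank, update_bank]) ?_
  have := Nat.mul_le_mul_right (13 * m + 20) hF
  simp
  omega

/-- On `(F, q)`, run `N` on `q` with the oracle `memF F`. -/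
def lookM (N : Prog) : Prog := adviceM lookG N

theorem run_lookM {A : Lang} {z F q : Str} {N : Prog} {g Q t s₁} (hz : dec z = (F, q))
    (h : Run (memF F) N (init q) g Q t s₁) :
    ∃ t' s', Run A (lookM N) (init z) g [] t' s' ∧ s' 1 = s₁ 1 ∧
      t' ≤ t * ((z.length + t) * (13 * (z.length + t) + 20) + 30 * (z.length + t) + 20 + 5) +
        30 * (z.length + t) + 20 := by
  have hl := dec_length z
  rw [hz] at hl
  dsimp only at hl
  obtain ⟨Q', t', s', k, hQ', h⟩ := run_adviceM (A' := A) (Al := fun _ => True)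
    -- No question is admissible, so the simulation asks none.
    (Al' := fun _ => False) (G := lookG)
    (K := (z.length + t) * (13 * (z.length + t) + 20) + 30 * (z.length + t) + 20)
    hz h (fun _ _ => trivial) fun s r b hs hu hb =>
      ⟨[], by simp, run_lookG (hs r) (by omega) hb⟩
  obtain rfl : Q' = [] := List.eq_nil_iff_forall_not_mem.2 hQ'
  exact ⟨t', s', k, h⟩

theorem det_lookG (r : ℕ) : (lookG r).Deterministic := by
  simp [lookG, Prog.Deterministic, det_copy, det_clear]

theorem isDPOM_lookM {N : Prog} (hN : IsDPOM N) : IsDPOM (lookM N) := by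
  refine ⟨⟨det_decode _ _ _, det_move _ _, det_move₂ _ _ _, det_sim det_lookG (.inr hN.1),
    det_move₂ _ _ _⟩, ?_⟩
  obtain ⟨p, hp⟩ := hN.2.time
  refine isNPOM_of_total (f := fun n => p.eval n * ((n + p.eval n) * (13 * (n + p.eval n) + 20) +
    30 * (n + p.eval n) + 20 + 5) + 30 * (n + p.eval n) + 20) ?_ fun A z => ?_
  · have h := PolyBd.eval p .id
    have h' := PolyBd.id.add h
    exact ((h.mul ((((h'.mul (((PolyBd.const _).mul h').add (.const _))).add
      ((PolyBd.const _).mul h')).add (.const _)).add (.const _))).add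
      ((PolyBd.const _).mul h')).add (.const _)
  · have hl := dec_length z
    refine (hp (memF (dec z).1) (dec z).2).transfer fun g Q t s₁ hr ht => ?_
    obtain ⟨t', s', k, -, ht'⟩ := run_lookM (A := A) (z := z) rfl hr
    have ht : t ≤ p.eval z.length := ht.trans (eval_mono p (by omega))
    refine ⟨[], t', s', k, ht'.trans ?_⟩
    gcongr

theorem enc_mem_langOf_lookM {A : Lang} {N : Prog} (hN : IsNPOM N) (F q : Str) :
    enc F q ∈ langOf A (lookM N) ↔ q ∈ langOf (memF F) N := by
  obtain ⟨p, hp⟩ := hN.time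
  have h : Total A (lookM N) (init (enc F q)) (fun g _ _ s' => ∃ Q t s₁,
      Run (memF F) N (init q) g Q t s₁ ∧ s' 1 = s₁ 1) := by
    refine (hp (memF F) q).transfer fun g Q t s₁ hr _ => ?_
    obtain ⟨t', s', k, e, -⟩ := run_lookM (A := A) (dec_enc F q) hr
    exact ⟨[], t', s', k, Q, t, s₁, hr, e⟩
  constructor
  · rintro ⟨g, Q', t', s', k, h1⟩
    obtain ⟨Q, t, s₁, hr, e⟩ := h.of_run k
    exact ⟨g, Q, t, s₁, hr, e ▸ h1⟩
  · rintro ⟨g, Q, t, s₁, hr, h1⟩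
    obtain ⟨t', s', k, e, -⟩ := run_lookM (A := A) (dec_enc F q) hr
    exact ⟨g, [], t', s', k, e ▸ h1⟩

/-! ### Replacing an oracle in `P^O` by the oracle `O` -/

/-- Answer the question on tape `r` of the simulated machine by running `M`. -/
def composeG (M : Prog) (r : ℕ) : Prog :=
  .seq (copy (sT r) (hT 3) (hT 5)) (.seq (call 3 4 M) (.seq
    (.test (hT 4) (.push (hT 2) true) (.push (hT 2) true) (.push (hT 2) false))
    (.seq (clear (hT 3)) (clear (hT 4)))))

/-- The machine `N` with the oracle `L(M)`. -/
def composeM (N M : Prog) : Prog :=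
  .seq (move₂ (hT 0) (sT 0) (hT 5)) (.seq (sim (composeG M) pass N) finish)

theorem run_composeG {O : Lang} {M : Prog} {s : Store} {r m : ℕ} {b : Bool} {Q t b'}
    (h : Run O M (init (s r)) [] Q t b') (hs : (s r).length + t ≤ m)
    (hb : b = true ↔ b' 1 ≠ []) :
    RunLE O (composeG M r) (mix (adviceBank []) s nil) [] Q (callCost M m + 13 * m + 10)
      (mix (Function.update (adviceBank []) 2 [b]) s nil) := by
  have k₁ := run_copy (A := O) (i := sT r) (j := hT 3) (k := hT 5) (by simp) (by simp) (by simp)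
    (mix (adviceBank []) s nil) (by simp [adviceBank])
  have k₂ := run_call (a := bank [[], [], [], s r, [], [], [], [], [], []]) (s := s) (i := 3) (j := 4)
    (by simp) (by simp) (by simp) (by simp) h
  have k₃ : RunLE O (.test (hT 4) (.push (hT 2) true) (.push (hT 2) true) (.push (hT 2) false))
      (mix (bank [[], [], [], s r, b' 1, [], [], [], [], []]) s nil) [] [] 2
      (mix (bank [[], [], [b], s r, b' 1, [], [], [], [], []]) s nil) := by
    rcases hb' : b' 1 with _ | ⟨c, l⟩
    · obtain rfl : b = false := by simpa [hb'] using hb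
      exact RunLE.test_empty (by simp) (runLE_push.to (by simp [update_bank]) le_rfl)
    · obtain rfl : b = true := by simpa [hb'] using hb
      refine RunLE.test_bit (b := c) (bs := l) (by simp) ?_
      cases c <;> exact runLE_push.to (by simp [update_bank]) le_rfl
  have k₄ := run_clear (A := O) (i := hT 3)
    (mix (bank [[], [], [b], s r, b' 1, [], [], [], [], []]) s nil)
  have k₅ := run_clear (A := O) (i := hT 4)
    (mix (bank [[], [], [b], [], b' 1, [], [], [], [], []]) s nil)
  refine ((k₁.to (by simp [adviceBank, update_bank]) le_rfl).pre
    ((k₂.to (by simp [update_bank]) le_rfl).post (k₃.pre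
    ((k₄.to (by simp [update_bank]) le_rfl).pre k₅)))).to (by simp [adviceBank, update_bank]) ?_
  have h₁ := (h.length_le (init_length_le _)).1 1
  have := callCost_mono (M := M) hs
  simp only [mix_sT, mix_hT, bank_apply, List.getD_cons_succ, List.getD_cons_zero]
  omega

/-- Since `M` is deterministic, its single path reveals both yes and no answers and adds no choices.
The choices are those of `N`, so unambiguity survives the absorption of the oracle. -/
theorem run_composeM {O : Lang} {N M : Prog} {p : Polynomial ℕ} (hM : M.Deterministic)
    (hp : ∀ A x, Total A M (init x) (fun _ _ t _ => t ≤ p.eval x.length))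
    {x : Str} {g Q t s₁} (h : Run (langOf O M) N (init x) g Q t s₁) :
    ∃ Q' t' s', Run O (composeM N M) (init x) g Q' t' s' ∧ s' 1 = s₁ 1 ∧
      t' ≤ t * (callCost M (x.length + t + p.eval (x.length + t)) +
        13 * (x.length + t + p.eval (x.length + t)) + 10 + 5) + 20 * (x.length + t) + 10 := by
  obtain ⟨Q', hQ', k⟩ := run_sim_pass (A' := O) (G := composeG M) (a := adviceBank [])
    (m := x.length + t) (Al := fun _ => True) (Al' := fun _ => True)
    (K := callCost M (x.length + t + p.eval (x.length + t)) +
      13 * (x.length + t + p.eval (x.length + t)) + 10) (by simp [adviceBank])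
    (fun s r b hs _ hb => by
      obtain ⟨g', ω', Q', t', b', -, hr, ht⟩ := hp O (s r) zeros
      obtain rfl := hr.no_guess hM
      refine ⟨Q', fun _ _ => trivial, run_composeG hr ?_ (hb.trans ⟨?_, fun h1 => ?_⟩)⟩
      · exact Nat.add_le_add (hs r) (ht.trans (eval_mono p (hs r)))
      · rintro ⟨g₂, Q₂, t₂, s₂, hr₂, h1⟩
        obtain rfl := hr₂.no_guess hM
        obtain ⟨-, -, rfl⟩ := hr.det_self hr₂
        exact h1
      · exact ⟨[], Q', t', b', hr, h1⟩) h (fun _ _ => trivial) le_rfl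
  have k₃ := run_move₂ (A := O) (i := hT 0) (j := sT 0) (k := hT 5) (by simp) (by simp) (by simp)
    (mix (bank [x, [], [], [], [], [], [], [], [], []]) nil nil) (by simp)
  have k₄ := run_finish (A := O) (a := adviceBank []) (s := s₁) (by simp [adviceBank])
    (by simp [adviceBank])
  have h₁ := (h.length_le (init_length_le _)).1 1
  obtain ⟨t', ht', k⟩ := (k₃.to (by simp [update_bank, mix_bank_init, adviceBank]) le_rfl).pre
    (k.post k₄)
  refine ⟨Q', t', _, by rw [init_eq_mix]; exact k, by rw [mix_one]; simp, ht'.trans ?_⟩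
  simp only [mix_hT, bank_apply, List.getD_cons_zero]
  omega

theorem composeM_spec {N M : Prog} (hN : IsNPOM N) (hM : IsDPOM M) : IsNPOM (composeM N M) ∧
    ∀ O x g, AcceptingPath O (composeM N M) x g ↔ AcceptingPath (langOf O M) N x g := by
  obtain ⟨p, hp⟩ := hM.2.time
  obtain ⟨pN, hpN⟩ := hN.time
  constructor
  · refine isNPOM_of_total (f := fun n => pN.eval n *
      (callCost M (n + pN.eval n + p.eval (n + pN.eval n)) +
        13 * (n + pN.eval n + p.eval (n + pN.eval n)) + 10 + 5) + 20 * (n + pN.eval n) + 10)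
      ?_ fun O x => ?_
    · have h := PolyBd.eval pN .id
      have h' := PolyBd.id.add h
      have h'' := h'.add (h'.eval p)
      exact ((h.mul ((((h''.callCost M).add ((PolyBd.const _).mul h'')).add (.const _)).add
        (.const _))).add ((PolyBd.const _).mul h')).add (.const _)
    · refine (hpN (langOf O M) x).transfer fun g Q t s₁ hr ht => ?_
      obtain ⟨Q', t', s', k, -, ht'⟩ := run_composeM hM.1 hp hr
      refine ⟨Q', t', s', k, ht'.trans ?_⟩
      have h₁ := eval_mono p (Nat.add_le_add_left ht x.length)
      have h₂ := callCost_mono (M := M) (Nat.add_le_add (Nat.add_le_add_left ht x.length) h₁)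
      gcongr
  · intro O x g
    constructor
    · rintro ⟨Q', t', s', k, h1⟩
      obtain ⟨Q, t, s₁, hr, e⟩ := ((hpN (langOf O M) x).transfer
        (Ψ := fun g _ _ s' => ∃ Q t s₁, Run (langOf O M) N (init x) g Q t s₁ ∧ s' 1 = s₁ 1)
        fun g Q t s₁ hr _ => by
          obtain ⟨Q', t', s', k, e, -⟩ := run_composeM hM.1 hp hr
          exact ⟨Q', t', s', k, Q, t, s₁, hr, e⟩).of_run k
      exact ⟨Q, t, s₁, hr, e ▸ h1⟩
    · rintro ⟨Q, t, s₁, hr, h1⟩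
      obtain ⟨Q', t', s', k, e, -⟩ := run_composeM hM.1 hp hr
      exact ⟨Q', t', s', k, e ▸ h1⟩

theorem langOf_composeM {N M : Prog} (hN : IsNPOM N) (hM : IsDPOM M) (O : Lang) :
    langOf O (composeM N M) = langOf (langOf O M) N :=
  Set.ext fun x => exists_congr fun g => (composeM_spec hN hM).2 O x g

theorem isDPOM_composeM {N M : Prog} (hN : IsDPOM N) (hM : IsDPOM M) : IsDPOM (composeM N M) := by
  refine ⟨⟨det_move₂ _ _ _, det_sim (fun r => ?_) (.inr hN.1), det_move₂ _ _ _⟩,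
    (composeM_spec hN.2 hM).1⟩
  simp [composeG, Prog.Deterministic, det_copy, det_clear, det_call hM.1]

/-! ### Prefixes of accepting paths -/

/-- The pairs `(u, x)` for which `N(x)` has an accepting path whose choices begin with the reverse
of `u` and then `1`. -/
def prefixes (A : Lang) (N : Prog) : Lang :=
  {z | ∃ g, AcceptingPath A N (dec z).2 g ∧ (dec z).1.reverse ++ [true] <+: g}

/-- The first choices are those on the helper tape `4`. -/
def preH : Prog :=
  .test (hT 4) (.seq (.pop (hT 4)) (.push (hT 2) true)) (.seq (.pop (hT 4)) (.push (hT 2) false)) pass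

/-- The machine for `prefixes`. -/
def preM (N : Prog) : Prog :=
  .seq (.push (hT 4) true) (.seq (decode (hT 0) (hT 4) (hT 5)) (.seq (move₂ (hT 0) (sT 0) (hT 5))
    (.seq (sim (fun r => .ask (sT r) (.push (hT 2) true) (.push (hT 2) false)) preH N)
      (.test (hT 4) .skip .skip finish))))

/-- The first `n` choices are dictated by a tape and use up no guess of the simulator. -/
theorem simGuess_drop (n : ℕ) (h g : List Bool) :
    simGuess (fun h b => if h.length < n then [] else [b]) h g = g.drop (n - h.length) := by
  induction g generalizing h with
  | nil => simp [simGuess]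
  | cons b g ih =>
    rw [simGuess, ih, List.length_append, List.length_singleton]
    split_ifs with hn
    · obtain ⟨k, hk⟩ : ∃ k, n - h.length = k + 1 := ⟨n - h.length - 1, by omega⟩
      rw [hk, show n - (h.length + 1) = k by omega]
      simp
    · rw [show n - (h.length + 1) = 0 by omega, show n - h.length = 0 by omega]
      simp

/-- The mark `true` is put on tape `4` before decoding, so it lies below the reversed first
component and is dictated last. If the simulated path halts while dictated choices remain, the
prefix does not fit and the machine rejects. -/
theorem run_preM {A : Lang} {N : Prog} {z F x : Str} (hz : dec z = (F, x)) {g Q t s₁}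
    (h : Run A N (init x) g Q t s₁)
    (hg : g <+: F.reverse ++ [true] ∨ F.reverse ++ [true] <+: g) :
    ∃ Q' t' s', Run A (preM N) (init z) (g.drop (F.length + 1)) Q' t' s' ∧
      s' 1 = (if F.length + 1 ≤ g.length then s₁ 1 else []) ∧
      t' ≤ t * 8 + 30 * (z.length + t) + 30 := by
  have hl := dec_length z
  rw [hz] at hl
  dsimp only at hl
  set w := F.reverse ++ [true] with hw
  have hwl : w.length = F.length + 1 := by simp [hw]
  obtain ⟨Q', hQ', k⟩ := run_sim (A' := A)
    (G := fun r => .ask (sT r) (.push (hT 2) true) (.push (hT 2) false)) (H := preH)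
    (a := fun h => bank [[], [], [], [], w.drop h.length, [], [], [], [], []])
    -- Only histories compatible with the dictated choices `w` occur; `w.drop h.length` is what is
    -- left to dictate.
    (ok := fun h => h <+: w ∨ w <+: h) (γ := fun h b => if h.length < w.length then [] else [b])
    (Al := fun _ => True) (Al' := fun _ => True) (m := x.length + t) (K := 5)
    (fun _ _ => by simp)
    (fun h h' hh => hh.elim (fun k => .inl ((List.prefix_append _ _).trans k))
      (fun k => List.prefix_or_prefix_of_prefix (List.prefix_append _ _) k))
    (fun h s r b _ _ _ hb => ⟨[s r], fun _ _ => trivial, by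
      simpa [update_bank] using (runLE_ask_push (A := A) (r := sT r) (x := hT 2) (b := b)
        (s := mix (bank [[], [], [], [], w.drop h.length, [], [], [], [], []]) s nil)
        (by simpa)).mono (T' := 5) (by omega)⟩)
    (fun h s b hh => by
      refine ⟨[], by simp, ?_⟩
      by_cases hlt : h.length < w.length
      · have hp : h ++ [b] <+: w := by
          refine hh.elim id fun k => ?_
          rw [k.eq_of_length_le (by simp; omega)]
        obtain ⟨v, hv⟩ := hp
        have e₁ : w.drop h.length = b :: v := by rw [← hv]; simp
        have e₂ : w.drop (h ++ [b]).length = v := by rw [← hv, List.drop_left]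
        simp only [hlt, if_true, e₁, e₂]
        refine RunLE.mono (RunLE.test_bit (T := 2) (b := b) (bs := v) (by simp) ?_) (by omega)
        cases b <;> exact (runLE_pop.pre runLE_push).to (by simp [update_bank]) le_rfl
      · have e₁ : w.drop h.length = [] := List.drop_eq_nil_of_le (by omega)
        have e₂ : w.drop (h ++ [b]).length = [] := List.drop_eq_nil_of_le (by simp; omega)
        simp only [hlt, if_false, e₁, e₂]
        exact RunLE.mono (RunLE.test_empty (by simp)
          (runLE_guess_push.to (by simp [update_bank]) le_rfl)) (by omega))
    h [] (by simpa using hg) (fun _ _ => trivial) (fun r => by have := init_length_le x r; omega)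
  rw [simGuess_drop, hwl] at k
  simp only [List.length_nil, Nat.sub_zero, List.drop_zero, List.nil_append] at k
  have k₁ := run_decode (A := A) (i := hT 0) (r := hT 4) (c := hT 5) (by simp) (by simp)
    (by simp) (mix (bank [z, [], [], [], [true], [], [], [], [], []]) nil nil) (by simp)
  have k₃ := run_move₂ (A := A) (i := hT 0) (j := sT 0) (k := hT 5) (by simp) (by simp) (by simp)
    (mix (bank [x, [], [], [], w, [], [], [], [], []]) nil nil) (by simp)
  have h₁ := (h.length_le (init_length_le _)).1 1
  have kf : ∃ s', s' 1 = (if F.length + 1 ≤ g.length then s₁ 1 else []) ∧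
      RunLE A (.test (hT 4) .skip .skip finish)
        (mix (bank [[], [], [], [], w.drop g.length, [], [], [], [], []]) s₁ nil) [] []
        (8 * (s₁ 1).length + 3) s' := by
    split_ifs with hc
    · rw [List.drop_eq_nil_of_le (by omega)]
      exact ⟨_, by rw [mix_one]; simp, RunLE.test_empty (by simp) (run_finish (by simp) (by simp))⟩
    · rcases hd : w.drop g.length with _ | ⟨b, v⟩
      · rw [List.drop_eq_nil_iff] at hd; omega
      · refine ⟨mix (bank [[], [], [], [], b :: v, [], [], [], [], []]) s₁ nil,
          by rw [mix_one]; simp, ?_⟩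
        refine RunLE.mono (RunLE.test_bit (T := 1) (b := b) (bs := v) (by simp) ?_) (by omega)
        cases b <;> exact runLE_skip
  obtain ⟨s', hs', kf⟩ := kf
  simp only [mix_hT, bank_apply, List.getD_cons_zero, hz] at k₁
  have k₀ : RunLE A (.push (hT 4) true)
      (mix (bank [z, [], [], [], [], [], [], [], [], []]) nil nil) [] [] 1
      (mix (bank [z, [], [], [], [true], [], [], [], [], []]) nil nil) :=
    runLE_push.to (by simp [update_bank]) le_rfl
  obtain ⟨t', ht', k⟩ := k₀.pre ((k₁.to (by simp [update_bank, ← hw]) le_rfl).pre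
    ((k₃.to (by simp [update_bank, mix_bank_init]) le_rfl).pre (k.post kf)))
  refine ⟨Q', t', _, by rw [init_eq_mix]; exact k, hs', ht'.trans ?_⟩
  simp
  omega

theorem preM_spec {N : Prog} (hN : IsNPOM N) : IsNPOM (preM N) ∧
    ∀ A z g, AcceptingPath A (preM N) z g ↔
      AcceptingPath A N (dec z).2 ((dec z).1.reverse ++ [true] ++ g) := by
  obtain ⟨p, hp⟩ := hN.time
  have total : ∀ A z, Total A (preM N) (init z) (fun g' _ t' s' => (∃ g Q t s₁,
      Run A N (init (dec z).2) g Q t s₁ ∧ g' = g.drop ((dec z).1.length + 1) ∧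
      (g <+: (dec z).1.reverse ++ [true] ∨ (dec z).1.reverse ++ [true] <+: g) ∧
      s' 1 = (if (dec z).1.length + 1 ≤ g.length then s₁ 1 else [])) ∧
      t' ≤ p.eval z.length * 8 + 30 * (z.length + p.eval z.length) + 30) := by
    intro A z ω
    have hl := dec_length z
    -- Putting the dictated choices in front of the given stream yields the path of `N` that is to
    -- be simulated.
    obtain ⟨g, ω', Q, t, s₁, hω, hr, ht⟩ := hp A (dec z).2 ((dec z).1.reverse ++ [true] ++ₛ ω)
    have hg : g <+: (dec z).1.reverse ++ [true] ∨ (dec z).1.reverse ++ [true] <+: g := by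
      rcases le_total g.length ((dec z).1.reverse ++ [true]).length with hle | hle
      · left
        have := congrArg (Stream'.take g.length) hω
        rw [Stream'.take_append_of_le_length (h := hle), Stream'.take_append_of_le_length (h := le_rfl),
          List.take_length] at this
        rw [← this]; exact List.take_prefix _ _
      · right
        have := congrArg (Stream'.take ((dec z).1.reverse ++ [true]).length) hω
        rw [Stream'.take_append_of_le_length (h := hle), Stream'.take_append_of_le_length (h := le_rfl),
          List.take_length] at this
        rw [this]; exact List.take_prefix _ _
    obtain ⟨Q', t', s', k, hs', ht'⟩ := run_preM rfl hr hg
    have ht : t ≤ p.eval z.length := ht.trans (eval_mono p (by omega))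
    -- The simulator uses only the choices beyond the dictated ones, and none at all if `N` halts
    -- earlier.
    have hω' : ∃ ω'', ω = g.drop ((dec z).1.length + 1) ++ₛ ω'' := by
      rcases hg with ⟨v, hv⟩ | ⟨v, hv⟩
      · refine ⟨ω, ?_⟩
        have : g.length ≤ (dec z).1.length + 1 := by
          have := congrArg List.length hv; simp at this; omega
        rw [List.drop_eq_nil_of_le this]; rfl
      · refine ⟨ω', ?_⟩
        rw [← hv, Stream'.append_append_stream _ v] at hω
        rw [← hv, List.drop_append_of_le_length (by simp), List.drop_eq_nil_of_le (by simp)]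
        exact Stream'.append_right_injective _ _ _ hω
    obtain ⟨ω'', hω''⟩ := hω'
    refine ⟨_, ω'', Q', t', s', hω'', k, ⟨g, Q, t, s₁, hr, rfl, hg, hs'⟩, ht'.trans ?_⟩
    gcongr
  refine ⟨isNPOM_of_total (f := fun n => p.eval n * 8 + 30 * (n + p.eval n) + 30) ?_
    fun A z => (total A z).mono fun _ _ _ _ _ h => h.2, fun A z g => ⟨?_, ?_⟩⟩
  · have h := PolyBd.eval p .id
    exact ((h.mul (.const _)).add ((PolyBd.const _).mul (PolyBd.id.add h))).add (.const _)
  · rintro ⟨Q', t', s', k, h1⟩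
    obtain ⟨⟨g', Q, t, s₁, hr, rfl, hg, e⟩, -⟩ := (total A z).of_run k
    rw [e] at h1
    split_ifs at h1 with hc
    · have hp : (dec z).1.reverse ++ [true] <+: g' := by
        refine hg.elim (fun k => ?_) id
        rw [k.eq_of_length_le (by simpa using hc)]
      obtain ⟨v, rfl⟩ := hp
      rw [List.drop_append_of_le_length (by simp), List.drop_eq_nil_of_le (by simp)]
      exact ⟨Q, t, s₁, hr, h1⟩
    · exact absurd rfl h1
  · rintro ⟨Q, t, s₁, hr, h1⟩
    obtain ⟨Q', t', s', k, e, -⟩ := run_preM rfl hr (.inr (List.prefix_append _ _))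
    rw [List.drop_append_of_le_length (by simp), List.drop_eq_nil_of_le (by simp)] at k
    rw [if_pos (by simp)] at e
    exact ⟨Q', t', s', k, e ▸ h1⟩

theorem langOf_preM {N : Prog} (hN : IsNPOM N) (A : Lang) :
    langOf A (preM N) = prefixes A N := by
  ext z
  constructor
  · rintro ⟨g, hg⟩
    exact ⟨_, ((preM_spec hN).2 A z g).1 hg, List.prefix_append _ _⟩
  · rintro ⟨_, hg, v, rfl⟩
    exact ⟨v, ((preM_spec hN).2 A z v).2 hg⟩

/-- Prepending the fixed choices embeds the accepting paths into those of `N`. This is what puts the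
prefix set of a UP machine into UP. -/
theorem unambiguousAt_preM {N : Prog} (hN : IsNPOM N) {A : Lang} (h : ∀ x, UnambiguousAt A N x)
    (z : Str) : UnambiguousAt A (preM N) z := fun g g' hg hg' =>
  List.append_cancel_left
    (h _ _ _ (((preM_spec hN).2 A z g).1 hg) (((preM_spec hN).2 A z g').1 hg'))

/-! ### Search -/

/-- There is a path on which the choices follow a given rule. -/
theorem Total.exists_of_rule {A : Lang} {N : Prog} {s : Store}
    {Φ : List Bool → List Str → ℕ → Store → Prop} (hN : Total A N s Φ) (f : List Bool → Bool) :
    ∃ g Q t s', Run A N s g Q t s' ∧ Φ g Q t s' ∧ ∀ h b h', g = h ++ b :: h' → b = f h := by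
  -- The history after `n` choices that obey the rule; reading off the last bits gives the stream to
  -- which totality is applied.
  let pfx : ℕ → List Bool := fun n => Nat.rec [] (fun _ l => l ++ [f l]) n
  have hpfx : ∀ n, pfx (n + 1) = pfx n ++ [f (pfx n)] := fun _ => rfl
  let ω : Stream' Bool := fun n => f (pfx n)
  obtain ⟨g, ω', Q, t, s', hω, hr, hΦ⟩ := hN ω
  have bit : ∀ (h : List Bool) (b : Bool) (ω'' : Stream' Bool),
      ω = h ++ₛ Stream'.cons b ω'' → b = f (pfx h.length) := by
    intro h b ω'' e
    have : ω.get h.length = b := by rw [e, Stream'.get_append_length]; rfl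
    rw [← this]; rfl
  have key : ∀ (h : List Bool) (ω'' : Stream' Bool), ω = h ++ₛ ω'' → pfx h.length = h := by
    intro h
    induction h using List.reverseRecOn with
    | nil => intro _ _; rfl
    | append_singleton h b ih =>
      intro ω'' e
      rw [Stream'.append_append_stream] at e
      have e' := bit h b ω'' e
      rw [List.length_append, List.length_singleton, hpfx, ← e', ih _ e]
  refine ⟨g, Q, t, s', hr, hΦ, ?_⟩
  rintro h b h' rfl
  rw [Stream'.append_append_stream] at hω
  rw [bit h b _ hω, key h _ hω]

/-- If each choice of a path is `1` just in case the choices so far, followed by `1`, can be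
extended to an element of `Acc`, then the path itself is in `Acc`. -/
theorem mem_of_prefix_rule {Acc : Set (List Bool)} {g : List Bool} (hne : Acc.Nonempty)
    (h₁ : ∀ g' ∈ Acc, g <+: g' → g' = g) (h₂ : ∀ g' ∈ Acc, g' <+: g → g' = g)
    (rule : ∀ h b h', g = h ++ b :: h' → (b = true ↔ ∃ g' ∈ Acc, h ++ [true] <+: g')) :
    g ∈ Acc := by
  have key : ∀ h, h <+: g → ∃ g' ∈ Acc, h <+: g' := by
    intro h
    induction h using List.reverseRecOn with
    | nil => intro _; obtain ⟨g', hg'⟩ := hne; exact ⟨g', hg', List.nil_prefix⟩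
    | append_singleton h b ih =>
      rintro ⟨v, hv⟩
      obtain ⟨g', hg', w, hw⟩ := ih ⟨b :: v, by simpa using hv⟩
      have r := rule h b v (by simpa using hv.symm)
      cases b with
      | true => exact r.1 rfl
      | false =>
        refine ⟨g', hg', ?_⟩
        -- The rule chose `0` at `h`. A member of `Acc` extending `h` cannot go on with `1`, since
        -- the rule would then have chosen `1`; and if it ends at `h`, it is a prefix of `g` and so
        -- equals `g`.
        rcases w with _ | ⟨c, w⟩
        · have := h₂ g' hg' ⟨false :: v, by rw [← hw]; simpa using hv⟩
          rw [this]; exact ⟨v, hv⟩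
        · cases c with
          | true => exact absurd (r.2 ⟨g', hg', w, by simpa using hw⟩) (by simp)
          | false => exact ⟨w, by simpa using hw⟩
  obtain ⟨g', hg', hp⟩ := key g List.prefix_rfl
  exact h₁ g' hg' hp ▸ hg'

/-- Make the choice that is recommended by the oracle. -/
def searchH (pre : Str) : Prog :=
  .seq (encode (hT 3) (hT 0) (hT 4) (hT 5)) (.seq (pushes (hT 4) pre)
    (.seq (.ask (hT 4) (.seq (.push (hT 2) true) (.push (hT 3) true))
      (.seq (.push (hT 2) false) (.push (hT 3) false))) (clear (hT 4))))

/-- The deterministic machine that follows the path of `N` that is recommended by the oracle. -/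
def searchM (pre : Str) (N : Prog) : Prog :=
  .seq (copy (hT 0) (sT 0) (hT 5)) (.seq
    (sim (fun _ => .push (hT 2) false) (searchH pre) N) finish)

theorem run_searchH {A : Lang} {pre x : Str} {s : Store} {h : List Bool} {m : ℕ} {b : Bool}
    (hx : x.length ≤ m) (hh : h.length ≤ m) (hb : b = true ↔ pre ++ enc h.reverse x ∈ A) :
    RunLE A (searchH pre) (mix (bank [x, [], [], h.reverse, [], [], [], [], [], []]) s nil) []
      [pre ++ enc h.reverse x] (3 * pre.length + 30 * m + 20)
      (mix (Function.update (bank [x, [], [], (h ++ [b]).reverse, [], [], [], [], [], []]) 2 [b])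
        s nil) := by
  have k₁ := run_encode (A := A) (f := hT 3) (q := hT 0) (o := hT 4) (k := hT 5) (by simp) (by simp)
    (by simp) (by simp) (by simp) (mix (bank [x, [], [], h.reverse, [], [], [], [], [], []]) s nil)
    (by simp) (by simp)
  have k₂ := run_pushes (A := A) (i := hT 4)
    (mix (bank [x, [], [], h.reverse, enc h.reverse x, [], [], [], [], []]) s nil) pre
  have k₃ : RunLE A (.ask (hT 4) (.seq (.push (hT 2) true) (.push (hT 3) true))
      (.seq (.push (hT 2) false) (.push (hT 3) false)))
      (mix (bank [x, [], [], h.reverse, pre ++ enc h.reverse x, [], [], [], [], []]) s nil) []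
      [mix (bank [x, [], [], h.reverse, pre ++ enc h.reverse x, [], [], [], [], []]) s nil (hT 4)] 3
      (mix (bank [x, [], [b], b :: h.reverse, pre ++ enc h.reverse x, [], [], [], [], []])
        s nil) := by
    cases b
    · exact RunLE.ask_no (by simpa using hb)
        ((runLE_push.pre runLE_push).to (by simp [update_bank]) le_rfl)
    · exact RunLE.ask_yes (by simpa using hb)
        ((runLE_push.pre runLE_push).to (by simp [update_bank]) le_rfl)
  have k₄ := run_clear (A := A) (i := hT 4)
    (mix (bank [x, [], [b], b :: h.reverse, pre ++ enc h.reverse x, [], [], [], [], []]) s nil)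
  refine ((k₁.to (by simp [update_bank]) le_rfl).pre
    ((k₂.to (by simp [update_bank]) le_rfl).pre (k₃.post k₄))).to (by simp [update_bank]) ?_
  simp [enc_length]; omega

theorem run_searchM {A : Lang} {pre x : Str} {N : Prog} {g Q t s₁}
    (h : Run ∅ N (init x) g Q t s₁)
    (rule : ∀ h b h', g = h ++ b :: h' → (b = true ↔ pre ++ enc h.reverse x ∈ A)) :
    ∃ Q' t' s', Run A (searchM pre N) (init x) [] Q' t' s' ∧ s' 1 = s₁ 1 ∧
      (∀ q ∈ Q', ∃ y, q = pre ++ y) ∧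
      t' ≤ t * (3 * pre.length + 30 * (x.length + t) + 20 + 3) + 20 * (x.length + t) + 10 := by
  have hgl := h.guess_length_le
  obtain ⟨Q', hQ', k⟩ := run_sim (A' := A)
    (G := fun _ => .push (hT 2) false) (H := searchH pre)
    -- Tape `3` is a stack and carries the latest choice on top; `prefixes` reverses it back.
    (a := fun h => bank [x, [], [], h.reverse, [], [], [], [], [], []])
    (ok := fun h => h <+: g) (γ := fun _ _ => [])
    (Al := fun _ => True) (Al' := fun q => ∃ y, q = pre ++ y) (m := x.length + t)
    (K := 3 * pre.length + 30 * (x.length + t) + 20)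
    (fun _ _ => by simp)
    (fun h h' hh => (List.prefix_append _ _).trans hh)
    (fun h s r b _ _ _ hb => ⟨[], by simp, by
      obtain rfl : b = false := by simpa using hb
      exact runLE_push.to (by simp) (by omega)⟩)
    (fun h s b hh => by
      have hl := hh.length_le
      simp only [List.length_append, List.length_singleton] at hl
      obtain ⟨v, hv⟩ := hh
      exact ⟨_, by simp, run_searchH (by omega) (by omega) (rule h b v (by simpa using hv.symm))⟩)
    h [] (by simp) (fun _ _ => trivial) (fun r => by have := init_length_le x r; omega)
  rw [simGuess_nil] at k
  have k₃ := run_copy (A := A) (i := hT 0) (j := sT 0) (k := hT 5) (by simp) (by simp) (by simp)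
    (mix (bank [x, [], [], [], [], [], [], [], [], []]) nil nil) (by simp)
  have k₄ := run_finish (A := A)
    (a := bank [x, [], [], ([] ++ g).reverse, [], [], [], [], [], []]) (s := s₁) (by simp)
    (by simp)
  have h₁ := (h.length_le (init_length_le _)).1 1
  obtain ⟨t', ht', k⟩ := (k₃.to (by simp [mix_bank_init]) le_rfl).pre (k.post k₄)
  refine ⟨Q', t', _, by rw [init_eq_mix]; exact k, by rw [mix_one]; simp, hQ', ht'.trans ?_⟩
  simp only [mix_hT, bank_apply, List.getD_cons_zero]
  omega

-- For an arbitrary oracle the search still follows some genuine path of `N`. This gives both the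
-- time bound and the fact that acceptance is always justified by an accepting path.
open Classical in
theorem searchM_spec {N : Prog} (hN : IsNPOM N) (pre : Str) : IsDPOM (searchM pre N) ∧
    ∀ A x, ∃ g Q t s₁ Q' t' s', Run ∅ N (init x) g Q t s₁ ∧
      (∀ h b h', g = h ++ b :: h' → (b = true ↔ pre ++ enc h.reverse x ∈ A)) ∧
      Run A (searchM pre N) (init x) [] Q' t' s' ∧ s' 1 = s₁ 1 ∧ ∀ q ∈ Q', ∃ y, q = pre ++ y := by
  obtain ⟨p, hp⟩ := hN.time
  have key : ∀ A x, ∃ g Q t s₁ Q' t' s', Run ∅ N (init x) g Q t s₁ ∧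
      (∀ h b h', g = h ++ b :: h' → (b = true ↔ pre ++ enc h.reverse x ∈ A)) ∧
      Run A (searchM pre N) (init x) [] Q' t' s' ∧ s' 1 = s₁ 1 ∧ (∀ q ∈ Q', ∃ y, q = pre ++ y) ∧
      t' ≤ p.eval x.length * (3 * pre.length + 30 * (x.length + p.eval x.length) + 20 + 3) +
        20 * (x.length + p.eval x.length) + 10 := by
    intro A x
    obtain ⟨g, Q, t, s₁, hr, ht, rule⟩ := (hp ∅ x).exists_of_rule
      fun h => decide (pre ++ enc h.reverse x ∈ A)
    have rule' : ∀ h b h', g = h ++ b :: h' → (b = true ↔ pre ++ enc h.reverse x ∈ A) :=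
      fun h b h' e => by rw [rule h b h' e, decide_eq_true_iff]
    obtain ⟨Q', t', s', k, e, hQ', ht'⟩ := run_searchM hr rule'
    refine ⟨g, Q, t, s₁, Q', t', s', hr, rule', k, e, hQ', ht'.trans ?_⟩
    gcongr
  refine ⟨⟨⟨det_copy _ _ _, det_sim (fun _ => trivial) (.inl ?_), det_move₂ _ _ _⟩, ?_⟩, ?_⟩
  · simp [searchH, Prog.Deterministic, det_encode, det_pushes, det_clear]
  · refine isNPOM_of_total (f := fun n => p.eval n * (3 * pre.length + 30 * (n + p.eval n) + 20 + 3) +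
      20 * (n + p.eval n) + 10) ?_ fun A x => ?_
    · have h := PolyBd.eval p .id
      have h' := PolyBd.id.add h
      exact ((h.mul ((((PolyBd.const _).add ((PolyBd.const _).mul h')).add (.const _)).add (.const _))).add
        ((PolyBd.const _).mul h')).add (.const _)
    · obtain ⟨g, Q, t, s₁, Q', t', s', -, -, k, -, -, ht⟩ := key A x
      exact Total.of_det k ht
  · intro A x
    obtain ⟨g, Q, t, s₁, Q', t', s', h₁, h₂, h₃, h₄, h₅, -⟩ := key A x
    exact ⟨g, Q, t, s₁, Q', t', s', h₁, h₂, h₃, h₄, h₅⟩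

/-! ### Strings of polynomial length -/

/-- Execute `c` `n` times. -/
def repeatN (c : Prog) : ℕ → Prog
  | 0 => .skip
  | n + 1 => .seq (repeatN c n) c

/-- Multiply the length of tape `1` by the length of tape `0`. -/
def mulStep : Prog :=
  .seq (move (hT 1) (hT 3)) (.loop (hT 3) (.seq (.pop (hT 3)) (copy (hT 0) (hT 1) (hT 5))))

/-- The machine that on input of length `n` writes a string of length `(n + 2) ^ d`. -/
def polyM (d : ℕ) : Prog :=
  .seq (.push (hT 0) true) (.seq (.push (hT 0) true) (.seq (.push (hT 1) true) (repeatN mulStep d)))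

theorem run_mulStep {A : Lang} (x y : Str) : ∃ y' : Str, y'.length = y.length * x.length ∧
    RunLE A mulStep (mix (bank [x, y, [], [], [], [], [], [], [], []]) nil nil) [] []
      (y.length * (9 * x.length + 10) + 10)
      (mix (bank [x, y', [], [], [], [], [], [], [], []]) nil nil) := by
  have key : ∀ w y : Str, ∃ y' : Str, y'.length = w.length * x.length + y.length ∧
      RunLE A (.loop (hT 3) (.seq (.pop (hT 3)) (copy (hT 0) (hT 1) (hT 5))))
        (mix (bank [x, y, [], w, [], [], [], [], [], []]) nil nil) [] []
        (w.length * (9 * x.length + 4) + 1)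
        (mix (bank [x, y', [], [], [], [], [], [], [], []]) nil nil) := by
    intro w
    induction w with
    | nil => intro y; exact ⟨y, by simp, (runLE_loop_stop (by simp)).mono (by simp)⟩
    | cons b w ih =>
      intro y
      obtain ⟨y', hy', k⟩ := ih (x ++ y)
      have k₁ := run_copy (A := A) (i := hT 0) (j := hT 1) (k := hT 5) (by simp) (by simp) (by simp)
        (mix (bank [x, y, [], w, [], [], [], [], [], []]) nil nil) (by simp)
      refine ⟨y', by simp [hy', Nat.add_mul]; omega, (RunLE.loop_step (by simp)
        ((runLE_pop.to (by simp [update_bank]) le_rfl).pre (k₁.to (by simp [update_bank])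
          le_rfl)) k).mono ?_⟩
      simp [Nat.add_mul]; omega
  obtain ⟨y', hy', k⟩ := key y.reverse []
  have k₁ := run_move (A := A) (i := hT 1) (j := hT 3) (by simp)
    (mix (bank [x, y, [], [], [], [], [], [], [], []]) nil nil)
  refine ⟨y', by simpa using hy', ((k₁.to (by simp [update_bank]) le_rfl).pre k).mono ?_⟩
  simp [Nat.mul_add]; omega

theorem run_polyM (A : Lang) (d : ℕ) (x : Str) : ∃ t' s', Run A (polyM d) (init x) [] [] t' s' ∧
    (s' 1).length = (x.length + 2) ^ d ∧
    t' ≤ d * ((x.length + 2) ^ d * (9 * (x.length + 2) + 10) + 10) + 4 := by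
  have key : ∀ d, ∃ y' : Str, y'.length = (x.length + 2) ^ d ∧
      RunLE A (repeatN mulStep d)
        (mix (bank [true :: true :: x, [true], [], [], [], [], [], [], [], []]) nil nil) [] []
        (d * ((x.length + 2) ^ d * (9 * (x.length + 2) + 10) + 10) + 1)
        (mix (bank [true :: true :: x, y', [], [], [], [], [], [], [], []]) nil nil) := by
    intro d
    induction d with
    | zero => exact ⟨[true], by simp, runLE_skip.mono (by simp)⟩
    | succ d ih =>
      obtain ⟨y, hy, k⟩ := ih
      obtain ⟨y', hy', k'⟩ := run_mulStep (A := A) (true :: true :: x) y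
      refine ⟨y', by rw [hy', hy, pow_succ]; simp, (k.pre k').mono ?_⟩
      have h₁ : (x.length + 2) ^ d ≤ (x.length + 2) ^ (d + 1) := Nat.pow_le_pow_right (by omega)
        (by omega)
      have h₂ := Nat.mul_le_mul_right (9 * (x.length + 2) + 10) h₁
      have h₃ := Nat.mul_le_mul_left d (Nat.add_le_add_right h₂ 10)
      rw [show (true :: true :: x).length = x.length + 2 from rfl, hy, Nat.add_mul d 1]
      omega
  obtain ⟨y, hy, k⟩ := key d
  have kp : RunLE A (polyM d) (mix (bank [x, [], [], [], [], [], [], [], [], []]) nil nil) [] [] _ _ :=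
    (runLE_push.to (by simp [update_bank]; rfl) le_rfl).pre
    ((runLE_push.to (by simp [update_bank]; rfl) le_rfl).pre
    ((runLE_push.to (by simp [update_bank]) le_rfl).pre k))
  obtain ⟨t', ht', k⟩ := kp
  refine ⟨t', _, by rw [init_eq_mix]; exact k, by rw [mix_one]; simpa using hy, ht'.trans (by omega)⟩

/-- Every polynomial is bounded by a power of `n + 2`. -/
theorem exists_pow_ge {f : ℕ → ℕ} (hf : PolyBd f) : ∃ d, ∀ n, f n ≤ (n + 2) ^ d := by
  obtain ⟨p, hp⟩ := hf
  suffices ∃ d, ∀ n, p.eval n ≤ (n + 2) ^ d by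
    obtain ⟨d, hd⟩ := this
    exact ⟨d, fun n => (hp n).trans (hd n)⟩
  clear hp
  induction p using Polynomial.induction_on' with
  | add p q hp hq =>
    obtain ⟨d, hd⟩ := hp
    obtain ⟨e, he⟩ := hq
    -- The additional factor `n + 2`, which is at least 2, absorbs the sum of two powers.
    refine ⟨max d e + 1, fun n => ?_⟩
    have h₁ : (n + 2) ^ d ≤ (n + 2) ^ max d e := Nat.pow_le_pow_right (by omega) (le_max_left _ _)
    have h₂ : (n + 2) ^ e ≤ (n + 2) ^ max d e := Nat.pow_le_pow_right (by omega) (le_max_right _ _)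
    have h₃ := hd n
    have h₄ := he n
    rw [Polynomial.eval_add, pow_succ]
    nlinarith
  | monomial k a =>
    -- The coefficient `a` is below `(n + 2) ^ a`; having base at least 2 even for `n = 0` is the
    -- reason for `n + 2`.
    refine ⟨a + k, fun n => ?_⟩
    rw [Polynomial.eval_monomial, pow_add]
    exact Nat.mul_le_mul ((Nat.lt_pow_self (by omega)).le) (Nat.pow_le_pow_left (by omega) _)

/-! ### Guessing a string -/

/-- Guess a string that is not longer than the one on tape `c`, and write it on tape `o`. -/
def guessLoop (c o : ℕ) : Prog :=
  .loop c (.seq (.pop c) (.guess (.guess (.push o true) (.push o false)) .skip))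

/-- In each round one choice decides whether a bit is written and a second one decides which. A
short string can be produced on many paths; this is harmless, as guessing occurs only in machines
that need not be unambiguous. -/
theorem total_guessLoop {A : Lang} {c o : ℕ} (hco : c ≠ o) (σ : Store) :
    Total A (guessLoop c o) σ (fun _ Q t s' => Q = [] ∧ t ≤ 6 * (σ c).length + 1 ∧
      ∃ y : Str, y.length ≤ (σ c).length ∧
        s' = Function.update (Function.update σ o (y ++ σ o)) c []) := by
  generalize hw : σ c = w
  induction w generalizing σ with
  | nil =>
    refine Total.of_det (Run.loop_stop hw) ⟨rfl, by simp, [], by simp, ?_⟩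
    rw [List.nil_append, Function.update_eq_self, ← hw, Function.update_eq_self]
  | cons b w ih =>
    intro ω
    have pop : Run A (.pop c) σ [] [] 1 (Function.update σ c w) := by
      have := Run.pop (A := A) c σ; rwa [hw] at this
    have body : ∃ g ω', ω = g ++ₛ ω' ∧ ∃ (y : Str) (t : ℕ), y.length ≤ 1 ∧ t ≤ 4 ∧
        Run A (.seq (.pop c) (.guess (.guess (.push o true) (.push o false)) .skip)) σ g [] t
          (Function.update (Function.update σ c w) o (y ++ σ o)) := by
      rw [← Stream'.eta ω]
      cases ω.head with
      | false =>
        refine ⟨[false], ω.tail, rfl, [], 3, by simp, by simp, ?_⟩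
        have e : Function.update (Function.update σ c w) o ([] ++ σ o) = Function.update σ c w := by
          rw [List.nil_append, ← Function.update_of_ne hco.symm w σ, Function.update_eq_self]
        rw [e]
        exact pop.seq (.guess_zero (.skip _))
      | true =>
        rw [← Stream'.eta ω.tail]
        have e : ∀ b, Function.update (Function.update σ c w) o (b :: Function.update σ c w o) =
            Function.update (Function.update σ c w) o ([b] ++ σ o) := by
          intro b; rw [Function.update_of_ne hco.symm]; rfl
        cases ω.tail.head with
        | false =>
          refine ⟨[true, false], ω.tail.tail, rfl, [false], 4, by simp, by simp, ?_⟩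
          rw [← e]
          exact pop.seq (.guess_one (.guess_zero (.push _ _ _)))
        | true =>
          refine ⟨[true, true], ω.tail.tail, rfl, [true], 4, by simp, by simp, ?_⟩
          rw [← e]
          exact pop.seq (.guess_one (.guess_one (.push _ _ _)))
    obtain ⟨g, ω', rfl, y, t, hy, ht, k⟩ := body
    obtain ⟨g', ω'', Q', t', s', rfl, k', rfl, ht', y', hy', rfl⟩ :=
      ih (Function.update (Function.update σ c w) o (y ++ σ o)) (by simp [hco]) ω'
    refine ⟨g ++ g', ω'', [], t + t' + 1, _, by rw [Stream'.append_append_stream],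
      .loop_step (Q := []) (by simp [hw]) k k', rfl, by simp; omega, y' ++ y, by simp; omega, ?_⟩
    ext1 n
    by_cases h : n = c <;> by_cases h' : n = o <;> simp [h, h', Function.update_apply]

theorem run_guessLoop {A : Lang} {c o : ℕ} (hco : c ≠ o) (σ : Store) (y : Str)
    (hy : y.length ≤ (σ c).length) :
    ∃ g, RunLE A (guessLoop c o) σ g [] (6 * (σ c).length + 1)
      (Function.update (Function.update σ o (y ++ σ o)) c []) := by
  generalize hw : σ c = w at hy
  induction w generalizing σ y with
  | nil =>
    obtain rfl : y = [] := by simpa using hy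
    refine ⟨[], (runLE_loop_stop hw).to ?_ (by simp)⟩
    rw [List.nil_append, Function.update_eq_self, ← hw, Function.update_eq_self]
  | cons b w ih =>
    have pop : RunLE A (.pop c) σ [] [] 1 (Function.update σ c w) :=
      runLE_pop.to (by rw [hw]; rfl) le_rfl
    induction y using List.reverseRecOn with
    | nil =>
      obtain ⟨g, k⟩ := ih (Function.update σ c w) [] (by simp) (by simp)
      refine ⟨false :: g, ((RunLE.loop_step (g := [false]) (Q := []) (by simp [hw])
        (pop.pre (RunLE.guess_bit (b := false) runLE_skip)) k).to ?_ (by simp; omega))⟩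
      ext1 n
      by_cases h : n = c <;> by_cases h' : n = o <;>
        simp [h, h', hco.symm]
    -- The bit that is written first ends up at the bottom, so `y` is taken apart from its end.
    | append_singleton y b _ =>
      obtain ⟨g, k⟩ := ih (Function.update (Function.update σ c w) o (b :: σ o)) y
        (by simp [hco]) (by simpa using hy)
      have k₁ : RunLE A (.guess (.guess (.push o true) (.push o false)) .skip)
          (Function.update σ c w) [true, b] [] 3
          (Function.update (Function.update σ c w) o (b :: σ o)) :=
        RunLE.guess_bit (b := true) (runLE_guess_push.to
          (by rw [Function.update_of_ne hco.symm]) le_rfl)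
      refine ⟨[true, b] ++ g, (RunLE.loop_step (Q := []) (by simp [hw]) (pop.pre k₁) k).to ?_
        (by simp; omega)⟩
      ext1 n
      by_cases h : n = c <;> by_cases h' : n = o <;> simp [h, h', Function.update_apply]

/-- The machine that on input of length `n` guesses a string of length at most `(n + 2) ^ d` and
writes it on tape `1`. -/
def guessM (d : ℕ) : Prog := .seq (call 0 3 (polyM d)) (guessLoop (hT 3) (hT 1))

/-- A bound for the time of `polyM d`. -/
def polyCost (d n : ℕ) : ℕ := d * ((n + 2) ^ d * (9 * (n + 2) + 10) + 10) + 4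

theorem PolyBd.polyCost (d : ℕ) {f : ℕ → ℕ} (h : PolyBd f) :
    PolyBd (fun n => SparseUP.polyCost d (f n)) := by
  have h' := h.add (.const 2)
  exact ((PolyBd.const _).mul (((h'.pow d).mul (((PolyBd.const _).mul h').add (.const _))).add
    (.const _))).add (.const _)

theorem run_call_polyM {A : Lang} {a s : Store} {i j d : ℕ} (hi : i ≠ 5) (hj : j ≠ 5)
    (h5 : a 5 = []) (haj : a j = []) : ∃ y : Str, y.length = ((a i).length + 2) ^ d ∧
    RunLE A (call i j (polyM d)) (mix a s nil) [] []
      (callCost (polyM d) ((a i).length + polyCost d (a i).length))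
      (mix (Function.update a j y) s nil) := by
  obtain ⟨t', s', k, hy, ht⟩ := run_polyM A d (a i)
  exact ⟨s' 1, hy, (run_call hi hj h5 haj k).mono (callCost_mono (Nat.add_le_add_left ht _))⟩

/-- A bound for the time of `guessM d`. -/
def guessCost (d n : ℕ) : ℕ := callCost (polyM d) (n + polyCost d n) + 6 * (n + 2) ^ d + 1

theorem PolyBd.guessCost (d : ℕ) {f : ℕ → ℕ} (h : PolyBd f) :
    PolyBd (fun n => SparseUP.guessCost d (f n)) :=
  (((h.add (h.polyCost d)).callCost _).add ((PolyBd.const _).mul ((h.add (.const _)).pow d))).add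
    (.const _)

theorem total_guessM (A : Lang) (d : ℕ) (x : Str) :
    Total A (guessM d) (init x) (fun _ Q t s' => Q = [] ∧ t ≤ guessCost d x.length ∧
      (s' 1).length ≤ (x.length + 2) ^ d) := by
  obtain ⟨y, hy, t₁, ht₁, k⟩ := run_call_polyM (A := A) (s := nil) (i := 0) (j := 3) (d := d)
    (a := bank [x, [], [], [], [], [], [], [], [], []]) (by simp) (by simp) (by simp) (by simp)
  rw [← init_eq_mix] at k
  refine Total.seq (Φ := fun g Q t s' => g = [] ∧ Q = [] ∧ t = t₁ ∧ s' = _)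
    (Total.of_det k ⟨rfl, rfl, rfl, rfl⟩) ?_
  rintro g Q t s' - ⟨rfl, rfl, rfl, rfl⟩
  refine (total_guessLoop (by simp) _).mono ?_
  rintro g Q t s' - ⟨rfl, ht, u, hu, rfl⟩
  simp only [mix_hT, Function.update_self] at hu ht
  refine ⟨rfl, ?_, ?_⟩
  · simp only [bank_apply, List.getD_cons_zero] at ht₁ hy
    rw [hy] at ht
    unfold guessCost
    omega
  · simp only [bank_apply, List.getD_cons_zero] at hy
    rw [update_mix_hT, update_mix_hT, mix_one, ← hy]
    simpa using hu

theorem run_guessM (A : Lang) (d : ℕ) (x y : Str) (hy : y.length ≤ (x.length + 2) ^ d) :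
    ∃ g t' s', Run A (guessM d) (init x) g [] t' s' ∧ s' 1 = y := by
  obtain ⟨y', hy', k⟩ := run_call_polyM (A := A) (s := nil) (i := 0) (j := 3) (d := d)
    (a := bank [x, [], [], [], [], [], [], [], [], []]) (by simp) (by simp) (by simp) (by simp)
  simp only [bank_apply, List.getD_cons_zero] at hy'
  obtain ⟨g, k₂⟩ := run_guessLoop (A := A) (c := hT 3) (o := hT 1) (by simp)
    (mix (Function.update (bank [x, [], [], [], [], [], [], [], [], []]) 3 y') nil nil) y
    (by simp; omega)
  obtain ⟨t', -, k⟩ := k.pre k₂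
  exact ⟨g, t', _, by rw [init_eq_mix]; exact k,
    by rw [update_mix_hT, update_mix_hT, mix_one]; simp⟩

theorem isNPOM_guessM (d : ℕ) : IsNPOM (guessM d) :=
  isNPOM_of_total (PolyBd.id.guessCost d) fun A x =>
    (total_guessM A d x).mono fun _ _ _ _ _ h => h.2.1

/-! ### Machines without questions -/

theorem total_noAsk {N : Prog} {x : Str} {Φ : List Bool → List Str → ℕ → Store → Prop}
    (h : Total ∅ N (init x) Φ) (A : Lang) :
    Total A N.noAsk (init x) (fun g Q t' s' => Q = [] ∧ ∃ Q' t, t' ≤ t ∧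
      Run ∅ N (init x) g Q' t s' ∧ Φ g Q' t s') :=
  h.transfer fun _ Q t s₁ hr hΦ =>
    let ⟨t', ht', k⟩ := hr.noAsk A
    ⟨[], t', s₁, k, rfl, Q, t, ht', hr, hΦ⟩

theorem isNPOM_noAsk {N : Prog} (hN : IsNPOM N) : IsNPOM N.noAsk := by
  obtain ⟨p, hp⟩ := hN.time
  exact isNPOM_iff.2 ⟨p, fun A x => (total_noAsk (hp ∅ x) A).mono
    fun _ _ _ _ _ ⟨_, _, _, ht', _, ht⟩ => ht'.trans ht⟩

theorem langOf_noAsk {N : Prog} (hN : IsNPOM N) (A : Lang) : langOf A N.noAsk = langOf ∅ N := by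
  obtain ⟨p, hp⟩ := hN.time
  ext x
  constructor
  · rintro ⟨g, Q, t, s', k, h1⟩
    obtain ⟨-, Q', t', -, hr, -⟩ := (total_noAsk (hp ∅ x) A).of_run k
    exact ⟨g, Q', t', s', hr, h1⟩
  · rintro ⟨g, Q, t, s', hr, h1⟩
    obtain ⟨t', -, k⟩ := hr.noAsk A
    exact ⟨g, [], t', s', k, h1⟩

/-! ### Testing advice -/

/-- Compare `N` and `E` on the string on tape `6`, with the advice on tape `3`. -/
def badTest (N E : Prog) : Prog :=
  .seq (call 6 7 N) (.seq (encode (hT 3) (hT 6) (hT 4) (hT 5)) (.seq (call 4 8 E)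
    (.test (hT 7) (.test (hT 8) .skip .skip (.push (hT 1) true))
      (.test (hT 8) .skip .skip (.push (hT 1) true)) .skip)))

/-- On `(F, y)`, search for a string `u`, not longer than `y`, that is accepted by `N` while `(F, u)`
is not accepted by `E`. -/
def badM (N E : Prog) : Prog :=
  .seq (decode (hT 0) (hT 4) (hT 5)) (.seq (move (hT 4) (hT 3))
    (.seq (guessLoop (hT 0) (hT 6)) (badTest N E)))

theorem run_badTest {O : Lang} {N E : Prog} {F u : Str} {g Q t b Q₂ t₂ b₂ m}
    (h : Run O N (init u) g Q t b) (h₂ : Run O E (init (enc F u)) [] Q₂ t₂ b₂)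
    (hm : u.length + t ≤ m) (hm₂ : (enc F u).length + t₂ ≤ m) :
    ∃ Q' t' s', Run O (badTest N E)
      (mix (bank [[], [], [], F, [], [], u, [], [], []]) nil nil) g Q' t' s' ∧
      t' ≤ callCost N m + callCost E m + 20 * m + 20 ∧ (s' 1 ≠ [] ↔ b 1 ≠ [] ∧ b₂ 1 = []) := by
  have k₁ := run_call (a := bank [[], [], [], F, [], [], u, [], [], []]) (s := nil) (i := 6) (j := 7)
    (by simp) (by simp) (by simp) (by simp) h
  have k₂ := run_encode (A := O) (f := hT 3) (q := hT 6) (o := hT 4) (k := hT 5) (by simp) (by simp)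
    (by simp) (by simp) (by simp) (mix (bank [[], [], [], F, [], [], u, b 1, [], []]) nil nil)
    (by simp) (by simp)
  have k₃ := run_call (a := bank [[], [], [], F, enc F u, [], u, b 1, [], []]) (s := nil) (i := 4)
    (j := 8) (by simp) (by simp) (by simp) (by simp) h₂
  have k₄ : ∃ s', (s' 1 ≠ [] ↔ b 1 ≠ [] ∧ b₂ 1 = []) ∧
      RunLE O (.test (hT 7) (.test (hT 8) .skip .skip (.push (hT 1) true))
        (.test (hT 8) .skip .skip (.push (hT 1) true)) .skip)
        (mix (bank [[], [], [], F, enc F u, [], u, b 1, b₂ 1, []]) nil nil) [] [] 3 s' := by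
    rcases hb : b 1 with _ | ⟨c, l⟩
    · refine ⟨_, ?_, RunLE.mono (RunLE.test_empty (by simp) runLE_skip) (by omega)⟩
      rw [mix_one]; simp
    · rcases hb₂ : b₂ 1 with _ | ⟨c₂, l₂⟩
      · have k : RunLE O (.test (hT 8) .skip .skip (.push (hT 1) true))
            (mix (bank [[], [], [], F, enc F u, [], u, c :: l, [], []]) nil nil) [] [] 2
            (mix (bank [[], [true], [], F, enc F u, [], u, c :: l, [], []]) nil nil) :=
          RunLE.test_empty (by simp) (runLE_push.to (by simp [update_bank]) le_rfl)
        refine ⟨_, ?_, RunLE.test_bit (b := c) (bs := l) (by simp) (by rw [ite_self]; exact k)⟩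
        rw [mix_one]; simp
      · have k : RunLE O (.test (hT 8) .skip .skip (.push (hT 1) true))
            (mix (bank [[], [], [], F, enc F u, [], u, c :: l, c₂ :: l₂, []]) nil nil) [] [] 2
            (mix (bank [[], [], [], F, enc F u, [], u, c :: l, c₂ :: l₂, []]) nil nil) := by
          refine RunLE.test_bit (b := c₂) (bs := l₂) (by simp) ?_
          cases c₂ <;> exact runLE_skip
        refine ⟨_, ?_, RunLE.test_bit (b := c) (bs := l) (by simp) (by rw [ite_self]; exact k)⟩
        rw [mix_one]; simp
  obtain ⟨s', hs', k₄⟩ := k₄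
  obtain ⟨t', ht', k⟩ := (k₁.to (by simp [update_bank]) le_rfl).seq
    ((k₂.to (by simp [update_bank]) le_rfl).pre
    ((k₃.to (by simp [update_bank]) le_rfl).post k₄))
  rw [List.append_nil] at k
  refine ⟨_, t', s', k, ht'.trans ?_, hs'⟩
  have h₁ := callCost_mono (M := N) hm
  have h₂ := callCost_mono (M := E) hm₂
  rw [enc_length] at hm₂
  simp only [mix_hT, bank_apply, List.getD_cons_succ, List.getD_cons_zero] at h₁ h₂ ⊢
  omega

/-- `E` is deterministic, so rejection of the pair is visible on its only path, while acceptance by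
`N` is witnessed by the path at hand. Hence the existence of such a `u` is an NP property. -/
theorem badM_spec {N E : Prog} (hN : IsNPOM N) (hE : IsDPOM E) : IsNPOM (badM N E) ∧
    ∀ O F y, enc F y ∈ langOf O (badM N E) ↔
      ∃ u : Str, u.length ≤ y.length ∧ u ∈ langOf O N ∧ enc F u ∉ langOf O E := by
  obtain ⟨p, hp⟩ := hN.time
  obtain ⟨pE, hpE⟩ := hE.2.time
  -- On input of length `n` both `F` and `u` have length at most `n`, so their pair has length at
  -- most `3 * n + 1`; the rest is running time.
  let f : ℕ → ℕ := fun n => 3 * n + 1 + p.eval n + pE.eval (3 * n + 1)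
  have start : ∀ O z, RunLE O (.seq (decode (hT 0) (hT 4) (hT 5)) (move (hT 4) (hT 3))) (init z) []
      [] (10 * z.length + 7)
      (mix (bank [(dec z).2, [], [], (dec z).1, [], [], [], [], [], []]) nil nil) := by
    intro O z
    have hl := dec_length z
    have k₁ := run_decode (A := O) (i := hT 0) (r := hT 4) (c := hT 5) (by simp) (by simp)
      (by simp) (init z) (by simp [init_eq_mix])
    have k₂ := run_move (A := O) (i := hT 4) (j := hT 3) (by simp)
      (mix (bank [(dec z).2, [], [], [], (dec z).1.reverse, [], [], [], [], []]) nil nil)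
    simp only [init_eq_mix z, mix_hT, bank_apply, List.getD_cons_zero] at k₁ k₂ ⊢
    refine ((k₁.to (by simp [update_bank]) le_rfl).pre k₂).to (by simp [update_bank]) ?_
    simp; omega
  have assoc : ∀ {O : Lang} {c d e s g Q t s'}, Run O (.seq (.seq c d) e) s g Q t s' →
      Run O (.seq c (.seq d e)) s g Q t s' := by
    intro O c d e s g Q t s' h
    cases h with
    | seq h₁ h₂ =>
      cases h₁ with
      | seq h₁ h₁' => rw [List.append_assoc, List.append_assoc, Nat.add_assoc]; exact h₁.seq (h₁'.seq h₂)
  have detE : ∀ O x, ∃ Q t b, Run O E (init x) [] Q t b ∧ t ≤ pE.eval x.length ∧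
      (x ∈ langOf O E ↔ b 1 ≠ []) := by
    intro O x
    obtain ⟨g, ω', Q, t, b, -, hr, ht⟩ := hpE O x zeros
    obtain rfl := hr.no_guess hE.1
    refine ⟨Q, t, b, hr, ht, ?_, fun h => ⟨[], Q, t, b, hr, h⟩⟩
    rintro ⟨g, Q₂, t₂, b₂, hr₂, h1⟩
    obtain rfl := hr₂.no_guess hE.1
    obtain ⟨-, -, rfl⟩ := hr.det_self hr₂
    exact h1
  have bound : ∀ z : Str, ∀ F u : Str, F = (dec z).1 → u.length ≤ (dec z).2.length →
      ∀ t t₂, t ≤ p.eval u.length → t₂ ≤ pE.eval (enc F u).length →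
      u.length + t ≤ f z.length ∧ (enc F u).length + t₂ ≤ f z.length := by
    rintro z _ u rfl hu t t₂ ht ht₂
    have hl := dec_length z
    have h₁ := eval_mono p (show u.length ≤ z.length by omega)
    have h₂ := eval_mono pE (show (enc (dec z).1 u).length ≤ 3 * z.length + 1 by
      rw [enc_length]; omega)
    have h₃ := enc_length (dec z).1 u
    simp only [f]
    omega
  have total : ∀ O z, Total O (badM N E) (init z) (fun _ _ t s' =>
      t ≤ callCost N (f z.length) + callCost E (f z.length) + 20 * f z.length + 20 +
        16 * z.length + 8 ∧ (s' 1 ≠ [] → ∃ u : Str, u.length ≤ (dec z).2.length ∧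
        u ∈ langOf O N ∧ enc (dec z).1 u ∉ langOf O E)) := by
    intro O z
    have hl := dec_length z
    obtain ⟨t₀, ht₀, k₀⟩ := start O z
    have h : Total O (.seq (.seq (decode (hT 0) (hT 4) (hT 5)) (move (hT 4) (hT 3)))
        (.seq (guessLoop (hT 0) (hT 6)) (badTest N E))) (init z) (fun _ _ t s' =>
        t ≤ callCost N (f z.length) + callCost E (f z.length) + 20 * f z.length + 20 +
          16 * z.length + 8 ∧ (s' 1 ≠ [] → ∃ u : Str, u.length ≤ (dec z).2.length ∧
          u ∈ langOf O N ∧ enc (dec z).1 u ∉ langOf O E)) := by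
      refine Total.seq (Φ := fun g Q t s' => t = t₀ ∧ s' = _) (Total.of_det k₀ ⟨rfl, rfl⟩) ?_
      rintro g Q t s' - ⟨rfl, rfl⟩
      refine Total.seq (total_guessLoop (by simp) _) ?_
      rintro g₁ Q₁ t₁ s₁ - ⟨-, ht₁, u, hu, rfl⟩
      simp only [mix_hT, bank_apply, List.getD_cons_zero] at ht₁ hu
      simp only [mix_hT, update_mix_hT, update_bank, List.length_cons, List.length_nil,
        List.set_cons_succ, List.set_cons_zero, Nat.reduceLT, Nat.reduceAdd, bank_apply,
        List.getD_cons_succ, List.getD_cons_zero, List.append_nil, Nat.zero_lt_succ]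
      obtain ⟨Q₂, t₂, b₂, hr₂, ht₂, hE₂⟩ := detE O (enc (dec z).1 u)
      refine (hp O u).transfer fun g₃ Q₃ t₃ b₃ hr₃ ht₃ => ?_
      obtain ⟨hm, hm₂⟩ := bound z _ u rfl hu t₃ t₂ ht₃ ht₂
      obtain ⟨Q', t', s', k, ht', h1⟩ := run_badTest hr₃ hr₂ hm hm₂
      refine ⟨Q', t', s', k, by omega, fun hs => ⟨u, hu, ⟨g₃, Q₃, t₃, b₃, hr₃, (h1.1 hs).1⟩, ?_⟩⟩
      rw [hE₂]
      exact fun h => h (h1.1 hs).2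
    intro ω
    obtain ⟨g, ω', Q, t, s', hω, k, hΦ⟩ := h ω
    exact ⟨g, ω', Q, t, s', hω, assoc k, hΦ⟩
  refine ⟨isNPOM_of_total (f := fun n => callCost N (f n) + callCost E (f n) + 20 * f n + 20 +
    16 * n + 8) ?_ fun A x => (total A x).mono fun _ _ _ _ _ h => h.1, ?_⟩
  · have hf : PolyBd f := ((((PolyBd.const _).mul .id).add (.const _)).add (PolyBd.eval p .id)).add
      (PolyBd.eval pE (((PolyBd.const _).mul .id).add (.const _)))
    exact (((((hf.callCost N).add (hf.callCost E)).add ((PolyBd.const _).mul hf)).add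
      (.const _)).add ((PolyBd.const _).mul .id)).add (.const _)
  · intro O F y
    constructor
    · rintro ⟨g, Q, t, s', k, h1⟩
      simpa using ((total O (enc F y)).of_run k).2 h1
    · rintro ⟨u, hu, ⟨g, Q, t, b, hr, hb⟩, hE'⟩
      obtain ⟨t₀, -, k₀⟩ := start O (enc F y)
      obtain ⟨g₁, t₁, -, k₁⟩ := run_guessLoop (A := O) (c := hT 0) (o := hT 6) (by simp)
        (mix (bank [(dec (enc F y)).2, [], [], (dec (enc F y)).1, [], [], [], [], [], []]) nil nil) u
        (by simpa using hu)
      simp only [dec_enc, mix_hT, update_mix_hT, update_bank, List.length_cons, List.length_nil,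
        List.set_cons_succ, List.set_cons_zero, Nat.reduceLT, Nat.reduceAdd, bank_apply,
        List.getD_cons_succ, List.getD_cons_zero, List.append_nil, Nat.zero_lt_succ] at k₀ k₁
      obtain ⟨Q₂, t₂, b₂, hr₂, ht₂, hE₂⟩ := detE O (enc F u)
      obtain ⟨Q', t', s', k, -, h1⟩ := run_badTest hr hr₂ (le_max_left _ _) (le_max_right _ _)
      refine ⟨_, _, _, s', assoc (k₀.seq (k₁.seq k)), h1.2 ⟨hb, ?_⟩⟩
      rw [hE₂] at hE'
      exact not_not.1 hE'

/-! ### Advice for UP from a sparse hard set -/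

/-- With the advice `F`, the set `E` decides `U` on all strings of length at most `m`. -/
def Good (U E : Lang) (F : Str) (m : ℕ) : Prop :=
  ∀ u : Str, u.length ≤ m → (enc F u ∈ E ↔ u ∈ U)

theorem langOf_deterministic {O : Lang} {M : Prog} (hM : M.Deterministic) {x : Str} {g Q t s}
    (h : Run O M (init x) g Q t s) : x ∈ langOf O M ↔ s 1 ≠ [] := by
  constructor
  · rintro ⟨g₂, Q₂, t₂, s₂, h₂, h1⟩
    obtain rfl := h.no_guess hM
    obtain rfl := h₂.no_guess hM
    obtain ⟨-, -, rfl⟩ := h.det_self h₂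
    exact h1
  · exact fun h1 => ⟨g, Q, t, s, h, h1⟩

/-- Search with an arbitrary oracle does not accept wrongly. -/
theorem langOf_searchM_subset {N : Prog} (hN : IsNPOM N) (pre : Str) (O : Lang) :
    langOf O (searchM pre N) ⊆ langOf ∅ N := by
  intro x hx
  obtain ⟨hd, h⟩ := searchM_spec hN pre
  obtain ⟨g, Q, t, s₁, Q', t', s', hr, -, k, e, -⟩ := h O x
  rw [langOf_deterministic hd.1 k, e] at hx
  exact ⟨g, Q, t, s₁, hr, hx⟩

/-- Search with the oracle `prefixes` finds an accepting path. -/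
theorem subset_langOf_searchM {N : Prog} (hN : IsNPOM N) :
    langOf ∅ N ⊆ langOf (prefixes ∅ N) (searchM [] N) := by
  intro x hx
  obtain ⟨hd, h⟩ := searchM_spec hN []
  obtain ⟨g, Q, t, s₁, Q', t', s', hr, rule, k, e, -⟩ := h (prefixes ∅ N) x
  -- Prefix search works for any nonempty set of accepting paths. Unambiguity matters only for
  -- placing the prefix set in UP.
  have hg : AcceptingPath ∅ N x g := by
    refine mem_of_prefix_rule (Acc := {g | AcceptingPath ∅ N x g}) hx ?_ ?_ fun h b h' hh => ?_
    · rintro g' ⟨Q₂, t₂, s₂, hr₂, -⟩ hp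
      exact (hr.eq_of_prefix hr₂ hp).symm
    · rintro g' ⟨Q₂, t₂, s₂, hr₂, -⟩ hp
      exact hr₂.eq_of_prefix hr hp
    · rw [rule h b h' hh]
      simp [prefixes]
  obtain ⟨Q₂, t₂, s₂, hr₂, h1⟩ := hg
  obtain ⟨-, -, rfl⟩ := hr.det_self hr₂
  rw [langOf_deterministic hd.1 k, e]
  exact h1

theorem finite_strings (m : ℕ) : {x : Str | x.length ≤ m}.Finite :=
  List.finite_length_le Bool m

/-- If there is a sparse set that is hard for UP, then a set in UP has advice of polynomial length
whose correctness can be checked in coNP. -/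
theorem exists_advice (hS : ∃ S : Lang, Sparse S ∧ TuringHard S UP) {U : Lang} (hU : U ∈ UP) :
    ∃ E B : Prog, IsDPOM E ∧ IsNPOM B ∧
      (∀ A x g Q t s', Run A B (init x) g Q t s' → Q = []) ∧
      (∀ A F y, enc F y ∈ langOf A B ↔ ¬ Good U (langOf ∅ E) F y.length) ∧
      ∃ p : ℕ → ℕ, PolyBd p ∧ ∀ m, ∃ F : Str, F.length ≤ p m ∧ Good U (langOf ∅ E) F m := by
  obtain ⟨S, ⟨q, hq⟩, hard⟩ := hS
  obtain ⟨N, hN, unamb, rfl⟩ := hU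
  -- Hardness is applied to the prefix set and not to the given language: a direct reduction could
  -- err in both directions on wrong advice, whereas the search checks itself.
  obtain ⟨MA, hMA, hA⟩ := hard (prefixes ∅ N)
    ⟨preM N, (preM_spec hN).1, unambiguousAt_preM hN unamb, (langOf_preM hN ∅).symm⟩
  obtain ⟨hsearch, -⟩ := searchM_spec hN []
  set M := composeM (searchM [] N) MA with hMdef
  have hM : IsDPOM M := isDPOM_composeM hsearch hMA
  have hML : ∀ O, langOf O M = langOf (langOf O MA) (searchM [] N) :=
    langOf_composeM hsearch.2 hMA
  have sound : ∀ F u : Str, enc F u ∈ langOf ∅ (lookM M) → u ∈ langOf ∅ N := by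
    intro F u hu
    rw [enc_mem_langOf_lookM hM.2, hML] at hu
    exact langOf_searchM_subset hN _ _ hu
  obtain ⟨hbad, hbad'⟩ := badM_spec hN (isDPOM_lookM hM)
  obtain ⟨pM, hpM⟩ := hM.2.time
  obtain ⟨pB, hpB⟩ := hbad.time
  refine ⟨lookM M, (badM N (lookM M)).noAsk, isDPOM_lookM hM, isNPOM_noAsk hbad, ?_, ?_,
    -- On inputs of length at most `m` the questions have length at most `n = m + pM.eval m`; there
    -- are at most `q.eval n` such strings in `S`, each coded with at most `2 * n + 1` bits.
    fun m => q.eval (m + pM.eval m) * (2 * (m + pM.eval m) + 1), ?_, fun m => ?_⟩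
  · intro A x g Q t s' hr
    exact ((total_noAsk (hpB ∅ x) A).of_run hr).1
  · intro A F y
    rw [langOf_noAsk hbad, hbad', Good]
    push Not
    constructor
    · rintro ⟨u, hu, h₁, h₂⟩
      exact ⟨u, hu, .inr ⟨h₂, h₁⟩⟩
    · rintro ⟨u, hu, ⟨h₁, h₂⟩ | ⟨h₁, h₂⟩⟩
      -- Wrong acceptance is impossible for any advice, so searching for wrong rejections is a
      -- complete test.
      · exact absurd (sound F u h₁) h₂
      · exact ⟨u, hu, h₂, h₁⟩
  · have h := PolyBd.id.add (PolyBd.eval pM .id)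
    exact (h.eval q).mul (((PolyBd.const _).mul h).add (.const _))
  · set n := m + pM.eval m
    have hfin : {x | x ∈ S ∧ x.length ≤ n}.Finite := (finite_strings n).subset fun x hx => hx.2
    have hmem : ∀ x : Str, x.length ≤ n → (x ∈ memF (encList hfin.toFinset.toList) ↔ x ∈ S) := by
      intro x hx
      rw [mem_memF_encList, Finset.mem_toList, Set.Finite.mem_toFinset]
      exact ⟨fun h => h.1, fun h => ⟨h, hx⟩⟩
    refine ⟨encList hfin.toFinset.toList, ?_, fun u hu => ⟨sound _ u, fun huN => ?_⟩⟩
    · refine (encList_length_le (m := n) fun u hu => ?_).trans (Nat.mul_le_mul_right _ ?_)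
      · rw [Finset.mem_toList, Set.Finite.mem_toFinset] at hu
        exact hu.2
      · rw [Finset.length_toList, ← Set.ncard_eq_toFinset_card _ hfin]
        exact hq n
    · rw [enc_mem_langOf_lookM hM.2]
      have huS : u ∈ langOf S M := by
        rw [hML, ← hA]
        exact subset_langOf_searchM hN huN
      obtain ⟨g, Q, t, s', hr, h1⟩ := huS
      have ht := (hpM S u).of_run hr
      have hQ := (hr.length_le (init_length_le u)).2
      have hp := eval_mono pM hu
      -- The run with oracle `S` asks only short strings, on which the list and `S` agree.
      exact ⟨g, Q, t, s', hr.congr_oracle fun x hx => (hmem x (by have := hQ x hx; omega)).symm, h1⟩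

/-! ### Towers with advice -/

/-- All machines of the tower are unambiguous on all inputs. -/
def UnambTower (A : Lang) : List Prog → Prop
  | [] => True
  | N :: Ns => (∀ x, UnambiguousAt (towerLang A Ns) N x) ∧ UnambTower A Ns

theorem Good.mono {U E : Lang} {F : Str} {m m' : ℕ} (h : Good U E F m') (hm : m ≤ m') :
    Good U E F m := fun u hu => h u (hu.trans hm)

theorem Asks.length_le {A : Lang} {N : Prog} {x q : Str} {p : Polynomial ℕ}
    (hp : ∀ A x, Total A N (init x) (fun _ _ t _ => t ≤ p.eval x.length)) (h : Asks A N x q) :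
    q.length ≤ x.length + p.eval x.length := by
  obtain ⟨g, Q, t, s', hr, hq⟩ := h
  have h₁ := (hr.length_le (init_length_le x)).2 q hq
  have h₂ := (hp A x).of_run hr
  omega

/-- In a tower over `U`, the bottom can be replaced by a set that decides `U` with the help of
advice. -/
theorem tower_advice {U E : Lang} (Ns : List Prog) (hNs : ∀ N ∈ Ns, IsNPOM N) :
    ∃ r : ℕ → ℕ, PolyBd r ∧ Monotone r ∧ ∀ F q, Good U E F (r q.length) →
      (enc F q ∈ towerLang E (Ns.map (primeM [])) ↔ q ∈ towerLang U Ns) ∧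
      (UnambTower U Ns → Guarded E (Ns.map (primeM [])) (enc F q)) := by
  induction Ns with
  | nil => exact ⟨fun n => n, .id, fun _ _ h => h, fun F q h => ⟨h q le_rfl, fun _ => trivial⟩⟩
  | cons N Ns ih =>
    obtain ⟨r, hr, hmono, ih⟩ := ih fun N hN => hNs N (by simp [hN])
    have hN := hNs N (by simp)
    obtain ⟨p, hp⟩ := hN.time
    obtain ⟨pr, hpr⟩ := hr
    -- A question of `N` on a string of length `n` has length at most `n + p.eval n`. Monotonicity
    -- of `r` makes advice for this length serve all shorter questions.
    refine ⟨fun n => r (n + p.eval n), PolyBd.mono (PolyBd.eval pr (PolyBd.id.add (.eval p .id)))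
      fun n => hpr _, fun m n h => hmono (Nat.add_le_add h (eval_mono p h)), fun F q hF => ?_⟩
    have asked : ∀ u, Asks (towerLang U Ns) N q u → Good U E F (r u.length) :=
      fun u hu => hF.mono (hmono (hu.length_le hp))
    have hA : ∀ u, Asks (towerLang U Ns) N q u →
        (u ∈ towerLang U Ns ↔ [] ++ enc F u ∈ towerLang E (Ns.map (primeM []))) :=
      fun u hu => (ih F u (asked u hu)).1.symm
    have hpath := primeM_acceptingPath hN hA
    refine ⟨exists_congr hpath, fun hun => ⟨?_, ?_⟩⟩
    · intro g g' hg hg'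
      exact hun.1 q g g' ((hpath g).1 hg) ((hpath g').1 hg')
    · intro q' hq'
      obtain ⟨u, hu, rfl⟩ := primeM_asks hN hA hq'
      exact (ih F u (asked u hu)).2 hun.2

/-! ### Guessing and testing advice -/

/-- Guess advice `F` and write the question whether it is bad for some string of length at most
`(n + 2) ^ e` on tape `4`. -/
def adviceGuess (d e : ℕ) : Prog :=
  .seq (call 0 3 (guessM d)) (.seq (call 0 6 (polyM e)) (encode (hT 3) (hT 6) (hT 4) (hT 5)))

/-- A bound for the time of `adviceGuess`. -/
def adviceCost (d e n : ℕ) : ℕ :=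
  callCost (guessM d) (n + guessCost d n) + callCost (polyM e) (n + polyCost e n) +
    12 * ((n + 2) ^ d + (n + 2) ^ e) + 10

theorem PolyBd.adviceCost (d e : ℕ) {f : ℕ → ℕ} (h : PolyBd f) :
    PolyBd (fun n => SparseUP.adviceCost d e (f n)) := by
  have h' := h.add (.const 2)
  exact ((((h.add (h.guessCost d)).callCost _).add ((h.add (h.polyCost e)).callCost _)).add
    ((PolyBd.const _).mul ((h'.pow d).add (h'.pow e)))).add (.const _)

/-- The tapes after `adviceGuess`. -/
def guessedBank (x F y : Str) : Store := bank [x, [], [], F, enc F y, [], y, [], [], []]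

theorem run_adviceGuess {A : Lang} {d e : ℕ} {x : Str} {g Q t s₁}
    (h : Run A (guessM d) (init x) g Q t s₁) : ∃ y : Str, y.length = (x.length + 2) ^ e ∧
      RunLE A (adviceGuess d e) (init x) g [] (adviceCost d e x.length)
        (mix (guessedBank x (s₁ 1) y) nil nil) := by
  obtain ⟨rfl, ht, hF⟩ := (total_guessM A d x).of_run h
  have k₁ := run_call (a := bank [x, [], [], [], [], [], [], [], [], []]) (s := nil) (i := 0) (j := 3)
    (by simp) (by simp) (by simp) (by simp) h
  obtain ⟨y, hy, k₂⟩ := run_call_polyM (A := A) (s := nil) (i := 0) (j := 6) (d := e)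
    (a := bank [x, [], [], s₁ 1, [], [], [], [], [], []]) (by simp) (by simp) (by simp) (by simp)
  have k₃ := run_encode (A := A) (f := hT 3) (q := hT 6) (o := hT 4) (k := hT 5) (by simp) (by simp)
    (by simp) (by simp) (by simp) (mix (bank [x, [], [], s₁ 1, [], [], y, [], [], []]) nil nil)
    (by simp) (by simp)
  simp only [bank_apply, List.getD_cons_zero] at hy
  refine ⟨y, hy, ?_⟩
  rw [init_eq_mix]
  refine ((k₁.to (by simp [update_bank]) le_rfl).post ((k₂.to (by simp [update_bank]) le_rfl).pre
    k₃)).to (by simp [update_bank, guessedBank]) ?_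
  have h₁ := callCost_mono (M := guessM d) (Nat.add_le_add_left ht x.length)
  simp only [mix_hT, bank_apply, List.getD_cons_succ, List.getD_cons_zero, hy, adviceCost] at h₁ ⊢
  omega

theorem total_adviceGuess (A : Lang) (d e : ℕ) (x : Str) :
    Total A (adviceGuess d e) (init x) (fun g Q t s' => Q = [] ∧ t ≤ adviceCost d e x.length ∧
      ∃ t₁ s₁ y, Run A (guessM d) (init x) g [] t₁ s₁ ∧ y.length = (x.length + 2) ^ e ∧
        s' = mix (guessedBank x (s₁ 1) y) nil nil) := by
  refine (total_guessM A d x).transfer fun g Q t s₁ hr ⟨hQ, _, _⟩ => ?_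
  subst hQ
  obtain ⟨y, hy, t', ht', k⟩ := run_adviceGuess (e := e) hr
  exact ⟨[], t', _, k, rfl, ht', t, s₁, y, hr, hy, rfl⟩

/-- Guess advice and accept if the oracle says that it is not bad. -/
def verifyM (d e : ℕ) : Prog := .seq (adviceGuess d e) (.ask (hT 4) .skip (.push (hT 1) true))

theorem isNPOM_verifyM (d e : ℕ) : IsNPOM (verifyM d e) := by
  refine isNPOM_of_total ((PolyBd.id.adviceCost d e).add (.const 2)) fun A x => ?_
  refine (total_adviceGuess A d e x).seq ?_
  rintro g Q t s' - ⟨-, ht, -⟩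
  by_cases h : s' (hT 4) ∈ A
  · exact Total.of_det (.ask_yes h (.skip _)) (by omega)
  · exact Total.of_det (.ask_no h (.push _ _ _)) (by omega)

/-- The test adds no choices, so accepting paths are guessing paths of the oracle-free `guessM`. A
search that runs `guessM` alone can therefore be steered by prefixes of `verifyM`. -/
theorem verifyM_acceptingPath {O : Lang} {d e : ℕ} {G : Str → ℕ → Prop}
    (hO : ∀ F y, enc F y ∈ O ↔ ¬ G F y.length) (x : Str) (g : List Bool) :
    AcceptingPath O (verifyM d e) x g ↔ ∃ t s₁, Run ∅ (guessM d) (init x) g [] t s₁ ∧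
      G (s₁ 1) ((x.length + 2) ^ e) := by
  constructor
  · rintro ⟨Q, t, s', k, h1⟩
    cases k with
    | seq k₁ k₂ =>
      obtain ⟨-, -, t₁, s₁, y, hr, hy, rfl⟩ := (total_adviceGuess O d e x).of_run k₁
      cases k₂ with
      | ask_yes _ k₃ =>
        cases k₃
        rw [mix_one] at h1
        simp [guessedBank] at h1
      | ask_no hn k₃ =>
        cases k₃
        refine ⟨t₁, s₁, ?_, ?_⟩
        · simpa using hr.congr_oracle (A' := ∅) (by simp)
        · simpa [guessedBank, hO, hy] using hn
  · rintro ⟨t, s₁, hr, hG⟩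
    obtain ⟨y, hy, t', -, k⟩ := run_adviceGuess (e := e) (hr.congr_oracle (A' := O) (by simp))
    have k₂ := k.seq (.ask_no (r := hT 4) (c₁ := .skip) (by simpa [guessedBank, hO, hy] using hG)
      (.push (hT 1) true _))
    rw [List.append_nil] at k₂
    exact ⟨_, _, _, k₂, by rw [update_mix_hT, mix_one]; simp⟩

/-! ### The collapse -/

/-- Continue with `c₁` or `c₀`, depending on the first bit of the input, which is erased. -/
def caseM (c₁ c₀ : Prog) : Prog := .test 0 (.seq (.pop 0) c₁) (.seq (.pop 0) c₀) .skip

theorem run_pop_init {A : Lang} (b : Bool) (z : Str) :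
    Run A (.pop 0) (init (b :: z)) [] [] 1 (init z) := by
  have := Run.pop (A := A) 0 (init (b :: z))
  simpa [init_eq_update] using this

theorem run_caseM {A : Lang} {c₁ c₀ : Prog} {b : Bool} {z : Str} {g Q t s'}
    (h : Run A (if b then c₁ else c₀) (init z) g Q t s') :
    Run A (caseM c₁ c₀) (init (b :: z)) g Q (1 + t + 1) s' := by
  cases b
  · exact .test_zero (by simp [init]) ((run_pop_init false z).seq h)
  · exact .test_one (by simp [init]) ((run_pop_init true z).seq h)

theorem caseM_run {A : Lang} {c₁ c₀ : Prog} {b : Bool} {z : Str} {g Q t s'}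
    (h : Run A (caseM c₁ c₀) (init (b :: z)) g Q t s') :
    ∃ t', Run A (if b then c₁ else c₀) (init z) g Q t' s' := by
  cases h with
  | test_one hb h =>
    obtain rfl : b = true := by simpa [init] using hb
    cases h with
    | seq h₁ h₂ =>
      cases h₁
      exact ⟨_, by simpa [init_eq_update] using h₂⟩
  | test_zero hb h =>
    obtain rfl : b = false := by simpa [init] using hb
    cases h with
    | seq h₁ h₂ =>
      cases h₁
      exact ⟨_, by simpa [init_eq_update] using h₂⟩
  | test_empty hb => simp [init] at hb

theorem isNPOM_caseM {c₁ c₀ : Prog} (h₁ : IsNPOM c₁) (h₀ : IsNPOM c₀) : IsNPOM (caseM c₁ c₀) := by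
  obtain ⟨p, hp⟩ := h₁.time
  obtain ⟨q, hq⟩ := h₀.time
  refine isNPOM_of_total (f := fun n => p.eval n + q.eval n + 2)
    (((PolyBd.eval p .id).add (PolyBd.eval q .id)).add (.const _)) fun A x => ?_
  rcases x with _ | ⟨b, z⟩
  · exact Total.of_det (.test_empty rfl (.skip _)) (by omega)
  · have hpz := eval_mono p (Nat.le_succ z.length)
    have hqz := eval_mono q (Nat.le_succ z.length)
    cases b
    · exact (hq A z).transfer fun g Q t s₁ hr ht => ⟨Q, _, s₁, run_caseM (b := false) hr, by
        simp only [List.length_cons, Nat.succ_eq_add_one] at *; omega⟩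
    · exact (hp A z).transfer fun g Q t s₁ hr ht => ⟨Q, _, s₁, run_caseM (b := true) hr, by
        simp only [List.length_cons, Nat.succ_eq_add_one] at *; omega⟩

theorem mem_langOf_caseM {A : Lang} {c₁ c₀ : Prog} {b : Bool} {z : Str} :
    b :: z ∈ langOf A (caseM c₁ c₀) ↔ z ∈ langOf A (if b then c₁ else c₀) := by
  constructor
  · rintro ⟨g, Q, t, s', k, h1⟩
    obtain ⟨t', k⟩ := caseM_run k
    exact ⟨g, Q, t', s', k, h1⟩
  · rintro ⟨g, Q, t, s', k, h1⟩
    exact ⟨g, Q, _, s', run_caseM k, h1⟩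

theorem asks_caseM {A : Lang} {c₁ c₀ : Prog} {b : Bool} {z q : Str}
    (h : Asks A (caseM c₁ c₀) (b :: z) q) : Asks A (if b then c₁ else c₀) z q := by
  obtain ⟨g, Q, t, s', k, hq⟩ := h
  obtain ⟨t', k⟩ := caseM_run k
  exact ⟨g, Q, t', s', k, hq⟩

/-! ### Running a machine with tested advice -/

/-- If the oracle says that the advice is not bad, run `N` with the advice. -/
def advisedTail (N : Prog) : Prog :=
  .seq (.push (hT 4) true) (.ask (hT 4) .skip (.seq (clear (hT 4))
    (.seq (encode (hT 3) (hT 0) (hT 4) (hT 5)) (call 4 1 (primeM [false] N)))))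

/-- Guess advice, make sure that it is not bad, and run `N` with this advice. -/
def advisedM (d e : ℕ) (N : Prog) : Prog := .seq (adviceGuess d e) (advisedTail N)

theorem run_advisedTail_yes {O : Lang} {N : Prog} {x F y : Str} (h : true :: enc F y ∈ O) :
    RunLE O (advisedTail N) (mix (guessedBank x F y) nil nil) [] [true :: enc F y] 3
      (mix (bank [x, [], [], F, true :: enc F y, [], y, [], [], []]) nil nil) := by
  have k : RunLE O (.ask (hT 4) .skip (.seq (clear (hT 4))
      (.seq (encode (hT 3) (hT 0) (hT 4) (hT 5)) (call 4 1 (primeM [false] N)))))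
      (mix (bank [x, [], [], F, true :: enc F y, [], y, [], [], []]) nil nil) []
      [mix (bank [x, [], [], F, true :: enc F y, [], y, [], [], []]) nil nil (hT 4)] 2
      (mix (bank [x, [], [], F, true :: enc F y, [], y, [], [], []]) nil nil) :=
    RunLE.ask_yes (by simpa) runLE_skip
  exact (runLE_push.to (by simp [update_bank, guessedBank]) le_rfl).pre k

theorem run_advisedTail_no {O : Lang} {N : Prog} {x F y : Str} (h : true :: enc F y ∉ O)
    {g Q t b} (hr : Run O (primeM [false] N) (init (enc F x)) g Q t b) :
    RunLE O (advisedTail N) (mix (guessedBank x F y) nil nil) g ((true :: enc F y) :: Q)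
      (callCost (primeM [false] N) (2 * F.length + x.length + 1 + t) +
        20 * (F.length + x.length + y.length) + 30)
      (mix (bank [x, b 1, [], F, enc F x, [], y, [], [], []]) nil nil) := by
  have k₁ := run_clear (A := O) (i := hT 4)
    (mix (bank [x, [], [], F, true :: enc F y, [], y, [], [], []]) nil nil)
  have k₂ := run_encode (A := O) (f := hT 3) (q := hT 0) (o := hT 4) (k := hT 5) (by simp) (by simp)
    (by simp) (by simp) (by simp) (mix (bank [x, [], [], F, [], [], y, [], [], []]) nil nil)
    (by simp) (by simp)
  have k₃ := run_call (a := bank [x, [], [], F, enc F x, [], y, [], [], []]) (s := nil) (i := 4)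
    (j := 1) (by simp) (by simp) (by simp) (by simp) hr
  have k := RunLE.ask_no (r := hT 4) (c := .skip)
    (s := mix (bank [x, [], [], F, true :: enc F y, [], y, [], [], []]) nil nil) (by simpa)
    ((k₁.to (by simp [update_bank]) le_rfl).pre ((k₂.to (by simp [update_bank]) le_rfl).pre k₃))
  refine ((runLE_push.to (by simp [update_bank, guessedBank]) le_rfl).pre k).to
    (by simp [update_bank]) ?_
  simp [enc_length]
  omega

/-- One case distinction, rejected or accepted advice, from which the time bound, the language and
the questions are all read off. -/
theorem total_advisedM {O : Lang} {d e : ℕ} {N : Prog} {x : Str}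
    {Φ : Str → List Bool → List Str → ℕ → Store → Prop}
    (h : ∀ F, Total O (primeM [false] N) (init (enc F x)) (Φ F)) :
    Total O (advisedM d e N) (init x) (fun _ Q t s' => ∃ F y : Str,
      F.length ≤ (x.length + 2) ^ d ∧ y.length = (x.length + 2) ^ e ∧
      ((true :: enc F y ∈ O ∧ Q = [true :: enc F y] ∧ s' 1 = [] ∧ t ≤ adviceCost d e x.length + 3) ∨
      (true :: enc F y ∉ O ∧ ∃ g' Q' t' b, Run O (primeM [false] N) (init (enc F x)) g' Q' t' b ∧
        Φ F g' Q' t' b ∧ Q = (true :: enc F y) :: Q' ∧ s' 1 = b 1 ∧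
        t ≤ adviceCost d e x.length +
          (callCost (primeM [false] N) (2 * F.length + x.length + 1 + t') +
          20 * (F.length + x.length + y.length) + 30)))) := by
  refine (total_adviceGuess O d e x).seq ?_
  rintro g Q t s' - ⟨rfl, ht, t₁, s₁, y, hr, hy, rfl⟩
  have hF := ((total_guessM O d x).of_run hr).2.2
  by_cases hO : true :: enc (s₁ 1) y ∈ O
  · obtain ⟨t', ht', k⟩ := run_advisedTail_yes (N := N) (x := x) hO
    exact Total.of_det k ⟨_, y, hF, hy, .inl ⟨hO, rfl, by rw [mix_one]; simp, by omega⟩⟩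
  · refine (h (s₁ 1)).transfer fun g' Q' t' b hr' hΦ => ?_
    obtain ⟨t'', ht'', k⟩ := run_advisedTail_no (N := N) (x := x) hO hr'
    exact ⟨_, t'', _, k, _, y, hF, hy, .inr ⟨hO, g', Q', t', b, hr', hΦ, rfl,
      by rw [mix_one]; simp, by omega⟩⟩

theorem isNPOM_advisedM {N : Prog} (hN : IsNPOM N) (d e : ℕ) : IsNPOM (advisedM d e N) := by
  obtain ⟨p, hp⟩ := (isNPOM_primeM hN [false]).time
  -- The length of the pair of the guessed advice and the input.
  let f : ℕ → ℕ := fun n => 2 * (n + 2) ^ d + n + 1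
  refine isNPOM_of_total (f := fun n => adviceCost d e n + (callCost (primeM [false] N)
    (f n + p.eval (f n)) + 20 * ((n + 2) ^ d + n + (n + 2) ^ e) + 30)) ?_
    fun A x => (total_advisedM fun F => hp A (enc F x)).mono ?_
  · have h₂ := PolyBd.id.add (.const 2)
    have hf : PolyBd f := (((PolyBd.const _).mul (h₂.pow d)).add .id).add (.const _)
    exact (PolyBd.id.adviceCost d e).add ((((hf.add (.eval p hf)).callCost _).add
      ((PolyBd.const _).mul (((h₂.pow d).add .id).add (h₂.pow e)))).add (.const _))
  · rintro g Q t s' - ⟨F, y, hF, hy, ⟨-, -, -, ht⟩ | ⟨-, g', Q', t', b, -, ht', -, -, ht⟩⟩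
    · omega
    · have h₁ : (enc F x).length ≤ f x.length := by rw [enc_length]; simp only [f]; omega
      have h₂ : 2 * F.length + x.length + 1 + t' ≤ f x.length + p.eval (f x.length) := by
        rw [enc_length] at h₁ ht'
        exact Nat.add_le_add h₁ (ht'.trans (eval_mono p h₁))
      have h₃ := callCost_mono (M := primeM [false] N) h₂
      omega

/-- The properties of the oracle that are used by `advisedM`. -/
structure AdvisedOracle (O A : Lang) (N : Prog) (G : Str → ℕ → Prop) (e : ℕ) (x : Str) : Prop where
  bad : ∀ F y, true :: enc F y ∈ O ↔ ¬ G F y.length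
  good : ∀ F, G F ((x.length + 2) ^ e) → ∀ u, Asks A N x u → (u ∈ A ↔ [false] ++ enc F u ∈ O)

/-- Every advice that passes the test leads to the correct answer, and some advice short enough to
be guessed does pass. -/
theorem mem_langOf_advisedM {O A : Lang} {N : Prog} {G : Str → ℕ → Prop} {d e : ℕ} {x : Str}
    (hN : IsNPOM N) (h : AdvisedOracle O A N G e x)
    (hG : ∃ F : Str, F.length ≤ (x.length + 2) ^ d ∧ G F ((x.length + 2) ^ e)) :
    x ∈ langOf O (advisedM d e N) ↔ x ∈ langOf A N := by
  obtain ⟨p, hp⟩ := (isNPOM_primeM hN [false]).time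
  constructor
  · rintro ⟨g, Q, t, s', k, h1⟩
    obtain ⟨F, y, hF, hy, ⟨-, -, e1, -⟩ | ⟨hO, g', Q', t', b, hr, -, -, e1, -⟩⟩ :=
      (total_advisedM fun F => hp O (enc F x)).of_run k
    · exact absurd e1 h1
    · rw [h.bad, not_not, hy] at hO
      exact ⟨g', (primeM_acceptingPath hN (h.good F hO) g').1 ⟨Q', t', b, hr, e1 ▸ h1⟩⟩
  · rintro ⟨g, hg⟩
    obtain ⟨F, hF, hGF⟩ := hG
    obtain ⟨Q, t, b, hr, h1⟩ := (primeM_acceptingPath hN (h.good F hGF) g).2 hg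
    obtain ⟨g₁, t₁, s₁, hr₁, rfl⟩ := run_guessM O d x F hF
    obtain ⟨y, hy, k₁⟩ := run_adviceGuess (e := e) hr₁
    obtain ⟨t', -, k⟩ := k₁.seq (run_advisedTail_no (y := y)
      (by rw [h.bad, not_not, hy]; exact hGF) hr)
    exact ⟨_, _, t', _, k, by rw [mix_one]; simpa⟩

/-- The source of guardedness: a question marked `0` is asked only after the test, so its advice is
good and its second component is a genuine question of `N`. -/
theorem asks_advisedM {O A : Lang} {N : Prog} {G : Str → ℕ → Prop} {d e : ℕ} {x q : Str}
    (hN : IsNPOM N) (h : AdvisedOracle O A N G e x) (hq : Asks O (advisedM d e N) x q) :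
    (∃ z, q = true :: z) ∨
      ∃ F u, G F ((x.length + 2) ^ e) ∧ Asks A N x u ∧ q = false :: enc F u := by
  obtain ⟨p, hp⟩ := (isNPOM_primeM hN [false]).time
  obtain ⟨g, Q, t, s', k, hq⟩ := hq
  obtain ⟨F, y, hF, hy, ⟨-, rfl, -⟩ | ⟨hO, g', Q', t', b, hr, -, rfl, -⟩⟩ :=
    (total_advisedM fun F => hp O (enc F x)).of_run k
  · exact .inl ⟨_, by simpa using hq⟩
  · rcases List.mem_cons.1 hq with rfl | hq
    · exact .inl ⟨_, rfl⟩
    · rw [h.bad, not_not, hy] at hO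
      obtain ⟨u, hu, rfl⟩ := primeM_asks hN (h.good F hO) ⟨g', Q', t', b, hr, hq⟩
      exact .inr ⟨F, u, hO, hu, rfl⟩

/-- A tower of machines over a set in UP, of height at least two, collapses by one level. -/
theorem collapse (hS : ∃ S : Lang, Sparse S ∧ TuringHard S UP) {U : Lang} (hU : U ∈ UP)
    {N₁ N₂ : Prog} {Ns : List Prog} (h₁ : IsNPOM N₁) (h₂ : IsNPOM N₂) (hNs : ∀ N ∈ Ns, IsNPOM N) :
    ∃ M₁ M₂ E, IsNPOM M₁ ∧ IsNPOM M₂ ∧ IsDPOM E ∧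
      towerLang U (N₁ :: N₂ :: Ns) =
        langOf (langOf (towerLang (langOf ∅ E) (Ns.map (primeM []))) M₂) M₁ ∧
      (UnambTower U (N₂ :: Ns) → ∀ x q q',
        Asks (langOf (towerLang (langOf ∅ E) (Ns.map (primeM []))) M₂) M₁ x q →
        Asks (towerLang (langOf ∅ E) (Ns.map (primeM []))) M₂ q q' →
        Guarded (langOf ∅ E) (Ns.map (primeM [])) q') := by
  obtain ⟨E, B, hE, hB, hBQ, hBL, p, hp, hpF⟩ := exists_advice hS hU
  obtain ⟨r, hr, hmono, htower⟩ := tower_advice (U := U) (E := langOf ∅ E) (N₂ :: Ns)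
    (by simpa [h₂] using hNs)
  obtain ⟨p₁, hp₁⟩ := h₁.time
  obtain ⟨pr, hpr⟩ := hr
  obtain ⟨pp, hpp⟩ := hp
  -- The advice has to be correct on everything the tower may need below any question of `N₁`.
  obtain ⟨e, he⟩ := exists_pow_ge (f := fun n => r (n + p₁.eval n))
    (PolyBd.mono (PolyBd.eval pr (PolyBd.id.add (.eval p₁ .id))) fun n => hpr _)
  -- Good advice for the length `(n + 2) ^ e` has length at most `(n + 2) ^ d`, which bounds the
  -- guess.
  obtain ⟨d, hd⟩ := exists_pow_ge (f := fun n => p ((n + 2) ^ e))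
    (PolyBd.mono (PolyBd.eval pp ((PolyBd.id.add (.const 2)).pow e)) fun n => hpp _)
  set T := towerLang (langOf ∅ E) (Ns.map (primeM [])) with hT
  have good : ∀ x F, Good U (langOf ∅ E) F ((x.length + 2) ^ e) → ∀ u,
      Asks (towerLang U (N₂ :: Ns)) N₁ x u → Good U (langOf ∅ E) F (r u.length) :=
    fun x F hF u hu => hF.mono ((hmono (hu.length_le hp₁)).trans (he _))
  -- One NP machine plays both parts: the mark `1` calls the badness test, the mark `0` calls `N₂`
  -- with advice.
  have oracle : ∀ x, AdvisedOracle (langOf T (caseM B (primeM [] N₂))) (towerLang U (N₂ :: Ns)) N₁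
      (Good U (langOf ∅ E)) e x := by
    refine fun x => ⟨fun F y => ?_, fun F hF u hu => ?_⟩
    · rw [mem_langOf_caseM]
      exact hBL T F y
    · rw [List.singleton_append, mem_langOf_caseM]
      exact (htower F u (good x F hF u hu)).1.symm
  refine ⟨advisedM d e N₁, caseM B (primeM [] N₂), E, isNPOM_advisedM h₁ d e,
    isNPOM_caseM hB (isNPOM_primeM h₂ []), hE, ?_, ?_⟩
  · ext x
    obtain ⟨F, hF, hGF⟩ := hpF ((x.length + 2) ^ e)
    exact (mem_langOf_advisedM h₁ (oracle x) ⟨F, hF.trans (hd _), hGF⟩).symm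
  · intro hun x q q' hq hq'
    rcases asks_advisedM h₁ (oracle x) hq with ⟨z, rfl⟩ | ⟨F, u, hF, hu, rfl⟩
    -- The badness test asks nothing, so it never reaches the tower.
    · obtain ⟨g, Q, t, s', k, hmem⟩ := asks_caseM hq'
      rw [hBQ _ _ _ _ _ _ k] at hmem
      simp at hmem
    -- Guardedness of the tower that starts with `N₂`, passed on to a question of `N₂`.
    · exact ((htower F u (good x F hF u hu)).2 hun).2 q' (asks_caseM hq')

/-! ### Finding advice with the help of a set in `Σ₂` -/

/-- Search for advice, and ask the oracle about the pair of this advice and the input. -/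
def findM (d : ℕ) : Prog :=
  .seq (call 0 3 (searchM [true] (guessM d))) (.seq (encode (hT 3) (hT 0) (hT 4) (hT 5))
    (.seq (.push (hT 4) false) (.ask (hT 4) (.push (hT 1) true) .skip)))

theorem run_findM {O : Lang} {d : ℕ} {x : Str} {Q t b}
    (h : Run O (searchM [true] (guessM d)) (init x) [] Q t b) :
    ∃ s', RunLE O (findM d) (init x) [] (Q ++ [false :: enc (b 1) x])
      (callCost (searchM [true] (guessM d)) (x.length + t) + 30 * (x.length + t) + 20) s' ∧
      (s' 1 ≠ [] ↔ false :: enc (b 1) x ∈ O) := by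
  have k₁ := run_call (a := bank [x, [], [], [], [], [], [], [], [], []]) (s := nil) (i := 0) (j := 3)
    (by simp) (by simp) (by simp) (by simp) h
  have k₂ := run_encode (A := O) (f := hT 3) (q := hT 0) (o := hT 4) (k := hT 5) (by simp) (by simp)
    (by simp) (by simp) (by simp) (mix (bank [x, [], [], b 1, [], [], [], [], [], []]) nil nil)
    (by simp) (by simp)
  have k₃ : RunLE O (.push (hT 4) false)
      (mix (bank [x, [], [], b 1, enc (b 1) x, [], [], [], [], []]) nil nil) [] [] 1
      (mix (bank [x, [], [], b 1, false :: enc (b 1) x, [], [], [], [], []]) nil nil) :=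
    runLE_push.to (by simp [update_bank]) le_rfl
  have k₄ : ∃ s', (s' 1 ≠ [] ↔ false :: enc (b 1) x ∈ O) ∧
      RunLE O (.ask (hT 4) (.push (hT 1) true) .skip)
        (mix (bank [x, [], [], b 1, false :: enc (b 1) x, [], [], [], [], []]) nil nil) []
        [mix (bank [x, [], [], b 1, false :: enc (b 1) x, [], [], [], [], []]) nil nil (hT 4)] 2
        s' := by
    by_cases hO : false :: enc (b 1) x ∈ O
    · exact ⟨_, by rw [update_mix_hT, mix_one]; simpa, RunLE.ask_yes (by simpa) runLE_push⟩
    · exact ⟨_, by rw [mix_one]; simpa, RunLE.ask_no (by simpa) runLE_skip⟩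
  obtain ⟨s', hs', k₄⟩ := k₄
  refine ⟨s', ?_, hs'⟩
  rw [init_eq_mix]
  refine ((k₁.to (by simp [update_bank]) le_rfl).seq ((k₂.to (by simp [update_bank]) le_rfl).pre
    (k₃.pre k₄))).mono ?_
  have h₁ := (h.length_le (init_length_le x)).1 1
  simp only [mix_hT, bank_apply, List.getD_cons_succ, List.getD_cons_zero]
  omega

theorem isDPOM_findM (d : ℕ) : IsDPOM (findM d) := by
  obtain ⟨hd, -⟩ := searchM_spec (isNPOM_guessM d) [true]
  obtain ⟨p, hp⟩ := hd.2.time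
  refine ⟨⟨det_call hd.1 _ _, det_encode _ _ _ _, trivial, trivial, trivial⟩,
    isNPOM_of_total (f := fun n => callCost (searchM [true] (guessM d)) (n + p.eval n) +
      30 * (n + p.eval n) + 20) ?_ fun A x => ?_⟩
  · have h := PolyBd.id.add (PolyBd.eval p .id)
    exact ((h.callCost _).add ((PolyBd.const _).mul h)).add (.const _)
  · obtain ⟨g, ω', Q, t, b, -, hr, ht⟩ := hp A x zeros
    obtain rfl := hr.no_guess hd.1
    obtain ⟨s', ⟨t', ht', k⟩, -⟩ := run_findM hr
    have := callCost_mono (M := searchM [true] (guessM d)) (Nat.add_le_add_left ht x.length)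
    exact Total.of_det k (by omega)

/-- Choices made by prefix search lead to a guessing path whose advice passes the test. The search
sends all its questions to the right half of the join, so the tower sees only the final pair. -/
theorem findM_spec {T B : Lang} {d e : ℕ} {G : Str → ℕ → Prop}
    (hB : ∀ F y, enc F y ∈ B ↔ ¬ G F y.length)
    {x : Str} (hG : ∃ F : Str, F.length ≤ (x.length + 2) ^ d ∧ G F ((x.length + 2) ^ e)) :
    ∃ F, G F ((x.length + 2) ^ e) ∧
      (x ∈ langOf (join T (prefixes B (verifyM d e))) (findM d) ↔ enc F x ∈ T) ∧
      ∀ q, Asks (join T (prefixes B (verifyM d e))) (findM d) x (false :: q) → q = enc F x := by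
  obtain ⟨-, hsearch⟩ := searchM_spec (isNPOM_guessM d) [true]
  obtain ⟨g, Q, t, s₁, Q', t', s', hr, rule, k, e1, hQ'⟩ :=
    hsearch (join T (prefixes B (verifyM d e))) x
  obtain ⟨rfl, -, -⟩ := (total_guessM ∅ d x).of_run hr
  have hacc := verifyM_acceptingPath (O := B) (d := d) (e := e) hB x
  -- Accepting paths of `verifyM` and the path found are all paths of `guessM`, so prefix-freeness
  -- for `guessM` supplies the two hypotheses on prefixes.
  have hg : AcceptingPath B (verifyM d e) x g := by
    refine mem_of_prefix_rule (Acc := {g | AcceptingPath B (verifyM d e) x g}) ?_ ?_ ?_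
      fun h b h' hh => ?_
    · obtain ⟨F, hF, hGF⟩ := hG
      obtain ⟨g₁, t₁, s₁, hr₁, rfl⟩ := run_guessM ∅ d x F hF
      exact ⟨g₁, (hacc g₁).2 ⟨t₁, s₁, hr₁, hGF⟩⟩
    · intro g' hg' hp
      obtain ⟨t₂, s₂, hr₂, -⟩ := (hacc g').1 hg'
      exact (hr.eq_of_prefix hr₂ hp).symm
    · intro g' hg' hp
      obtain ⟨t₂, s₂, hr₂, -⟩ := (hacc g').1 hg'
      exact hr₂.eq_of_prefix hr hp
    · rw [rule h b h' hh]
      simp [join, prefixes]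
  obtain ⟨t₂, s₂, hr₂, hGF⟩ := (hacc g).1 hg
  obtain ⟨-, -, rfl⟩ := hr.det_self hr₂
  obtain ⟨s'', ⟨t'', -, kf⟩, h1⟩ := run_findM k
  rw [e1] at kf h1
  refine ⟨s₁ 1, hGF, ?_, ?_⟩
  · rw [langOf_deterministic (isDPOM_findM d).1 kf, h1]
    simp [join]
  · rintro q ⟨g₃, Q₃, t₃, s₃, k₃, hq⟩
    obtain rfl := k₃.no_guess (isDPOM_findM d).1
    obtain ⟨rfl, -, -⟩ := kf.det_self k₃
    rcases List.mem_append.1 hq with hq | hq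
    · obtain ⟨y, hy⟩ := hQ' _ hq
      simp at hy
    · simpa using hq

/-! ### Two members of relativized P -/

theorem empty_mem_P : (∅ : Lang) ∈ PRel ∅ := by
  refine ⟨.skip, ⟨trivial, isNPOM_of_total (.const 1) fun A x => Total.of_det (.skip _) le_rfl⟩, ?_⟩
  ext x
  simp only [Set.mem_empty_iff_false, false_iff]
  rintro ⟨g, Q, t, s', k, h1⟩
  cases k
  exact h1 rfl

theorem self_mem_PRel (A : Lang) : A ∈ PRel A := by
  have run : ∀ (O : Lang) x, ∃ t ≤ 2, ∃ s', Run O (.ask 0 (.push 1 true) .skip) (init x) [] [x] t s' ∧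
      (s' 1 ≠ [] ↔ x ∈ O) := by
    intro O x
    by_cases h : x ∈ O
    · exact ⟨2, le_rfl, _, .ask_yes (s := init x) h (.push _ _ _), by simpa using h⟩
    · exact ⟨2, le_rfl, _, .ask_no (s := init x) h (.skip _), by simpa [init] using h⟩
  refine ⟨.ask 0 (.push 1 true) .skip, ⟨⟨trivial, trivial⟩,
    isNPOM_of_total (.const 2) fun O x => ?_⟩, ?_⟩
  · obtain ⟨t, ht, s', k, -⟩ := run O x
    exact Total.of_det k ht
  · ext x
    obtain ⟨t, ht, s', k, h1⟩ := run A x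
    rw [langOf_deterministic (by exact ⟨trivial, trivial⟩) k, h1]

/-! ### The unambiguous polynomial hierarchy -/

theorem UPRel_subset_UP {A : Lang} (hA : A ∈ P) : UPRel A ⊆ UP := by
  rintro _ ⟨N, hN, hun, rfl⟩
  obtain ⟨M, hM, rfl⟩ := hA
  obtain ⟨hc, hpath⟩ := composeM_spec hN hM
  exact ⟨composeM N M, hc, fun x g g' hg hg' =>
    hun x g g' ((hpath ∅ x g).1 hg) ((hpath ∅ x g').1 hg'), (langOf_composeM hN hM ∅).symm⟩

/-- The lowest UP level absorbs its oracle in P, so level `k + 1` needs only `k` machines over a set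
in UP. -/
theorem exists_tower {k : ℕ} {L : Lang} (hL : L ∈ USigma (k + 1)) :
    ∃ U ∈ UP, ∃ Ns : List Prog, Ns.length = k ∧ (∀ N ∈ Ns, IsNPOM N) ∧ UnambTower U Ns ∧
      L = towerLang U Ns := by
  induction k generalizing L with
  | zero =>
    obtain ⟨A, hA, hL⟩ := hL
    exact ⟨L, UPRel_subset_UP hA hL, [], rfl, by simp, trivial, rfl⟩
  | succ k ih =>
    obtain ⟨A, hA, N, hN, hun, rfl⟩ := hL
    obtain ⟨U, hU, Ns, hlen, hNs, hun', rfl⟩ := ih hA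
    exact ⟨U, hU, N :: Ns, by simp [hlen], by simpa [hN] using hNs, ⟨hun, hun'⟩, rfl⟩

/-- Peeling off levels from the top leaves a set of level `m` at the bottom, where the case `j = 0`
uses the set itself as oracle. -/
theorem USigma_add {j m : ℕ} : USigma (j + m) ⊆ relTo (USigmaRel j) (USigma m) := by
  induction j with
  | zero =>
    intro L hL
    rw [Nat.zero_add] at hL
    exact ⟨L, hL, self_mem_PRel L⟩
  | succ j ih =>
    intro L hL
    rw [Nat.add_right_comm] at hL
    obtain ⟨A, hA, hL⟩ := hL
    obtain ⟨A', hA', hA⟩ := ih hA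
    exact ⟨A', hA', A, hA, hL⟩

/-- Level `m + 3` consists of `m + 2` machines over a set in UP. The upper two become the Σ₂
machine, `m` remain as a tower, and the UP set gives way to a set in P. -/
theorem USigma_subset_Sigma2PromiseUSigma (hS : ∃ S : Lang, Sparse S ∧ TuringHard S UP) (m : ℕ) :
    USigma (m + 3) ⊆ Sigma2PromiseUSigma m := by
  intro L hL
  obtain ⟨U, hU, Ns, hlen, hNs, hun, rfl⟩ := exists_tower hL
  obtain ⟨N₁, N₂, Ns, rfl⟩ : ∃ N₁ N₂ Ns', Ns = N₁ :: N₂ :: Ns' := by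
    match Ns, hlen with
    | N₁ :: N₂ :: Ns', _ => exact ⟨N₁, N₂, Ns', rfl⟩
  have hNs' : ∀ N ∈ Ns, IsNPOM N := fun N hN => hNs N (by simp [hN])
  obtain ⟨M₁, M₂, E, hM₁, hM₂, hE, e, hg⟩ := collapse hS hU (hNs N₁ (by simp)) (hNs N₂ (by simp)) hNs'
  refine ⟨M₁, M₂, Ns.map (primeM []), langOf ∅ E, hM₁, hM₂, ⟨by simpa using hlen, ?_, E, hE, rfl⟩,
    e, hg hun.2⟩
  intro N hN
  obtain ⟨N', hN', rfl⟩ := List.mem_map.1 hN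
  exact isNPOM_primeM (hNs' N' hN') []

/-- Here all `k` machines stay in the tower. Only the bottom is replaced, and the advice is found
once, before the tower is asked. -/
theorem USigma_subset_PPromiseUSigmaJoinSigma2 (hS : ∃ S : Lang, Sparse S ∧ TuringHard S UP)
    (k : ℕ) : USigma (k + 1) ⊆ PPromiseUSigmaJoinSigma2 k := by
  intro L hL
  obtain ⟨U, hU, Ns, hlen, hNs, hun, rfl⟩ := exists_tower hL
  obtain ⟨E, B, hE, hB, -, hBL, p, ⟨pp, hpp⟩, hpF⟩ := exists_advice hS hU
  obtain ⟨r, hr, -, htower⟩ := tower_advice (U := U) (E := langOf ∅ E) Ns hNs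
  -- The tower is started on the input itself, so `r` is evaluated at the input length.
  obtain ⟨e, he⟩ := exists_pow_ge hr
  obtain ⟨d, hd⟩ := exists_pow_ge (f := fun n => p ((n + 2) ^ e))
    (PolyBd.mono (PolyBd.eval pp ((PolyBd.id.add (.const 2)).pow e)) fun n => hpp _)
  have spec := fun x : Str => findM_spec (T := towerLang (langOf ∅ E) (Ns.map (primeM []))) (d := d)
    (hBL ∅) (x := x) ((hpF ((x.length + 2) ^ e)).imp fun F hF => ⟨hF.1.trans (hd _), hF.2⟩)
  refine ⟨findM d, Ns.map (primeM []), langOf ∅ E, prefixes (langOf ∅ B) (verifyM d e),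
    isDPOM_findM d, ⟨by simpa using hlen, ?_, E, hE, rfl⟩, ?_, ?_, ?_⟩
  · intro N hN
    obtain ⟨N', hN', rfl⟩ := List.mem_map.1 hN
    exact isNPOM_primeM (hNs N' hN') []
  -- `B` is an NP machine, and prefixes of accepting paths of an NP machine with this oracle are
  -- again decided by one.
  · exact ⟨langOf ∅ B, ⟨∅, empty_mem_P, B, hB, rfl⟩, preM (verifyM d e),
      (preM_spec (isNPOM_verifyM d e)).1, (langOf_preM (isNPOM_verifyM d e) _).symm⟩
  · ext x
    obtain ⟨F, hF, hx, -⟩ := spec x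
    rw [hx, (htower F x (hF.mono (he _))).1]
  · intro x q hq
    obtain ⟨F, hF, -, hFq⟩ := spec x
    rw [hFq q hq]
    exact (htower F x (hF.mono (he _))).2 hun

/-- The equality in `collapse` holds for arbitrary NP machines, ambiguous or not, over a set in UP;
guardedness plays no role. The remaining set in P is absorbed into the second machine. -/
theorem UP_subset_Low2 (hS : ∃ S : Lang, Sparse S ∧ TuringHard S UP) : UP ⊆ Low2 := by
  intro A hA
  refine ⟨?_, ?_⟩
  · obtain ⟨N, hN, -, h⟩ := hA
    exact ⟨N, hN, h⟩
  · rintro _ ⟨_, ⟨N₂, hN₂, rfl⟩, N₁, hN₁, rfl⟩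
    obtain ⟨M₁, M₂, E, hM₁, hM₂, hE, e, -⟩ := collapse hS hA hN₁ hN₂ (Ns := []) (by simp)
    exact ⟨_, ⟨composeM M₂ E, (composeM_spec hM₂ hE).1, rfl⟩, M₁, hM₁, by
      rw [langOf_composeM hM₂ hE]; exact e⟩

end SparseUP

theorem theorem4p5 (hS : ∃ S : Lang, Sparse S ∧ TuringHard S UP) :
    UP ⊆ Low2 ∧
    ∀ k j : ℕ, 3 ≤ k → j ≤ k - 3 →
      USigma k ⊆
        relTo (USigmaRel j) (Sigma2PromiseUSigma (k - j - 3)) ∩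
          PPromiseUSigmaJoinSigma2 (k - 1) := by
  refine ⟨UP_subset_Low2 hS, fun k j hk hj L hL => ⟨?_, ?_⟩⟩
  -- The bounds on `k` and `j` make the subtractions exact: `j` levels are split off, and the level
  -- below them is collapsed.
  · rw [show k = j + (k - j - 3 + 3) by omega] at hL
    obtain ⟨A, hA, hL⟩ := USigma_add hL
    exact ⟨A, USigma_subset_Sigma2PromiseUSigma hS _ hA, hL⟩
  · rw [show k = k - 1 + 1 by omega] at hL
    exact USigma_subset_PPromiseUSigmaJoinSigma2 hS _ hL
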